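/- **Setting.** Let $\Gamma$ be a finite group, $\Gamma_*$ its set of conjugacy classes (listed in some order $c^0,\dots,c^r$), $\Gamma^*$ its set of irreducible complex characters, and $R(\Gamma)$ the space of complex class functions. For $c\in\Gamma_*$ let $\zeta_c$ be the order of the centralizer of an element of $c$. Let $\xi\in R(\Gamma)$ be self-dual, i.e. $\xi(x^{-1})=\xi(x)$, and put $\langle f,g\rangle_\xi=\frac1{|\Gamma|}\sum_{x\in\Gamma}\xi(x)f(x)g(x^{-1})$ on $R(\Gamma)$. **Groups.** $\tilde S_n$ is the group with generators $z,t_1,\dots,t_{n-1}$ and relations $z^2=1$, $t_i^2=(t_it_{i+1})^3=z$, $t_it_j=zt_jt_i$ $(i>j+1)$, $zt_i=t_iz$; it maps onto $S_n$ by $t_i\mapsto(i,i+1)$, $z\mapsto1$, and to $\mathbb Z/2$ by the parity $d(t_i)=1$, $d(z)=0$. Let $\Gamma_n=\Gamma^n\rtimes S_n$ and $\tilde\Gamma_n=\Gamma^n\rtimes\tilde S_n$, where $\tilde S_n$ acts through $S_n$ by permuting the factors, and where the parity of $(g,t)$ is $d(t)$. The type of $(g,\sigma)\in\Gamma_n$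 is the partition-valued function $\rho$ on $\Gamma_*$ such that $\rho(c)$ lists the lengths of the cycles $(i_1\cdots i_k)$ of $\sigma$ (fixed points included) with cycle product $g_{i_k}\cdots g_{i_1}\in c$; the type of an element of $\tilde\Gamma_n$ is that of its image in $\Gamma_n$. Let $R^-(\tilde\Gamma_n)$ be the space of class functions $f:\tilde\Gamma_n\to\mathbb C$ with $f(zx)=-f(x)$ that vanish on all odd elements, and let $R^-_\Gamma=\bigoplus_{n\ge0}R^-(\tilde\Gamma_n)$, with the form $$\langle u,v\rangle_\xi=\sum_{n\ge0}\frac1{|\tilde\Gamma_n|}\sum_{x\in\tilde\Gamma_n}\eta_n(\xi)(x)\,u_n(x)\,v_n(x^{-1}),\qquad \eta_n(\xi)(x)=\prod_{c\in\Gamma_*}\xi(c)^{l(\rho(c))}\ \text{ for } x \text{ of type }\rho .$$ **Fock space.** Let $S^-_\Gamma$ be the symmetric algebra over $\mathbb C$ on the symbols $a_{-n}(\gamma)$, with $n>0$ odd and $\gamma\in\Gamma^*$. For odd $n>0$ let $a_{-n}(\gamma)$ act on $S^-_\Gamma$ by multiplication, and let $a_n(\gamma)$ act as the derivation with $a_n(\gamma)\cdot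 a_{-m}(\alpha)=\delta_{n,m}\frac n2\langle\gamma,\alpha\rangle_\xi$. Put $a_{-n}(c)=\sum_{\gamma\in\Gamma^*}\gamma(c^{-1})a_{-n}(\gamma)$ for $c\in\Gamma_*$. **Characteristic map.** Let $\mathcal{OP}_n(\Gamma_*)$ be the set of partition-valued functions $\rho$ on $\Gamma_*$ all of whose parts are odd and with $\sum_c|\rho(c)|=n$. Write $l(\rho)=\sum_cl(\rho(c))$, $\bar\rho(c)=\rho(c^{-1})$, $a'_{-\rho}=\prod_c\prod_ia_{-\rho(c)_i}(c)$, $Z_\rho=\prod_cz_{\rho(c)}\zeta_c^{l(\rho(c))}$, where $z_\lambda=\prod_{i}i^{m_i}m_i!$ if $\lambda$ has $m_i$ parts equal to $i$. Fix a normalization $\varepsilon:\mathbb N\to\mathbb N$ of lifted cycles: $[a,a+1,\dots,a+m-1]=z^{\varepsilon(m)}t_at_{a+1}\cdots t_{a+m-2}\in\tilde S_n$ (for instance $\varepsilon(m)=m-1$). Let $t^\rho\in\tilde S_n$ be the product of the lifted cycles on consecutive intervals of $1,\dots,n$ whose lengths are the parts of $\rho(c^0)$ in decreasing order, then those of $\rho(c^1)$,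 and so on, and let $D^+_\rho$ be the conjugacy class of the elements $(g,t^\rho)\in\tilde\Gamma_n$ of type $\rho$. For $f\in R^-(\tilde\Gamma_n)$ let $f(\rho)$ be the value of $f$ on $D_\rho^+$. The characteristic map $\mathrm{ch}:R^-_\Gamma\to S^-_\Gamma$ is the linear map with $$\mathrm{ch}(f)=\sum_{\rho\in\mathcal{OP}_n(\Gamma_*)}\frac{2^{l(\rho)/2}}{Z_\rho}\,f(\rho)\,a'_{-\bar\rho}\qquad(f\in R^-(\tilde\Gamma_n)).$$ **Theorem.** For every order of $\Gamma_*$, every normalization $\varepsilon$ and every self-dual $\xi\in R(\Gamma)$: 1. there is exactly one bilinear form $\langle\,,\rangle'_\xi$ on $S^-_\Gamma$ such that $\langle1,1\rangle'_\xi=1$ and $\langle a_n(\gamma)u,v\rangle'_\xi=\langle u,a_{-n}(\gamma)v\rangle'_\xi$ for all odd integers $n$, all $\gamma\in\Gamma^*$ and all $u,v\in S_\Gamma^-$; 2. $\mathrm{ch}$ is an isometry from $(R^-_\Gamma,\langle\,,\rangle_\xi)$ to $(S^-_\Gamma,\langle\,,\rangle'_\xi)$: it is bijective and $\langle\mathrm{ch}(u),\mathrm{ch}(v)\rangle'_\xi=\langle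 u,v\rangle_\xi$ for all $u,v\in R^-_\Gamma$. -/

import Mathlib

open Equiv

noncomputable section

namespace SpinWreath

universe u

/-! ## The spin group -/

/-- Generators of the spin group: the central element `z` and `t i`.  The index set `{1, …, n-1}`
of the `t`'s is written as `Fin (n - 1) = {0, …, n-2}`, so `t i` covers the transposition of the
points `i` and `i + 1` of `Fin n = {0, …, n-1}`. -/
inductive SpinGen (n : ℕ) : Type
  | z : SpinGen n
  | t : Fin (n - 1) → SpinGen n

/-- The generator `z` in the free group. -/
def freeZ (n : ℕ) : FreeGroup (SpinGen n) := FreeGroup.of SpinGen.z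

/-- The generator `t i` in the free group. -/
def freeT {n : ℕ} (i : Fin (n - 1)) : FreeGroup (SpinGen n) := FreeGroup.of (SpinGen.t i)

/-- The relations `z² = 1`, `t_i² = z`, `(t_i t_{i+1})³ = z`, `t_i t_j = z t_j t_i` for `i > j+1`,
`z t_i = t_i z`. -/
inductive SpinRel (n : ℕ) : FreeGroup (SpinGen n) → Prop
  | z_sq : SpinRel n (freeZ n ^ 2)
  | t_sq (i : Fin (n - 1)) : SpinRel n (freeT i ^ 2 * (freeZ n)⁻¹)
  | braid (i j : Fin (n - 1)) (h : (j : ℕ) = i + 1) :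
      SpinRel n ((freeT i * freeT j) ^ 3 * (freeZ n)⁻¹)
  | comm (i j : Fin (n - 1)) (h : (i : ℕ) > j + 1) :
      SpinRel n (freeT i * freeT j * (freeZ n * freeT j * freeT i)⁻¹)
  | z_comm (i : Fin (n - 1)) : SpinRel n (freeZ n * freeT i * (freeT i * freeZ n)⁻¹)

/-- The spin group `S̃_n`, a double cover of the symmetric group. -/
abbrev SpinSym (n : ℕ) : Type := PresentedGroup {r | SpinRel n r}

/-- The central element `z` of `S̃_n`. -/
def spinZ (n : ℕ) : SpinSym n := PresentedGroup.of SpinGen.z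

/-- The generator `t_i` of `S̃_n`; only the indices `i + 1 < n` are meaningful. -/
def spinT (n i : ℕ) : SpinSym n :=
  if h : i < n - 1 then PresentedGroup.of (SpinGen.t ⟨i, h⟩) else 1

/-- The images of the generators in the symmetric group. -/
def thetaGen (n : ℕ) : SpinGen n → Perm (Fin n)
  | .z => 1
  | .t i => swap ⟨i, by omega⟩ ⟨i + 1, by omega⟩

theorem swap_braid {α : Type*} [DecidableEq α] {a b c : α} (hab : a ≠ b) (hbc : b ≠ c)
    (hac : a ≠ c) : (swap a b * swap b c) ^ 3 = 1 := by
  ext x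
  simp only [pow_succ, pow_zero, one_mul, Perm.mul_apply, Perm.one_apply, swap_apply_def]
  grind

theorem thetaGen_rel (n : ℕ) :
    ∀ r ∈ {r | SpinRel n r}, FreeGroup.lift (thetaGen n) r = 1 := by
  rintro r (_ | i | ⟨i, j, h⟩ | ⟨i, j, h⟩ | i)
  · simp [freeZ, thetaGen]
  · simp [freeZ, freeT, thetaGen, pow_two]
  · obtain ⟨j, hj⟩ := j
    obtain rfl : j = i + 1 := h
    simp only [freeZ, freeT, map_mul, map_pow, map_inv, FreeGroup.lift_apply_of, thetaGen, inv_one,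
      mul_one]
    apply swap_braid <;> simp only [ne_eq, Fin.ext_iff] <;> omega
  · simp only [freeZ, freeT, map_mul, map_inv, FreeGroup.lift_apply_of, thetaGen, one_mul]
    rw [mul_inv_eq_one]
    have : Perm.Disjoint (swap (⟨i, by omega⟩ : Fin n) ⟨i + 1, by omega⟩)
        (swap (⟨j, by omega⟩ : Fin n) ⟨j + 1, by omega⟩) := by
      intro x
      simp only [swap_apply_def, Fin.ext_iff]
      grind
    exact this.commute
  · simp [freeZ, freeT, thetaGen]

/-- The projection `θ_n : S̃_n → S_n`. -/
def theta (n : ℕ) : SpinSym n →* Perm (Fin n) := PresentedGroup.toGroup (thetaGen_rel n)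

/-- The parities of the generators: `d(z) = 0`, `d(t_i) = 1`. -/
def parityGen (n : ℕ) : SpinGen n → Multiplicative (ZMod 2)
  | .z => 1
  | .t _ => Multiplicative.ofAdd 1

theorem parityGen_rel (n : ℕ) :
    ∀ r ∈ {r | SpinRel n r}, FreeGroup.lift (parityGen n) r = 1 := by
  rintro r (_ | i | ⟨i, j, h⟩ | ⟨i, j, h⟩ | i) <;>
    simp only [freeZ, freeT, map_mul, map_pow, map_inv, FreeGroup.lift_apply_of, parityGen] <;>
    decide

/-- The parity homomorphism `d : S̃_n → ℤ/2`. -/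
def spinParity (n : ℕ) : SpinSym n →* Multiplicative (ZMod 2) :=
  PresentedGroup.toGroup (parityGen_rel n)

/-! ## Wreath products -/

/-- The symmetric group permuting the factors of `Γ^n`: `(s g)_i = g_{s⁻¹ i}`. -/
abbrev permAct (Γ : Type u) [Group Γ] (n : ℕ) : Perm (Fin n) →* MulAut (Fin n → Γ) := mulAutArrow

/-- The wreath product `Γ_n = Γ^n ⋊ S_n`. -/
abbrev Wr (Γ : Type u) [Group Γ] (n : ℕ) : Type u := (Fin n → Γ) ⋊[permAct Γ n] Perm (Fin n)

/-- The spin wreath product `Γ̃_n = Γ^n ⋊ S̃_n`, with `S̃_n` acting through `S_n`.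
It is a finite group, of order `2 n! |Γ|^n`. -/
abbrev SpinWr (Γ : Type u) [Group Γ] (n : ℕ) : Type u :=
  (Fin n → Γ) ⋊[(permAct Γ n).comp (theta n)] SpinSym n

/-! ## Class functions on `Γ`, conjugacy classes, irreducible characters -/

section ClassFunctions

variable {G : Type u} [Group G]

/-- The space `R(G)` of complex class functions on `G`. -/
def classFun (G : Type u) [Group G] : Submodule ℂ (G → ℂ) where
  carrier := {f | ∀ x y : G, IsConj x y → f x = f y}
  zero_mem' := by intro x y _; rfl
  add_mem' := by intro f g hf hg x y h; simp [hf x y h, hg x y h]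
  smul_mem' := by intro a f hf x y h; simp [hf x y h]

/-- The value of a class function at a conjugacy class. -/
def atClass (f : classFun G) (c : ConjClasses G) : ℂ :=
  Quotient.liftOn c f.1 f.2

/-- The class `c⁻¹` of the inverses of the elements of `c`. -/
def invClass (c : ConjClasses G) : ConjClasses G :=
  Quotient.map (fun x : G => x⁻¹) (by
    intro a b h
    obtain ⟨g, hg⟩ := isConj_iff.1 h
    exact isConj_iff.2 ⟨g, by rw [← hg]; group⟩) c

/-- `ζ_c`: the order of the centralizer of an element of the class `c`. -/
def zeta (c : ConjClasses G) : ℕ := Nat.card (Subgroup.centralizer {(Quotient.out c : G)})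

/-- The weighted bilinear form `⟨f, g⟩_ξ = |G|⁻¹ ∑_x ξ(x) f(x) g(x⁻¹)` on `R(G)`. -/
def wForm [Fintype G] (ξ f g : classFun G) : ℂ :=
  (Nat.card G : ℂ)⁻¹ * ∑ x : G, ξ.1 x * f.1 x * g.1 x⁻¹

/-- `G^*`: the set of irreducible complex characters of `G`, as class functions. -/
abbrev Irr (G : Type u) [Group G] : Type u :=
  {χ : classFun G // ∃ (m : ℕ) (π : Representation ℂ G (Fin m → ℂ)),
    π.IsIrreducible ∧ ∀ x, χ.1 x = π.character x}

open Classical in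
theorem irr_orthonormal [Fintype G] (χ ψ : Irr G) :
    (Nat.card G : ℂ)⁻¹ * ∑ x : G, χ.1.1 x * ψ.1.1 x⁻¹ = if χ = ψ then 1 else 0 := by
  obtain ⟨χ, m, π, hπ, h⟩ := χ
  obtain ⟨ψ, k, σ, hσ, h'⟩ := ψ
  have hc : (Nat.card G : ℂ) ≠ 0 := by exact_mod_cast Nat.card_pos.ne'
  have : Invertible (Nat.card G : ℂ) := invertibleOfNonzero hc
  have key := Representation.char_orthonormal π σ
  simp only [h, h']
  rw [key]
  by_cases he : χ = ψ
  · subst he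
    have hch : σ.character = π.character := by
      funext x; rw [← h, ← h']
    have h1 := Representation.char_orthonormal π π
    rw [if_pos ⟨Representation.Equiv.refl _⟩] at h1
    rw [hch, h1] at key
    rw [← key, if_pos rfl]
  · have : ¬ Nonempty (Representation.Equiv σ π) := by
      rintro ⟨φ⟩
      apply he
      apply Subtype.ext
      funext x
      rw [h, h', Representation.char_iso φ]
    rw [if_neg this, if_neg]
    exact fun h => he (congrArg Subtype.val h)

instance irr_finite [Finite G] : Finite (Irr G) := by
  classical
  have := Fintype.ofFinite G
  have hli : LinearIndependent ℂ (fun χ : Irr G => χ.1.1) := by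
    rw [linearIndependent_iff']
    intro s a ha ψ hψ
    have h1 : (Nat.card G : ℂ)⁻¹ * ∑ x : G, (∑ χ ∈ s, a χ • χ.1.1) x * ψ.1.1 x⁻¹ = 0 := by
      rw [ha]; simp
    have h2 : (Nat.card G : ℂ)⁻¹ * ∑ x : G, (∑ χ ∈ s, a χ • χ.1.1) x * ψ.1.1 x⁻¹
        = ∑ χ ∈ s, a χ * ((Nat.card G : ℂ)⁻¹ * ∑ x : G, χ.1.1 x * ψ.1.1 x⁻¹) := by
      simp only [Finset.sum_apply, Pi.smul_apply, smul_eq_mul, Finset.sum_mul, Finset.mul_sum]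
      rw [Finset.sum_comm]
      refine Finset.sum_congr rfl fun χ _ => Finset.sum_congr rfl fun x _ => by ring
    rw [h2] at h1
    simp only [irr_orthonormal, mul_ite, mul_one, mul_zero] at h1
    rw [Finset.sum_ite_eq' s ψ a, if_pos hψ] at h1
    exact h1
  exact hli.finite

instance irr_fintype [Finite G] : Fintype (Irr G) := Fintype.ofFinite _

instance conj_fintype [Finite G] : Fintype (ConjClasses G) := Fintype.ofFinite _

end ClassFunctions

/-! ## Partition-valued functions with odd parts -/

/-- The odd positive integers. -/
abbrev OddNat : Type := {m : ℕ // Odd m}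

/-- `OP(Γ_*)`: the functions on the set of conjugacy classes of `Γ` whose values are partitions
with odd parts, a partition being the multiset of its parts. -/
abbrev OP (Γ : Type u) [Group Γ] : Type u := ConjClasses Γ → Multiset OddNat

section Partitions

variable {Γ : Type u} [Group Γ]

/-- The function `ρ̄(c) = ρ(c⁻¹)`. -/
def OP.bar (ρ : OP Γ) : OP Γ := fun c => ρ (invClass c)

/-- The size `‖ρ‖`. -/
def OP.size [Finite Γ] (ρ : OP Γ) : ℕ := ∑ c, ((ρ c).map Subtype.val).sum

/-- The length `l(ρ)`, the total number of parts. -/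
def OP.len [Finite Γ] (ρ : OP Γ) : ℕ := ∑ c, (ρ c).card

/-- `OP_n(Γ_*)`. -/
abbrev OPn (Γ : Type u) [Group Γ] [Finite Γ] (n : ℕ) : Type u := {ρ : OP Γ // ρ.size = n}

theorem finite_oddMultiset (n : ℕ) :
    {s : Multiset OddNat | (s.map Subtype.val).sum ≤ n}.Finite := by
  classical
  have hodd : Finite {m : OddNat // m.1 ≤ n} :=
    Finite.of_injective (fun m => (⟨m.1.1, by have := m.2; omega⟩ : Fin (n + 1)))
      (by intro a b h; simpa [Subtype.ext_iff] using h)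
  have hfin : {m : OddNat | m.1 ≤ n}.Finite := Set.finite_coe_iff.1 hodd
  refine (Set.finite_Iic (n • hfin.toFinset.val)).subset ?_
  intro s hs
  rw [Set.mem_Iic, Multiset.le_iff_count]
  intro a
  by_cases ha : a ∈ s
  · have h1 : a.1 ≤ n := le_trans (Multiset.le_sum_of_mem (Multiset.mem_map_of_mem _ ha)) hs
    have h2 : s.card ≤ (s.map Subtype.val).sum := by
      have := Multiset.card_nsmul_le_sum (s := s.map (Subtype.val : OddNat → ℕ)) (a := 1) (by
        intro x hx
        obtain ⟨y, _, rfl⟩ := Multiset.mem_map.1 hx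
        exact y.2.pos)
      simpa using this
    have h3 : s.count a ≤ n := (Multiset.count_le_card a s).trans (h2.trans hs)
    have h4 : Multiset.count a hfin.toFinset.val = 1 :=
      Multiset.count_eq_one_of_mem hfin.toFinset.nodup (by simpa using h1)
    simpa [Multiset.count_nsmul, h4] using h3
  · simp [Multiset.count_eq_zero_of_notMem ha]

instance opn_finite [Finite Γ] (n : ℕ) : Finite (OPn Γ n) := by
  have h : {ρ : OP Γ | ∀ c, ρ c ∈ {s : Multiset OddNat | (s.map Subtype.val).sum ≤ n}}.Finite :=
    Set.Finite.pi' fun _ => finite_oddMultiset n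
  refine (h.subset ?_).to_subtype
  intro ρ hρ c
  have hρ' : OP.size ρ = n := hρ
  rw [← hρ']
  exact Finset.single_le_sum (f := fun c => ((ρ c).map Subtype.val).sum)
    (fun _ _ => Nat.zero_le _) (Finset.mem_univ c)

instance opn_fintype [Finite Γ] (n : ℕ) : Fintype (OPn Γ n) := Fintype.ofFinite _

/-- `z_λ = ∏_i i^{m_i} m_i!`. -/
def zPart (s : Multiset OddNat) : ℕ :=
  ∏ i ∈ s.toFinset, i.1 ^ s.count i * (s.count i).factorial

/-- `Z_ρ = ∏_c z_{ρ(c)} ζ_c^{l(ρ(c))}`. -/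
def OP.Z [Finite Γ] (ρ : OP Γ) : ℕ := ∏ c, zPart (ρ c) * zeta c ^ (ρ c).card

/-! ## Types of elements -/

/-- For a cycle of `σ` through `i`, of length `k`, the cycle product
`g_{σ^{k-1} i} ⋯ g_{σ i} g_i`. -/
def cycleProd {n : ℕ} (x : Wr Γ n) (i : Fin n) : Γ :=
  ((List.range (Function.minimalPeriod x.right i)).reverse.map
    fun j => x.left ((x.right ^ j) i)).prod

/-- The cycles of a permutation, including the fixed points. -/
abbrev Cycles {n : ℕ} (σ : Perm (Fin n)) : Type := Quotient (Perm.SameCycle.setoid σ)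

instance cycles_fintype {n : ℕ} (σ : Perm (Fin n)) : Fintype (Cycles σ) := Fintype.ofFinite _

open Classical in
/-- The type of an element `x = (g, σ)` of `Γ_n`: the partition `ρ(c)` consists of the lengths of
the cycles of `σ` whose cycle product lies in `c`.  The class of the cycle product does not depend
on the point of the cycle at which one starts. -/
def typeOf {n : ℕ} (x : Wr Γ n) (c : ConjClasses Γ) : Multiset ℕ :=
  (Finset.univ.filter fun q : Cycles x.right => ConjClasses.mk (cycleProd x q.out) = c).val.map
    fun q => Function.minimalPeriod x.right q.out

/-- The projection `Γ̃_n → Γ_n`. -/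
def proj {n : ℕ} (x : SpinWr Γ n) : Wr Γ n := ⟨x.left, theta n x.right⟩

/-- The element `z` of `Γ̃_n`. -/
def wrZ (Γ : Type u) [Group Γ] (n : ℕ) : SpinWr Γ n := SemidirectProduct.inr (spinZ n)

/-! ## The split classes `D_ρ^+` -/

/-- The lift `z^{ε(m)} t_a t_{a+1} ⋯ t_{a+m-2}` of the cycle `(a, a+1, …, a+m-1)`. The function `ε`
fixes the normalization of the lifted cycles, which only depends on their length. -/
def cycleLift (ε : ℕ → ℕ) (n a m : ℕ) : SpinSym n :=
  spinZ n ^ ε m * ((List.range (m - 1)).map fun k => spinT n (a + k)).prod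

/-- The product of the lifted cycles on consecutive intervals of lengths `L`, the first of which
starts at the point `a`. -/
def blockElt (ε : ℕ → ℕ) (n : ℕ) : ℕ → List ℕ → SpinSym n
  | _, [] => 1
  | a, m :: L => cycleLift ε n a m * blockElt ε n (a + m) L

/-- The list of all parts of `ρ`: first those of `ρ(c^0)`, then those of `ρ(c^1)`, and so on, the
parts of each partition in decreasing order. -/
def partList {r : ℕ} (e : Fin r ≃ ConjClasses Γ) (ρ : OP Γ) : List ℕ :=
  (List.ofFn e).flatMap fun c => ((ρ c).map Subtype.val).sort (· ≥ ·)

/-- The special element `t^ρ` of `S̃_n`. -/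
def specialElt (ε : ℕ → ℕ) {r : ℕ} (e : Fin r ≃ ConjClasses Γ) (n : ℕ) (ρ : OP Γ) : SpinSym n :=
  blockElt ε n 0 (partList e ρ)

/-- The conjugacy class `D_ρ^+` of `Γ̃_n`: that of the elements `(g, t^ρ)` of type `ρ`. -/
def Dplus (ε : ℕ → ℕ) {r : ℕ} (e : Fin r ≃ ConjClasses Γ) (n : ℕ) (ρ : OP Γ) :
    Set (SpinWr Γ n) :=
  {x | ∃ g : Fin n → Γ, IsConj (⟨g, specialElt ε e n ρ⟩ : SpinWr Γ n) x ∧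
    ∀ c, typeOf (proj (⟨g, specialElt ε e n ρ⟩ : SpinWr Γ n)) c = (ρ c).map Subtype.val}

open Classical in
/-- An element of the (nonempty) class `D_ρ^+`. -/
def classRep (ε : ℕ → ℕ) {r : ℕ} (e : Fin r ≃ ConjClasses Γ) (n : ℕ) (ρ : OP Γ) : SpinWr Γ n :=
  if h : (Dplus ε e n ρ).Nonempty then h.some else 1

/-! ## The space of spin super class functions -/

/-- `R^-(Γ̃_n)`: class functions `f` on `Γ̃_n` with `f(zx) = -f(x)` that vanish on the odd elements.
(On the odd elements `x` that are conjugate to `zx` they vanish anyway, so that the last condition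
concerns the odd split classes.) -/
def Rminus (Γ : Type u) [Group Γ] (n : ℕ) : Submodule ℂ (SpinWr Γ n → ℂ) where
  carrier := {f | (∀ x y, IsConj x y → f x = f y) ∧ (∀ x, f (wrZ Γ n * x) = -f x) ∧
    ∀ x, spinParity n x.right = Multiplicative.ofAdd 1 → f x = 0}
  zero_mem' := by refine ⟨?_, ?_, ?_⟩ <;> intros <;> simp
  add_mem' := by
    rintro f g ⟨hf1, hf2, hf3⟩ ⟨hg1, hg2, hg3⟩
    refine ⟨fun x y h => ?_, fun x => ?_, fun x h => ?_⟩
    · simp [hf1 x y h, hg1 x y h]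
    · simp only [Pi.add_apply, hf2 x, hg2 x]; ring
    · simp [hf3 x h, hg3 x h]
  smul_mem' := by
    rintro a f ⟨hf1, hf2, hf3⟩
    refine ⟨fun x y h => ?_, fun x => ?_, fun x h => ?_⟩
    · simp [hf1 x y h]
    · simp [hf2 x]
    · simp [hf3 x h]

/-- `R^-_Γ = ⨁_{n ≥ 0} R^-(Γ̃_n)`. -/
abbrev RminusSum (Γ : Type u) [Group Γ] : Type u := DirectSum ℕ fun n => Rminus Γ n

/-- `η_n(ξ)`, the class function on `Γ_n` with value `∏_c ξ(c)^{l(ρ(c))}` at the elements of type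
`ρ`. -/
def eta [Finite Γ] (ξ : classFun Γ) {n : ℕ} (x : Wr Γ n) : ℂ :=
  ∏ c, atClass ξ c ^ (typeOf x c).card

/-- The weighted bilinear form `⟨f, g⟩_{ξ,n} = ⟨η_n(ξ) * f, g⟩`, where
`⟨f, g⟩ = |Γ̃_n|⁻¹ ∑_x f(x) g(x⁻¹)`. -/
def wFormN [Finite Γ] (ξ : classFun Γ) (n : ℕ) (f g : Rminus Γ n) : ℂ :=
  (Nat.card (SpinWr Γ n) : ℂ)⁻¹ * ∑ᶠ x : SpinWr Γ n, (eta ξ (proj x) * f.1 x) * g.1 x⁻¹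

/-- The weighted bilinear form `⟨u, v⟩_ξ = ∑_n ⟨u_n, v_n⟩_{ξ,n}` on `R^-_Γ` (a finite sum). -/
def wFormSum [Finite Γ] (ξ : classFun Γ) (u v : RminusSum Γ) : ℂ :=
  ∑ᶠ n : ℕ, wFormN ξ n (u n) (v n)

/-! ## The Fock space -/

/-- `S^-_Γ`: the symmetric algebra on the symbols `a_{-n}(γ)` with `n` odd and positive and `γ` an
irreducible character of `Γ`. -/
abbrev Fock (Γ : Type u) [Group Γ] : Type u := MvPolynomial (OddNat × Irr Γ) ℂ

/-- The generator `a_{-n}(γ)`. -/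
def gen (n : OddNat) (γ : Irr Γ) : Fock Γ := MvPolynomial.X (n, γ)

/-- The action of the element `a_n(γ)` of the twisted Heisenberg algebra, `n` an odd integer: for
`n < 0`, multiplication by the generator `a_n(γ)`; for `n > 0`, the derivation that maps the
generator `a_{-m}(α)` to `δ_{n,m} (n/2) ⟨γ, α⟩_ξ`.  The central element acts as the identity. -/
def heis [Fintype Γ] (ξ : classFun Γ) (n : ℤ) (hn : Odd n) (γ : Irr Γ) :
    Fock Γ →ₗ[ℂ] Fock Γ :=
  if n < 0 then LinearMap.mulLeft ℂ (gen ⟨n.natAbs, Int.natAbs_odd.2 hn⟩ γ)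
  else (MvPolynomial.mkDerivation ℂ fun p : OddNat × Irr Γ =>
    if (p.1.1 : ℤ) = n then MvPolynomial.C ((n : ℂ) / 2 * wForm ξ γ.1 p.2.1)
    else (0 : Fock Γ)).toLinearMap

/-- The conditions `⟨1, 1⟩' = 1` and `a_n(γ)^* = a_{-n}(γ)` that determine the form `⟨,⟩'_ξ`. -/
def IsFockForm [Fintype Γ] (ξ : classFun Γ) (B : LinearMap.BilinForm ℂ (Fock Γ)) : Prop :=
  B 1 1 = 1 ∧ ∀ (n : ℤ) (hn : Odd n) (γ : Irr Γ) (u v : Fock Γ),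
    B (heis ξ n hn γ u) v = B u (heis ξ (-n) hn.neg γ v)

/-- `a_{-n}(c) = ∑_γ γ(c⁻¹) a_{-n}(γ)`. -/
def genClass [Finite Γ] (n : OddNat) (c : ConjClasses Γ) : Fock Γ :=
  ∑ γ : Irr Γ, atClass γ.1 (invClass c) • gen n γ

/-- `a'_{-ρ} = ∏_c ∏_i a_{-ρ(c)_i}(c)`. -/
def aPrime [Finite Γ] (ρ : OP Γ) : Fock Γ := ∏ c, ((ρ c).map fun n => genClass n c).prod

/-! ## The characteristic map -/

/-- The component of degree `n` of the characteristic map,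
`f ↦ ∑_ρ 2^{l(ρ)/2} Z_ρ⁻¹ f(ρ) a'_{-ρ̄}` with `ρ` in `OP_n(Γ_*)` and `f(ρ) = f(D_ρ^+)`. -/
def chN [Finite Γ] (ε : ℕ → ℕ) {r : ℕ} (e : Fin r ≃ ConjClasses Γ) (n : ℕ) :
    Rminus Γ n →ₗ[ℂ] Fock Γ where
  toFun f := ∑ ρ : OPn Γ n,
    (((Real.sqrt 2 : ℝ) : ℂ) ^ ρ.1.len / (ρ.1.Z : ℂ) * f.1 (classRep ε e n ρ.1)) • aPrime ρ.1.bar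
  map_add' f g := by
    simp only [Submodule.coe_add, Pi.add_apply, mul_add, add_smul, Finset.sum_add_distrib]
  map_smul' a f := by
    simp only [Submodule.coe_smul, Pi.smul_apply, smul_eq_mul, Finset.smul_sum, smul_smul,
      RingHom.id_apply]
    refine Finset.sum_congr rfl fun ρ _ => ?_
    congr 1
    ring

/-- The characteristic map `ch : R^-_Γ → S^-_Γ`. -/
def ch [Finite Γ] (ε : ℕ → ℕ) {r : ℕ} (e : Fin r ≃ ConjClasses Γ) :
    RminusSum Γ →ₗ[ℂ] Fock Γ :=
  DirectSum.toModule ℂ ℕ (Fock Γ) (chN ε e)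

end Partitions

end SpinWreath

end

noncomputable section

namespace SpinWreath

universe u

/-! ## Relations in the spin group -/

section SpinGroup

variable {n : ℕ}

/-! Both forms become explicit in bases indexed by the partition-valued functions `ρ` with odd
parts, and `ch` matches the two bases up to scalars.

Group side. `spinZ_ne_one` (a Clifford algebra) and `eq_one_or_eq_spinZ` (a coset enumeration) show
that `theta n` is a genuine double cover. Lifts of disjoint permutations commute up to `z` raised to
the product of their parities (`superCommute_of_disjoint`). Hence an even element whose permutation
has a cycle of even length is conjugate to its product with `z` (`isConj_wrZ_mul`), and every
function in `Rminus` vanishes there. If all cycles have odd length, the permutation has odd order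
and exactly one of its two lifts has odd order; `liftSign` records which, and it is a class
function. Elements of the wreath product are conjugate exactly when their types agree, and the
centralizer of an element of type `ρ` has order `Z_ρ`. So a function in `Rminus` is a free choice of
values `f(ρ)`, and the group form is the sum over `ρ` of `Z_ρ⁻¹ ∏ ξ(c)^{l(ρ(c))} f(ρ) g(ρ̄)`
(`wFormN_eq`). The delicate point is that inversion maps `D_ρ^+` to `D_ρ̄^+` without a sign, for
every order of the classes and every `ε`. This holds because the sign of `t^ρ` depends only on the
multiset of its block lengths (`liftSign_blockElt`), and `liftSign` is invariant under inversion.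

Fock side. By the orthogonality relations the `a_{-n}(c)` are again free polynomial generators
(`fockEquiv`); the second relation rests on the completeness of the irreducible characters
(`classFun_eq_zero`). In these variables `a_n(γ)` is the derivation `∑_c (n/2) ξ(c) γ(c)
∂/∂a_{-n}(c⁻¹)`, so the form can be written down: a monomial pairs only with its image under `c ↦
c⁻¹`, with value `Z_ρ 2^{-l(ρ)} ∏ ξ(c)^{l(ρ(c))}` (`polyForm`, `monoWeight_exponent`). Uniqueness is
the usual vacuum argument.

Comparison. The two coefficients `2^{l/2}/Z_ρ` of `ch` times `Z_ρ 2^{-l}` give `Z_ρ⁻¹`, which is the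
isometry (`fockForm_chN_ch`). Bijectivity holds because all coefficients of `ch` are nonzero and the
products `a'_{-ρ}` form a basis. -/

theorem spinZ_mul_self (n : ℕ) : spinZ n * spinZ n = 1 := by
  have := PresentedGroup.one_of_mem (rels := {r | SpinRel n r}) SpinRel.z_sq
  rw [pow_two, map_mul] at this
  exact this

theorem spinT_of_lt {i : ℕ} (h : i < n - 1) :
    spinT n i = PresentedGroup.of (SpinGen.t ⟨i, h⟩) := dif_pos h

theorem spinT_mul_self {i : ℕ} (h : i < n - 1) : spinT n i * spinT n i = spinZ n := by
  have := PresentedGroup.one_of_mem (rels := {r | SpinRel n r}) (SpinRel.t_sq ⟨i, h⟩)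
  rw [map_mul, map_inv, mul_inv_eq_one] at this
  rw [spinT_of_lt h, ← pow_two]
  exact this

theorem spinT_braid_pow {i : ℕ} (h : i + 1 < n - 1) :
    (spinT n i * spinT n (i + 1)) ^ 3 = spinZ n := by
  have := PresentedGroup.one_of_mem (rels := {r | SpinRel n r})
    (SpinRel.braid ⟨i, by omega⟩ ⟨i + 1, h⟩ rfl)
  rw [map_mul, map_inv, mul_inv_eq_one] at this
  rw [spinT_of_lt h, spinT_of_lt (by omega : i < n - 1)]
  exact this

theorem spinT_comm {i j : ℕ} (hi : i < n - 1) (h : j + 1 < i) :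
    spinT n i * spinT n j = spinZ n * spinT n j * spinT n i := by
  have := PresentedGroup.one_of_mem (rels := {r | SpinRel n r})
    (SpinRel.comm ⟨i, hi⟩ ⟨j, by omega⟩ h)
  rw [map_mul, map_inv, mul_inv_eq_one] at this
  rw [spinT_of_lt hi, spinT_of_lt (by omega : j < n - 1)]
  exact this

theorem spinSym_closure (n : ℕ) :
    Subgroup.closure (Set.range (PresentedGroup.of (rels := {r | SpinRel n r}))) = ⊤ :=
  PresentedGroup.closure_range_of _

theorem spinZ_mem_center (n : ℕ) : spinZ n ∈ Subgroup.center (SpinSym n) := by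
  have h : (⊤ : Subgroup (SpinSym n)) ≤ Subgroup.centralizer {spinZ n} := by
    rw [← spinSym_closure, Subgroup.closure_le]
    rintro _ ⟨x, rfl⟩
    rw [SetLike.mem_coe, Subgroup.mem_centralizer_singleton_iff]
    cases x with
    | z => rfl
    | t i =>
      have := PresentedGroup.one_of_mem (rels := {r | SpinRel n r}) (SpinRel.z_comm i)
      rw [map_mul, map_inv, mul_inv_eq_one] at this
      exact this.symm
  rw [Subgroup.mem_center_iff]
  intro g
  exact (Subgroup.mem_centralizer_singleton_iff.1 (h (Subgroup.mem_top g)))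

theorem spinZ_comm (s : SpinSym n) : s * spinZ n = spinZ n * s :=
  Subgroup.mem_center_iff.1 (spinZ_mem_center n) s

theorem spinZ_commute (s : SpinSym n) : Commute (spinZ n) s := (spinZ_comm s).symm

theorem spinZ_inv (n : ℕ) : (spinZ n)⁻¹ = spinZ n :=
  inv_eq_of_mul_eq_one_left (spinZ_mul_self n)

theorem spinT_inv {i : ℕ} (h : i < n - 1) : (spinT n i)⁻¹ = spinZ n * spinT n i := by
  rw [inv_eq_iff_mul_eq_one, ← mul_assoc, spinZ_comm, mul_assoc, spinT_mul_self h, spinZ_mul_self]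

/-- The braid relation in the form `t_i t_{i+1} t_i = t_{i+1} t_i t_{i+1}`. -/
theorem spinT_braid {i : ℕ} (h : i + 1 < n - 1) :
    spinT n i * spinT n (i + 1) * spinT n i = spinT n (i + 1) * spinT n i * spinT n (i + 1) := by
  have h1 := spinT_braid_pow h
  have ha : spinT n i * spinT n i = spinZ n := spinT_mul_self (by omega)
  have hb : spinT n (i + 1) * spinT n (i + 1) = spinZ n := spinT_mul_self h
  have hz : spinZ n * spinZ n = 1 := spinZ_mul_self n
  have ca := spinZ_comm (spinT n i)
  have cb := spinZ_comm (spinT n (i + 1))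
  generalize spinT n i = a at *
  generalize spinT n (i + 1) = b at *
  generalize spinZ n = z at *
  -- Both sides equal `z`: the left one is `(ab)^3`, and `(bab)^2` collapses to `z^3` through `b² =
  -- a² = z`. Cancelling `bab` on the right gives the braid relation.
  have h2 : (a * b * a) * (b * a * b) = (b * a * b) * (b * a * b) := by
    calc (a * b * a) * (b * a * b) = (a * b) ^ 3 := by simp only [pow_succ, pow_zero, one_mul, mul_assoc]
      _ = z := h1
      _ = z * (z * z) := by rw [hz, mul_one]
      _ = (b * a * b) * (b * a * b) := by
        calc z * (z * z) = b * b * (z * z) := by rw [hb]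
          _ = b * (z * b) * z := by rw [← cb]; simp only [mul_assoc]
          _ = b * (a * a * b) * z := by rw [ha]
          _ = b * a * (a * (b * z)) := by simp only [mul_assoc]
          _ = b * a * (z * (a * b)) := by rw [cb, ← mul_assoc a, ca, mul_assoc z]
          _ = _ := by rw [← hb]; simp only [mul_assoc]
  exact mul_right_cancel h2

/-- The universal property of the spin group. -/
theorem exists_spinLift {K : Type*} [Group K] (T : ℕ → K) (Z : K) (hZ : Z * Z = 1)
    (hT : ∀ i < n - 1, T i * T i = Z) (hb : ∀ i, i + 1 < n - 1 → (T i * T (i + 1)) ^ 3 = Z)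
    (hc : ∀ i j, i < n - 1 → j + 1 < i → T i * T j = Z * T j * T i)
    (hZT : ∀ i < n - 1, Z * T i = T i * Z) :
    ∃ φ : SpinSym n →* K, φ (spinZ n) = Z ∧ ∀ i < n - 1, φ (spinT n i) = T i := by
  let f : SpinGen n → K := fun
    | .z => Z
    | .t i => T i
  have hf : ∀ r ∈ {r | SpinRel n r}, FreeGroup.lift f r = 1 := by
    rintro r (_ | i | ⟨i, j, h⟩ | ⟨i, j, h⟩ | i) <;>
      simp only [freeZ, freeT, map_mul, map_pow, map_inv, FreeGroup.lift_apply_of, f,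
        mul_inv_eq_one]
    · rw [pow_two, hZ]
    · rw [pow_two, hT _ i.2]
    · rw [h, hb _ (by have := j.2; omega)]
    · exact hc _ _ i.2 h
    · exact hZT _ i.2
  refine ⟨PresentedGroup.toGroup hf, PresentedGroup.toGroup.of hf, fun i hi => ?_⟩
  rw [spinT_of_lt hi]
  exact PresentedGroup.toGroup.of hf

theorem theta_spinZ (n : ℕ) : theta n (spinZ n) = 1 := PresentedGroup.toGroup.of _

theorem theta_spinT {i : ℕ} (h : i < n - 1) :
    theta n (spinT n i) = swap ⟨i, by omega⟩ ⟨i + 1, by omega⟩ := by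
  rw [spinT_of_lt h]
  exact PresentedGroup.toGroup.of _

theorem parity_spinZ (n : ℕ) : spinParity n (spinZ n) = 1 := PresentedGroup.toGroup.of _

theorem parity_spinT {i : ℕ} (h : i < n - 1) :
    spinParity n (spinT n i) = Multiplicative.ofAdd 1 := by
  rw [spinT_of_lt h]
  exact PresentedGroup.toGroup.of _

/-- Induction on words in the generators of the spin group. -/
theorem spin_induction {p : SpinSym n → Prop} (one : p 1) (z : ∀ s, p s → p (s * spinZ n))
    (t : ∀ s i, i < n - 1 → p s → p (s * spinT n i)) (s : SpinSym n) : p s := by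
  have hs : s ∈ Subgroup.closure (Set.range (PresentedGroup.of (rels := {r | SpinRel n r}))) := by
    rw [spinSym_closure]; exact Subgroup.mem_top s
  have step : ∀ (x : SpinGen n) (s : SpinSym n), p s → p (s * PresentedGroup.of x) := by
    intro x s h
    cases x with
    | z => exact z s h
    | t i =>
      have := t s i i.2 h
      rwa [spinT_of_lt i.2] at this
  induction hs using Subgroup.closure_induction_right with
  | one => exact one
  | mul_right x y _ hy h => obtain ⟨g, rfl⟩ := hy; exact step g x h
  | mul_inv_cancel x y _ hy h =>
    obtain ⟨g, rfl⟩ := hy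
    cases g with
    | z =>
      have : (PresentedGroup.of (rels := {r | SpinRel n r}) SpinGen.z)⁻¹ = spinZ n := spinZ_inv n
      rw [this]
      exact z x h
    | t i =>
      have : (PresentedGroup.of (rels := {r | SpinRel n r}) (SpinGen.t i))⁻¹
          = spinZ n * spinT n i := by
        rw [← spinT_inv i.2, spinT_of_lt i.2]
      rw [this, ← mul_assoc]
      exact t _ i i.2 (z x h)

theorem theta_surjective (n : ℕ) : Function.Surjective (theta n) := by
  intro σ
  rw [← MonoidHom.mem_range]
  rcases n with _ | n
  · rw [Subsingleton.elim σ 1]; exact one_mem _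
  have h : Subgroup.closure (Set.range fun i : Fin n => swap i.castSucc i.succ) ≤
      (theta (n + 1)).range := by
    rw [Subgroup.closure_le]
    rintro _ ⟨i, rfl⟩
    exact ⟨spinT (n + 1) i, theta_spinT (n := n + 1) (i := i) (by simp)⟩
  have h2 := Equiv.Perm.mclosure_swap_castSucc_succ n
  have h3 : σ ∈ Subgroup.closure (Set.range fun i : Fin n => swap i.castSucc i.succ) :=
    Subgroup.le_closure_toSubmonoid _ (h2 ▸ Submonoid.mem_top σ)
  exact h h3

/-- The homomorphism from `ℤ/2` onto the signs. -/
def signOfParity : Multiplicative (ZMod 2) →* ℤˣ where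
  toFun a := if a = 1 then 1 else -1
  map_one' := by simp
  map_mul' := by decide

theorem sign_theta (s : SpinSym n) : Perm.sign (theta n s) = signOfParity (spinParity n s) := by
  induction s using spin_induction with
  | one => simp
  | z s h => rw [map_mul, map_mul, map_mul, map_mul, h, theta_spinZ, parity_spinZ]; simp
  | t s i hi h =>
    rw [map_mul, map_mul, map_mul, map_mul, h, theta_spinT hi, parity_spinT hi,
      Perm.sign_swap (by simp)]
    rfl

theorem sign_theta_eq_neg_one_iff (s : SpinSym n) :
    Perm.sign (theta n s) = -1 ↔ spinParity n s = Multiplicative.ofAdd 1 := by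
  rw [sign_theta]
  generalize spinParity n s = a
  revert a
  decide

end SpinGroup

/-! ## The element `z` is nontrivial -/

section ZNontrivial

/-- The quadratic form `-½ ∑ v_i²`. -/
def halfNegForm (n : ℕ) : QuadraticForm ℝ (Fin n → ℝ) :=
  QuadraticMap.weightedSumSquares ℝ fun _ : Fin n => (-1 / 2 : ℝ)

theorem halfNegForm_apply {n : ℕ} (v : Fin n → ℝ) :
    halfNegForm n v = -1 / 2 * (v ⬝ᵥ v) := by
  simp [halfNegForm, QuadraticMap.weightedSumSquares_apply, dotProduct, Finset.mul_sum]

theorem polar_halfNegForm {n : ℕ} (v w : Fin n → ℝ) :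
    QuadraticMap.polar (halfNegForm n) v w = -(v ⬝ᵥ w) := by
  simp only [QuadraticMap.polar, halfNegForm_apply, add_dotProduct, dotProduct_add,
    dotProduct_comm w v]
  ring

/-- Since `ab · ba = 1` and `ba = 1 - ab`, the element `ab` satisfies `X² - X + 1 = 0`, hence `X³ =
-1`. This is the relation between neighbouring generators in the Clifford algebra. -/
theorem cube_eq_neg_one {A : Type*} [Ring A] {a b : A} (ha : a * a = -1) (hb : b * b = -1)
    (h : a * b + b * a = 1) : (a * b) ^ 3 = -1 := by
  have h1 : b * a = 1 - a * b := eq_sub_of_add_eq' h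
  have h2 : a * b * (a * b) = a * b - 1 := by
    have : a * b * (b * a) = 1 := by
      rw [mul_assoc, ← mul_assoc b, hb]; simp [ha]
    rw [h1, mul_sub, mul_one] at this
    rw [← this]; abel
  rw [pow_succ, pow_two, h2, sub_mul, h2, one_mul]
  abel

/-- The simple root `e_i - e_{i+1}`. -/
def simpleRoot (n i : ℕ) : Fin n → ℝ :=
  if h : i < n - 1 then
    Pi.single ⟨i, by omega⟩ 1 - Pi.single ⟨i + 1, by omega⟩ 1 else 0

theorem simpleRoot_dotProduct {n i j : ℕ} (hi : i < n - 1) (hj : j < n - 1) :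
    simpleRoot n i ⬝ᵥ simpleRoot n j =
      if i = j then 2 else if i = j + 1 ∨ j = i + 1 then -1 else 0 := by
  rw [simpleRoot, simpleRoot, dif_pos hi, dif_pos hj]
  simp only [sub_dotProduct, single_dotProduct, Pi.sub_apply, Pi.single_apply, Fin.mk.injEq]
  split_ifs <;> first | omega | norm_num

/-- The simple roots of type A satisfy the spin relations in a Clifford algebra, with `z` acting as
`-1`. The factor `-1/2` of the form is chosen so that a root of squared length 2 squares to `-1`;
then adjacent roots have anticommutator `1` and orthogonal roots anticommute. A nonzero real algebra
has `-1 ≠ 1`. -/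
theorem spinZ_ne_one (n : ℕ) : spinZ n ≠ 1 := by
  let A := CliffordAlgebra (halfNegForm n)
  have hA : (-1 : A) ≠ 1 := by
    intro h
    have h2 : (2 : A) = 0 := by
      rw [← one_add_one_eq_two]; nth_rewrite 1 [← h]; exact neg_add_cancel 1
    have h3 : algebraMap ℝ A 2 = 0 := by rw [map_ofNat]; exact h2
    exact two_ne_zero ((FaithfulSMul.algebraMap_injective ℝ A) (h3.trans (map_zero _).symm))
  let a : ℕ → A := fun i => CliffordAlgebra.ι (halfNegForm n) (simpleRoot n i)
  have ha : ∀ i < n - 1, a i * a i = -1 := by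
    intro i hi
    have : a i * a i = algebraMap ℝ A (halfNegForm n (simpleRoot n i)) :=
      CliffordAlgebra.ι_sq_scalar _ _
    rw [this, halfNegForm_apply, simpleRoot_dotProduct hi hi, if_pos rfl]
    norm_num
  have hab : ∀ i j, i < n - 1 → j < n - 1 → a i * a j + a j * a i =
      algebraMap ℝ A (-(simpleRoot n i ⬝ᵥ simpleRoot n j)) := by
    intro i j _ _
    rw [← polar_halfNegForm]
    exact CliffordAlgebra.ι_mul_ι_add_swap _ _
  let T : ℕ → Aˣ := fun i => if hi : i < n - 1 then
    ⟨a i, -a i, by rw [mul_neg, ha i hi, neg_neg], by rw [neg_mul, ha i hi, neg_neg]⟩ else 1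
  have hT : ∀ i < n - 1, (T i : A) = a i := by
    intro i hi
    simp only [T, dif_pos hi]
  obtain ⟨φ, hφ, -⟩ := exists_spinLift (n := n) T (-1) (by simp)
    (fun i hi => by ext; simp [hT i hi, ha i hi])
    (fun i hi => by
      ext
      have h1 := hab i (i + 1) (by omega) hi
      rw [simpleRoot_dotProduct (by omega) hi, if_neg (by omega), if_pos (by omega), neg_neg,
        map_one] at h1
      simpa [hT i (by omega), hT _ hi] using cube_eq_neg_one (ha i (by omega)) (ha _ hi) h1)
    (fun i j hi hj => by
      ext
      have h1 := hab i j hi (by omega)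
      rw [simpleRoot_dotProduct hi (by omega), if_neg (by omega), if_neg (by omega), neg_zero,
        map_zero] at h1
      simpa [hT i hi, hT j (by omega)] using eq_neg_of_add_eq_zero_left h1)
    (fun i hi => by simp)
  intro h
  rw [h, map_one] at hφ
  exact hA (by simpa using (congrArg Units.val hφ).symm)

end ZNontrivial

/-! ## The kernel of the projection to the symmetric group -/

section Kernel

theorem theta_spinT_apply_val {n i : ℕ} (h : i < n - 1) (x : Fin n) :
    (theta n (spinT n i) x : ℕ) = if x.1 = i then i + 1 else if x.1 = i + 1 then i else x.1 := by
  rw [theta_spinT h, swap_apply_def]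
  simp only [Fin.ext_iff]
  split_ifs <;> rfl

/-- The homomorphism `S̃_m → S̃_n` with `t_i ↦ t_{a+i}`. -/
theorem exists_spinShift {m n a : ℕ} (h : a + m ≤ n) :
    ∃ φ : SpinSym m →* SpinSym n, φ (spinZ m) = spinZ n ∧
      ∀ i < m - 1, φ (spinT m i) = spinT n (a + i) :=
  exists_spinLift (fun i => spinT n (a + i)) (spinZ n) (spinZ_mul_self n)
    (fun i hi => spinT_mul_self (by omega)) (fun i hi => spinT_braid_pow (i := a + i) (by omega))
    (fun i j hi hj => spinT_comm (by omega) (by omega)) (fun i _ => (spinZ_comm _).symm)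

/-- Compatibility of the shift `S̃_m → S̃_n` with the projections to the symmetric groups. -/
theorem theta_spinShift {m n a : ℕ} (h : a + m ≤ n) {φ : SpinSym m →* SpinSym n}
    (hz : φ (spinZ m) = spinZ n) (ht : ∀ i < m - 1, φ (spinT m i) = spinT n (a + i))
    (s : SpinSym m) (x : Fin m) :
    theta n (φ s) ⟨a + x, by omega⟩ = ⟨a + theta m s x, by omega⟩ := by
  induction s using spin_induction generalizing x with
  | one => simp
  | z s hs => simp only [map_mul, hz, theta_spinZ, mul_one, hs]
  | t s i hi hs =>
    simp only [map_mul, Perm.mul_apply, ht i hi]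
    rw [← hs]
    congr 1
    ext
    rw [theta_spinT_apply_val (by omega)]
    simp only [theta_spinT_apply_val hi]
    split_ifs <;> omega

theorem theta_spinShift_of_ge {m n a : ℕ} (h : a + m ≤ n) {φ : SpinSym m →* SpinSym n}
    (hz : φ (spinZ m) = spinZ n) (ht : ∀ i < m - 1, φ (spinT m i) = spinT n (a + i))
    (s : SpinSym m) (x : Fin n) (hx : x.1 < a ∨ a + m ≤ x) :
    theta n (φ s) x = x := by
  induction s using spin_induction with
  | one => simp
  | z s hs => simp only [map_mul, hz, theta_spinZ, mul_one, hs]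
  | t s i hi hs =>
    rw [map_mul, map_mul, ht i hi, Perm.mul_apply]
    convert hs using 2
    ext
    rw [theta_spinT_apply_val (by omega)]
    split_ifs <;> omega

/-- The coset representative `t_{k+d-1} ⋯ t_{k+1} t_k`. -/
def descProd (n k : ℕ) : ℕ → SpinSym n
  | 0 => 1
  | d + 1 => spinT n (k + d) * descProd n k d

theorem descProd_mul_spinT_of_lt {n k j : ℕ} (d : ℕ) (hd : k + d ≤ n - 1) (hj : j + 1 < k) :
    descProd n k d * spinT n j = spinZ n ^ d * spinT n j * descProd n k d := by
  induction d with
  | zero => simp [descProd]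
  | succ d ih =>
    rw [descProd, mul_assoc, ih (by omega), ← mul_assoc, ← mul_assoc,
      ← ((spinZ_commute (spinT n (k + d))).pow_left d).eq, mul_assoc (spinZ n ^ d),
      spinT_comm (by omega) (by omega)]
    simp only [pow_succ, mul_assoc]

theorem descProd_succ' (n k d : ℕ) :
    descProd n k (d + 1) = descProd n (k + 1) d * spinT n k := by
  induction d with
  | zero => simp [descProd]
  | succ d ih =>
    rw [descProd, ih, descProd, mul_assoc]
    congr 2
    ring

theorem spinT_comm' {n i j : ℕ} (hj : j < n - 1) (h : i + 1 < j) :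
    spinT n i * spinT n j = spinZ n * spinT n j * spinT n i := by
  rw [mul_assoc, spinT_comm hj h, ← mul_assoc, ← mul_assoc, spinZ_mul_self, one_mul]

/-- Moving left, `t_j` passes the distant factors up to `z`, meets `t_j t_{j-1}`, turns into
`t_{j-1}` by the braid relation, and passes the remaining factors. The power of `z` is not tracked,
since it is absorbed by the subgroup in the coset decomposition. -/
theorem descProd_mul_spinT_of_gt {n k j : ℕ} (d : ℕ) (hd : k + d ≤ n - 1) (hj : k < j)
    (hjd : j < k + d) :
    ∃ e : ℕ, descProd n k d * spinT n j = spinZ n ^ e * spinT n (j - 1) * descProd n k d := by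
  induction d with
  | zero => omega
  | succ d ih =>
    rcases Nat.lt_or_ge j (k + d) with hlt | hge
    · obtain ⟨e, he⟩ := ih (by omega) hlt
      refine ⟨e + 1, ?_⟩
      rw [descProd, mul_assoc, he, ← mul_assoc, ← mul_assoc,
        ← ((spinZ_commute (spinT n (k + d))).pow_left e).eq, mul_assoc (spinZ n ^ e),
        spinT_comm (by omega) (by omega)]
      simp only [pow_succ, mul_assoc]
    · obtain rfl : j = k + d := by omega
      obtain ⟨d, rfl⟩ : ∃ c, d = c + 1 := ⟨d - 1, by omega⟩
      have hc : descProd n k d * spinT n (k + (d + 1)) =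
          spinZ n ^ d * spinT n (k + (d + 1)) * descProd n k d := by
        clear ih hjd hj hge
        have : ∀ c ≤ d, descProd n k c * spinT n (k + (d + 1)) =
            spinZ n ^ c * spinT n (k + (d + 1)) * descProd n k c := by
          intro c hc
          induction c with
          | zero => simp [descProd]
          | succ c ih =>
            rw [descProd, mul_assoc, ih (by omega), ← mul_assoc, ← mul_assoc,
              ← ((spinZ_commute (spinT n (k + c))).pow_left c).eq, mul_assoc (spinZ n ^ c),
              spinT_comm' (by omega) (by omega)]
            simp only [pow_succ, mul_assoc]
        exact this d le_rfl
      refine ⟨d, ?_⟩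
      have hb := spinT_braid (n := n) (i := k + d) (by omega)
      rw [descProd, descProd, mul_assoc, mul_assoc, hc]
      have e1 : k + (d + 1) - 1 = k + d := by omega
      have e2 : k + (d + 1) = k + d + 1 := by omega
      rw [e1, e2]
      have cz := fun s : SpinSym n => ((spinZ_commute s).pow_left d).eq
      rw [← mul_assoc (spinT n (k + d)), ← mul_assoc (spinT n (k + d)), ← cz, mul_assoc,
        mul_assoc, ← mul_assoc (spinT n (k + d + 1)), ← cz]
      simp only [mul_assoc]
      congr 1
      simp only [← mul_assoc]
      rw [hb]

theorem theta_descProd_apply {n k : ℕ} (d : ℕ) (h : k + d < n) :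
    theta n (descProd n k d) ⟨k, by omega⟩ = ⟨k + d, h⟩ := by
  induction d with
  | zero => simp [descProd]
  | succ d ih =>
    rw [descProd, map_mul, Perm.mul_apply, ih (by omega)]
    ext
    rw [theta_spinT_apply_val (by omega)]
    simp [add_assoc]

/-- The coset decomposition of `S̃_{n+1}` with respect to `S̃_n`. -/
theorem exists_eq_mul_descProd {n : ℕ} {φ : SpinSym n →* SpinSym (n + 1)}
    (hz : φ (spinZ n) = spinZ (n + 1)) (ht : ∀ i < n - 1, φ (spinT n i) = spinT (n + 1) i)
    (s : SpinSym (n + 1)) :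
    ∃ h : SpinSym n, ∃ k d, k + d = n ∧ s = φ h * descProd (n + 1) k d := by
  induction s using spin_induction with
  | one => exact ⟨1, n, 0, rfl, by simp [descProd]⟩
  | z s hs =>
    obtain ⟨h, k, d, hk, rfl⟩ := hs
    refine ⟨h * spinZ n, k, d, hk, ?_⟩
    rw [mul_assoc, spinZ_comm, map_mul, hz, mul_assoc]
  | t s i hi hs =>
    obtain ⟨h, k, d, hk, rfl⟩ := hs
    -- Right multiplication by `t_i` keeps the coset representative if `i + 1 < k` or `i > k`,
    -- lengthens it if `i + 1 = k`, and shortens it through `t_k² = z` if `i = k`.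
    rcases lt_trichotomy (i + 1) k with hik | hik | hik
    · refine ⟨h * (spinZ n ^ d * spinT n i), k, d, hk, ?_⟩
      rw [mul_assoc, descProd_mul_spinT_of_lt d (by omega) hik, map_mul, map_mul, map_pow, hz,
        ht i (by omega)]
      simp only [mul_assoc]
    · subst hik
      exact ⟨h, i, d + 1, by omega, by rw [mul_assoc, ← descProd_succ']⟩
    · rcases Nat.eq_or_lt_of_le (Nat.le_of_lt_succ hik) with hik | hik
      · subst hik
        obtain ⟨d, rfl⟩ : ∃ c, d = c + 1 := ⟨d - 1, by omega⟩
        refine ⟨h * spinZ n, k + 1, d, by omega, ?_⟩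
        rw [descProd_succ', mul_assoc, mul_assoc, spinT_mul_self hi, spinZ_comm, ← mul_assoc,
          map_mul, hz]
      · obtain ⟨e, he⟩ := descProd_mul_spinT_of_gt (n := n + 1) d (by omega) hik (by omega)
        refine ⟨h * (spinZ n ^ e * spinT n (i - 1)), k, d, hk, ?_⟩
        rw [mul_assoc, he, map_mul, map_mul, map_pow, hz, ht _ (by omega)]
        simp only [mul_assoc]

/-- By induction on `n`, using the coset decomposition: `descProd` sends the point `k` to the last
point, which the subgroup factor fixes. A kernel element therefore has trivial coset representative
and comes from a kernel element one level lower. -/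
theorem eq_one_or_eq_spinZ {n : ℕ} (s : SpinSym n) (hs : theta n s = 1) :
    s = 1 ∨ s = spinZ n := by
  induction n with
  | zero =>
    clear hs
    induction s using spin_induction with
    | one => exact Or.inl rfl
    | z s hs => rcases hs with rfl | rfl
                · simp
                · exact Or.inl (spinZ_mul_self 0)
    | t s i hi _ => omega
  | succ n ih =>
    obtain ⟨φ, hz, ht⟩ := exists_spinShift (m := n) (n := n + 1) (a := 0) (by omega)
    obtain ⟨h, k, d, hk, rfl⟩ := exists_eq_mul_descProd hz (by simpa using ht) s
    have h1 := congrArg (fun σ => σ ⟨k, by omega⟩) hs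
    simp only [map_mul, Perm.mul_apply, theta_descProd_apply d (by omega : k + d < n + 1),
      Perm.one_apply] at h1
    rw [theta_spinShift_of_ge (by omega) hz ht _ _ (Or.inr (by simp; omega))] at h1
    have hd : d = 0 := by have := congrArg Fin.val h1; simpa using this
    subst hd
    rw [descProd, mul_one] at hs ⊢
    have hh : theta n h = 1 := by
      ext x
      have h2 := theta_spinShift (by omega) hz ht h x
      rw [hs] at h2
      have := congrArg Fin.val h2
      simp only [Perm.one_apply, Nat.zero_add] at this
      simp [← this]
    rcases ih h hh with rfl | rfl
    · simp
    · exact Or.inr hz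

theorem theta_eq_iff {n : ℕ} {s t : SpinSym n} :
    theta n s = theta n t ↔ s = t ∨ s = spinZ n * t := by
  constructor
  · intro h
    rcases eq_one_or_eq_spinZ (s * t⁻¹) (by rw [map_mul, map_inv, h, mul_inv_cancel]) with h | h
    · exact Or.inl (mul_inv_eq_one.1 h)
    · exact Or.inr (mul_inv_eq_iff_eq_mul.1 h)
  · rintro (rfl | rfl)
    · rfl
    · rw [map_mul, theta_spinZ, one_mul]

theorem spinZ_mul_ne {n : ℕ} (s : SpinSym n) : spinZ n * s ≠ s := by
  intro h
  exact spinZ_ne_one n (mul_eq_right.1 h)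

end Kernel

/-! ## Commutators of lifts of disjoint permutations -/

section Commutator

/-- `z` if both signs are `-1`, and `1` otherwise. -/
def signZ (n : ℕ) (a b : ℤˣ) : SpinSym n := if a = -1 ∧ b = -1 then spinZ n else 1

theorem signZ_mul_left (n : ℕ) (a a' b : ℤˣ) :
    signZ n (a * a') b = signZ n a b * signZ n a' b := by
  have hz := spinZ_mul_self n
  rcases Int.units_eq_one_or a with rfl | rfl <;> rcases Int.units_eq_one_or a' with rfl | rfl <;>
    rcases Int.units_eq_one_or b with rfl | rfl <;> simp [signZ, hz]

theorem signZ_mul_signZ (n : ℕ) (a b : ℤˣ) : signZ n a b * signZ n b a = 1 := by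
  have hz := spinZ_mul_self n
  rcases Int.units_eq_one_or a with rfl | rfl <;>
    rcases Int.units_eq_one_or b with rfl | rfl <;> simp [signZ, hz]

theorem signZ_commute {n : ℕ} (a b : ℤˣ) (s : SpinSym n) : Commute (signZ n a b) s := by
  unfold signZ
  split_ifs
  · exact spinZ_commute s
  · exact Commute.one_left s

/-- The elements `s` and `t` commute up to the sign prescribed by their parities. -/
def SuperCommute {n : ℕ} (s t : SpinSym n) : Prop :=
  s * t = signZ n (Perm.sign (theta n s)) (Perm.sign (theta n t)) * t * s

theorem SuperCommute.symm {n : ℕ} {s t : SpinSym n} (h : SuperCommute s t) :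
    SuperCommute t s := by
  unfold SuperCommute at h ⊢
  rw [mul_assoc, h, ← mul_assoc, ← mul_assoc, signZ_mul_signZ, one_mul]

theorem SuperCommute.mul_left {n : ℕ} {s s' t : SpinSym n} (h : SuperCommute s t)
    (h' : SuperCommute s' t) : SuperCommute (s * s') t := by
  unfold SuperCommute at h h' ⊢
  rw [mul_assoc, h', map_mul, map_mul, signZ_mul_left]
  rw [← mul_assoc, ← mul_assoc, ← (signZ_commute _ _ s).eq, mul_assoc _ s t, h]
  simp only [← mul_assoc]
  rw [(signZ_commute _ (Perm.sign (theta n t)) (signZ n (Perm.sign (theta n s)) _)).eq]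

theorem SuperCommute.of_ker_left {n : ℕ} {s t : SpinSym n} (h : theta n s = 1) :
    SuperCommute s t := by
  unfold SuperCommute
  rw [h, Perm.sign_one, signZ, if_neg (by simp), one_mul]
  rcases eq_one_or_eq_spinZ s h with rfl | rfl
  · simp
  · exact (spinZ_comm t).symm

/-- Two lifts of one permutation differ by a kernel element, which is central. So super-commutation
is a property of the underlying permutations, and convenient lifts may be chosen. -/
theorem SuperCommute.of_theta_eq_left {n : ℕ} {s s' t : SpinSym n} (h : SuperCommute s t)
    (hs : theta n s' = theta n s) : SuperCommute s' t := by
  have := (SuperCommute.of_ker_left (s := s' * s⁻¹) (t := t)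
    (by rw [map_mul, map_inv, hs, mul_inv_cancel])).mul_left h
  rwa [inv_mul_cancel_right] at this

theorem SuperCommute.of_theta_eq {n : ℕ} {s s' t t' : SpinSym n} (h : SuperCommute s t)
    (hs : theta n s' = theta n s) (ht : theta n t' = theta n t) : SuperCommute s' t' :=
  ((h.of_theta_eq_left hs).symm.of_theta_eq_left ht).symm

theorem SuperCommute.conj {n : ℕ} {s t : SpinSym n} (h : SuperCommute s t) (w : SpinSym n) :
    SuperCommute (w * s * w⁻¹) (w * t * w⁻¹) := by
  unfold SuperCommute at h ⊢
  have hs : ∀ x, Perm.sign (theta n (w * x * w⁻¹)) = Perm.sign (theta n x) := by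
    intro x
    simp only [map_mul, map_inv, mul_inv_cancel_comm]
  rw [hs, hs]
  have h2 : signZ n (Perm.sign (theta n s)) (Perm.sign (theta n t)) =
      w * signZ n (Perm.sign (theta n s)) (Perm.sign (theta n t)) * w⁻¹ := by
    rw [← (signZ_commute _ _ w).eq, mul_inv_cancel_right]
  rw [h2]
  simp only [mul_assoc, inv_mul_cancel_left]
  simp only [← mul_assoc]
  rw [mul_assoc w s t, h]
  simp only [mul_assoc]

theorem superCommute_spinT_zero_two {n : ℕ} (h : 2 < n - 1) :
    SuperCommute (spinT n 2) (spinT n 0) := by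
  unfold SuperCommute
  rw [theta_spinT h, theta_spinT (by omega : 0 < n - 1), Perm.sign_swap (by simp),
    Perm.sign_swap (by simp), signZ, if_pos ⟨rfl, rfl⟩, spinT_comm h (by omega)]

/-- Any four distinct points are the images of `0, 1, 2, 3` under some permutation, so conjugation
reduces the claim to the defining relation between `t_2` and `t_0`. The order `c, d, a, b` reflects
that `t_2` goes to `(a b)` and `t_0` to `(c d)`. -/
theorem superCommute_of_swap {n : ℕ} {s t : SpinSym n} {a b c d : Fin n} (hab : a ≠ b)
    (hac : a ≠ c) (had : a ≠ d) (hbc : b ≠ c) (hbd : b ≠ d) (hcd : c ≠ d)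
    (hs : theta n s = swap a b) (ht : theta n t = swap c d) : SuperCommute s t := by
  have hf : Function.Injective ![c, d, a, b] := by
    intro i j hij
    fin_cases i <;> fin_cases j <;> simp_all
  have hn : 4 ≤ n := by simpa using Fintype.card_le_of_injective _ hf
  obtain ⟨g, hg⟩ := Perm.exists_extending_pair _ _ (Fin.castLE_injective hn) hf
  have hg' : ∀ i : Fin 4, g (Fin.castLE hn i) = ![c, d, a, b] i := hg
  obtain ⟨w, rfl⟩ := theta_surjective n g
  have h2 : 2 < n - 1 := by omega
  refine ((superCommute_spinT_zero_two h2).conj w).of_theta_eq ?_ ?_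
  · rw [hs, map_mul, map_mul, map_inv, theta_spinT h2, mul_swap_eq_swap_mul, mul_inv_cancel_right]
    exact congrArg₂ swap (hg' 2).symm (hg' 3).symm
  · rw [ht, map_mul, map_mul, map_inv, theta_spinT (by omega), mul_swap_eq_swap_mul,
      mul_inv_cancel_right]
    exact congrArg₂ swap (hg' 0).symm (hg' 1).symm

/-- Induction over a permutation by multiplication with transpositions inside its support. -/
theorem swap_support_induction {α : Type*} [Fintype α] [DecidableEq α] {p : Perm α → Prop}
    (σ : Perm α) (one : p 1)
    (step : ∀ (x y : α) (τ : Perm α), x ≠ y → x ∈ σ.support → y ∈ σ.support → p τ →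
      p (swap x y * τ)) : p σ := by
  suffices h : ∀ (k : ℕ) (τ : Perm α), τ.support.card = k → τ.support ⊆ σ.support → p τ from
    h _ σ rfl subset_rfl
  intro k
  induction k using Nat.strong_induction_on with
  | _ k ih =>
    intro τ hk hτ
    by_cases h1 : τ = 1
    · rw [h1]; exact one
    · obtain ⟨x, hx⟩ : ∃ x, τ x ≠ x := by
        by_contra! hcon
        exact h1 (Perm.ext hcon)
      have hxs : x ∈ τ.support := Perm.mem_support.2 hx
      have hlt := Perm.card_support_swap_mul hx
      have hsub : (swap x (τ x) * τ).support ⊆ τ.support := by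
        intro y hy
        have := Perm.mem_support_swap_mul_imp_mem_support_ne hy
        exact this.1
      have := step x (τ x) (swap x (τ x) * τ) hx.symm (hτ hxs)
        (hτ (Perm.apply_mem_support.2 hxs)) (ih _ (hk ▸ hlt) _ rfl (hsub.trans hτ))
      rwa [swap_mul_self_mul] at this

/-- Lifts of disjoint permutations commute up to the sign prescribed by their parities. -/
theorem superCommute_of_disjoint {n : ℕ} {s t : SpinSym n}
    (h : (theta n s).Disjoint (theta n t)) : SuperCommute s t := by
  -- Bilinearity in two stages: first `t` lies over a single transposition and `s` is split into
  -- transpositions inside its own support, which keeps every factor disjoint from `t`; then `t` is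
  -- split in the same way.
  have main : ∀ σ : Perm (Fin n), ∀ s t : SpinSym n, theta n s = σ →
      ∀ c d, c ≠ d → σ c = c → σ d = d → theta n t = swap c d → SuperCommute s t := by
    intro σ s t hs c d hcd hc hd ht
    refine swap_support_induction (p := fun σ => ∀ s, theta n s = σ → SuperCommute s t) σ ?_ ?_ s hs
    · intro s hs
      exact SuperCommute.of_ker_left hs
    · intro x y τ hxy hx hy ih s hs
      obtain ⟨r, hr⟩ := theta_surjective n (swap x y)
      have h1 : SuperCommute r t := superCommute_of_swap hxy
        (by rintro rfl; exact Perm.mem_support.1 hx hc)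
        (by rintro rfl; exact Perm.mem_support.1 hx hd)
        (by rintro rfl; exact Perm.mem_support.1 hy hc)
        (by rintro rfl; exact Perm.mem_support.1 hy hd) hcd hr ht
      have h2 := ih (r⁻¹ * s) (by rw [map_mul, map_inv, hr, hs, inv_mul_cancel_left])
      have := h1.mul_left h2
      rwa [mul_inv_cancel_left] at this
  refine swap_support_induction (p := fun τ => ∀ t', theta n t' = τ → SuperCommute s t')
    (theta n t) ?_ ?_ t rfl
  · intro t' ht
    exact (SuperCommute.of_ker_left ht).symm
  · intro x y τ hxy hx hy ih t' ht
    obtain ⟨r, hr⟩ := theta_surjective n (swap x y)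
    have h1 : SuperCommute r s := (main _ s r rfl x y hxy
      ((h x).resolve_right (Perm.mem_support.1 hx))
      ((h y).resolve_right (Perm.mem_support.1 hy)) hr).symm
    have h2 := ih (r⁻¹ * t') (by rw [map_mul, map_inv, hr, ht, inv_mul_cancel_left])
    have := h1.mul_left h2.symm
    rw [mul_inv_cancel_left] at this
    exact this.symm

end Commutator

/-! ## Lifts of permutations of odd order -/

section OddOrder

theorem odd_orderOf_iff {G : Type*} [Monoid G] {s : G} :
    Odd (orderOf s) ↔ ∃ k, Odd k ∧ s ^ k = 1 := by
  constructor
  · exact fun h => ⟨_, h, pow_orderOf_eq_one s⟩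
  · rintro ⟨k, hk, h⟩
    exact hk.of_dvd_nat (orderOf_dvd_of_pow_eq_one h)

theorem spinZ_pow_of_odd {n k : ℕ} (hk : Odd k) : spinZ n ^ k = spinZ n := by
  obtain ⟨j, rfl⟩ := hk
  rw [pow_succ, pow_mul, pow_two, spinZ_mul_self, one_pow, one_mul]

/-- Of the two lifts of a permutation of odd order exactly one has odd order. -/
theorem odd_orderOf_spinZ_mul_iff {n : ℕ} {s : SpinSym n} (h : Odd (orderOf (theta n s))) :
    Odd (orderOf (spinZ n * s)) ↔ ¬ Odd (orderOf s) := by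
  constructor
  · intro h1 h2
    obtain ⟨k, hk, h1⟩ := odd_orderOf_iff.1 h1
    obtain ⟨l, hl, h2⟩ := odd_orderOf_iff.1 h2
    have : (spinZ n * s) ^ (k * l) = spinZ n := by
      rw [(spinZ_commute s).mul_pow, spinZ_pow_of_odd (hk.mul hl), mul_comm k, pow_mul, h2,
        one_pow, mul_one]
    rw [pow_mul, h1, one_pow] at this
    exact spinZ_ne_one n this.symm
  · intro h1
    rcases eq_one_or_eq_spinZ (s ^ orderOf (theta n s))
      (by rw [map_pow, pow_orderOf_eq_one]) with h2 | h2
    · exact absurd (odd_orderOf_iff.2 ⟨_, h, h2⟩) h1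
    · refine odd_orderOf_iff.2 ⟨_, h, ?_⟩
      rw [(spinZ_commute s).mul_pow, h2, spinZ_pow_of_odd h, spinZ_mul_self]

/-- The sign that distinguishes the lift of odd order of a permutation of odd order. -/
def liftSign {n : ℕ} (s : SpinSym n) : ℂ := by
  classical exact if Odd (orderOf s) then 1 else -1

theorem liftSign_of_odd {n : ℕ} {s : SpinSym n} (h : Odd (orderOf s)) : liftSign s = 1 := by
  simp [liftSign, h]

theorem liftSign_spinZ_mul {n : ℕ} {s : SpinSym n} (h : Odd (orderOf (theta n s))) :
    liftSign (spinZ n * s) = -liftSign s := by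
  have := odd_orderOf_spinZ_mul_iff h
  by_cases h1 : Odd (orderOf s) <;> simp [liftSign, h1, this]

theorem liftSign_mul_self {n : ℕ} (s : SpinSym n) : liftSign s * liftSign s = 1 := by
  unfold liftSign; split_ifs <;> simp

theorem liftSign_inv {n : ℕ} (s : SpinSym n) : liftSign s⁻¹ = liftSign s := by
  simp [liftSign, orderOf_inv]

theorem liftSign_conj {n : ℕ} (s w : SpinSym n) : liftSign (w * s * w⁻¹) = liftSign s := by
  have : orderOf (w * s * w⁻¹) = orderOf s := by
    rw [← MulAut.conj_apply, MulEquiv.orderOf_eq]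
  simp [liftSign, this]

/-- Every lift of a permutation of odd order is, up to `z`, of odd order. -/
theorem exists_odd_orderOf {n : ℕ} {s : SpinSym n} (h : Odd (orderOf (theta n s))) :
    ∃ s', Odd (orderOf s') ∧ theta n s' = theta n s ∧ (s = s' ∨ s = spinZ n * s') := by
  by_cases h1 : Odd (orderOf s)
  · exact ⟨s, h1, rfl, Or.inl rfl⟩
  · refine ⟨spinZ n * s, (odd_orderOf_spinZ_mul_iff h).2 h1, by simp [theta_spinZ], Or.inr ?_⟩
    rw [← mul_assoc, spinZ_mul_self, one_mul]

theorem spinParity_of_odd {n : ℕ} {s : SpinSym n} (h : Odd (orderOf (theta n s))) :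
    spinParity n s = 1 := by
  obtain ⟨k, hk, hs⟩ := odd_orderOf_iff.1 h
  have h2 : Perm.sign (theta n s) ^ k = 1 := by rw [← map_pow, hs, map_one]
  by_contra hne
  have h3 : spinParity n s = Multiplicative.ofAdd 1 := by
    generalize spinParity n s = a at hne
    revert a; decide
  rw [← sign_theta_eq_neg_one_iff] at h3
  rw [h3, hk.neg_one_pow] at h2
  exact absurd h2 (by decide)

/-- The product of commuting elements of odd order has odd order. Replacing `s` and `t` by their
lifts of odd order preserves commutation, as `z` is central, and each replacement changes both sides
by the same sign. -/
theorem liftSign_mul {n : ℕ} {s t : SpinSym n} (h : Commute s t)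
    (hs : Odd (orderOf (theta n s))) (ht : Odd (orderOf (theta n t))) :
    liftSign (s * t) = liftSign s * liftSign t := by
  have key : ∀ s t : SpinSym n, Commute s t → Odd (orderOf s) → Odd (orderOf t) →
      Odd (orderOf (s * t)) := by
    intro s t h hs ht
    exact (hs.mul ht).of_dvd_nat h.orderOf_mul_dvd_mul_orderOf
  have zc : ∀ s t : SpinSym n, Commute (spinZ n * s) t ↔ Commute s t := by
    intro s t
    refine ⟨fun h => ?_, fun h => (spinZ_commute t).mul_left h⟩
    have := (spinZ_commute t).mul_left h
    rwa [← mul_assoc, spinZ_mul_self, one_mul] at this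
  obtain ⟨s', hs', hs1, hs2⟩ := exists_odd_orderOf hs
  obtain ⟨t', ht', ht1, ht2⟩ := exists_odd_orderOf ht
  have hc : Commute s' t' := by
    have h1 : Commute s' t := by
      rcases hs2 with rfl | rfl
      · exact h
      · exact (zc _ _).1 h
    rcases ht2 with rfl | rfl
    · exact h1
    · exact ((zc _ _).1 h1.symm).symm
  have hst := key s' t' hc hs' ht'
  have hst' : Odd (orderOf (theta n (s' * t'))) := hst.of_dvd_nat (orderOf_map_dvd _ _)
  rw [← hs1] at hs
  rw [← ht1] at ht
  rcases hs2 with rfl | rfl <;> rcases ht2 with rfl | rfl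
  · rw [liftSign_of_odd hst, liftSign_of_odd hs', liftSign_of_odd ht', one_mul]
  · rw [← mul_assoc, spinZ_comm, mul_assoc, liftSign_spinZ_mul hst', liftSign_spinZ_mul ht,
      liftSign_of_odd hst, liftSign_of_odd hs', liftSign_of_odd ht', one_mul]
  · rw [mul_assoc, liftSign_spinZ_mul hst', liftSign_spinZ_mul hs,
      liftSign_of_odd hst, liftSign_of_odd hs', liftSign_of_odd ht', mul_one]
  · have e : spinZ n * s' * (spinZ n * t') = s' * t' := by
      rw [mul_assoc, ← mul_assoc s', spinZ_comm, ← mul_assoc, ← mul_assoc, spinZ_mul_self, one_mul]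
    rw [e, liftSign_spinZ_mul hs, liftSign_spinZ_mul ht,
      liftSign_of_odd hst, liftSign_of_odd hs', liftSign_of_odd ht']
    norm_num

end OddOrder

/-! ## Lifted cycles on intervals -/

section Blocks

open Function

/-- The points `a, a+1, …, a+m-1` of `Fin n`. -/
def interval (n : ℕ) : (m a : ℕ) → a + m ≤ n → List (Fin n)
  | 0, _, _ => []
  | m + 1, a, h => ⟨a, by omega⟩ :: interval n m (a + 1) (by omega)

theorem mem_interval {n m a : ℕ} (h : a + m ≤ n) (x : Fin n) :
    x ∈ interval n m a h ↔ a ≤ x ∧ x.1 < a + m := by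
  induction m generalizing a with
  | zero => simp only [interval, List.not_mem_nil, false_iff]; omega
  | succ m ih => rw [interval, List.mem_cons, ih, Fin.ext_iff]; dsimp only; omega

theorem length_interval {n m a : ℕ} (h : a + m ≤ n) : (interval n m a h).length = m := by
  induction m generalizing a with
  | zero => rfl
  | succ m ih => rw [interval, List.length_cons, ih]

theorem nodup_interval {n m a : ℕ} (h : a + m ≤ n) : (interval n m a h).Nodup := by
  induction m generalizing a with
  | zero => simp [interval]
  | succ m ih =>
    rw [interval, List.nodup_cons]
    refine ⟨fun hmem => ?_, ih _⟩
    rw [mem_interval] at hmem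
    simp at hmem

theorem theta_cycleLift (ε : ℕ → ℕ) {n a m : ℕ} (hm : 0 < m) (h : a + m ≤ n) :
    theta n (cycleLift ε n a m) = (interval n m a h).formPerm := by
  rw [cycleLift, map_mul, map_pow, theta_spinZ, one_pow, one_mul]
  obtain ⟨m, rfl⟩ : ∃ k, m = k + 1 := ⟨m - 1, by omega⟩
  clear hm
  rw [Nat.add_sub_cancel]
  induction m generalizing a with
  | zero => simp [interval]
  | succ m ih =>
    have := ih (a := a + 1) (by omega)
    rw [interval] at this
    rw [interval, interval, List.formPerm_cons_cons, ← this, List.range_succ_eq_map,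
      List.map_cons, List.prod_cons, map_mul, Nat.add_zero, theta_spinT (by omega), List.map_map]
    congr 4
    ext k
    simp only [comp_apply]
    congr 1
    omega

theorem orderOf_formPerm_interval {n m a : ℕ} (hm : 0 < m) (h : a + m ≤ n) :
    orderOf (interval n m a h).formPerm = m := by
  rcases Nat.eq_or_lt_of_le (Nat.succ_le_of_lt hm) with h1 | h1
  · subst h1
    simp [interval]
  · rw [(List.isCycle_formPerm (nodup_interval h) (by rw [length_interval]; exact h1)).orderOf,
      List.support_formPerm_of_nodup _ (nodup_interval h), List.card_toFinset,
      (nodup_interval h).dedup, length_interval]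
    intro x hx
    have := length_interval h
    rw [hx] at this
    simp at this
    omega

theorem minimalPeriod_formPerm_interval {n m a : ℕ} (h : a + m ≤ n) {x : Fin n}
    (hx : a ≤ x ∧ x.1 < a + m) : minimalPeriod (interval n m a h).formPerm x = m := by
  rcases Nat.lt_or_ge 1 m with h1 | h1
  · have hc := List.isCycle_formPerm (nodup_interval h) (by rw [length_interval]; exact h1)
    have hsupp : (interval n m a h).formPerm x ≠ x := by
      rw [← Perm.mem_support, List.support_formPerm_of_nodup _ (nodup_interval h)]
      · rw [List.mem_toFinset, mem_interval]; exact hx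
      · intro y hy
        have := length_interval h
        rw [hy] at this
        simp at this
        omega
    refine Eq.trans ?_ (orderOf_formPerm_interval (by omega) h)
    refine Nat.dvd_antisymm ?_ ?_
    · refine IsPeriodicPt.minimalPeriod_dvd ?_
      rw [IsPeriodicPt, IsFixedPt, Perm.iterate_eq_pow, pow_orderOf_eq_one, Perm.one_apply]
    · refine orderOf_dvd_of_pow_eq_one ((hc.pow_eq_one_iff).2 ⟨x, hsupp, ?_⟩)
      rw [← Perm.iterate_eq_pow]
      exact isPeriodicPt_minimalPeriod _ _
  · obtain rfl : m = 1 := by omega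
    simp [interval, minimalPeriod_id]

theorem formPerm_interval_apply_of_notMem {n m a : ℕ} (h : a + m ≤ n) {x : Fin n}
    (hx : x.1 < a ∨ a + m ≤ x) : (interval n m a h).formPerm x = x := by
  refine List.formPerm_apply_of_notMem ?_
  rw [mem_interval]
  omega

theorem theta_blockElt_apply (ε : ℕ → ℕ) {n a : ℕ} {L : List ℕ} (hL : ∀ m ∈ L, 0 < m)
    (h : a + L.sum ≤ n) {x : Fin n} (hx : x.1 < a ∨ a + L.sum ≤ x) :
    theta n (blockElt ε n a L) x = x := by
  induction L generalizing a with
  | nil => simp [blockElt]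
  | cons m L ih =>
    rw [List.sum_cons] at h hx
    rw [blockElt, map_mul, Perm.mul_apply, ih (fun k hk => hL k (by simp [hk])) (by omega)
      (by omega), theta_cycleLift ε (hL m (by simp)) (by omega),
      formPerm_interval_apply_of_notMem _ (by omega)]

theorem disjoint_cycleLift_blockElt (ε : ℕ → ℕ) {n a m : ℕ} {L : List ℕ} (hm : 0 < m)
    (hL : ∀ m ∈ L, 0 < m) (h : a + m + L.sum ≤ n) :
    (theta n (cycleLift ε n a m)).Disjoint (theta n (blockElt ε n (a + m) L)) := by
  intro x
  rw [theta_cycleLift ε hm (by omega)]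
  rcases Nat.lt_or_ge x (a + m) with hx | hx
  · exact Or.inr (theta_blockElt_apply ε hL h (Or.inl hx))
  · exact Or.inl (formPerm_interval_apply_of_notMem _ (Or.inr hx))

theorem minimalPeriod_mul_of_disjoint {α : Type*} {σ τ : Perm α} (h : σ.Disjoint τ) {x : α}
    (hx : τ x = x) : minimalPeriod (σ * τ) x = minimalPeriod σ x := by
  rw [minimalPeriod_eq_minimalPeriod_iff]
  intro k
  rw [IsPeriodicPt, IsPeriodicPt, IsFixedPt, IsFixedPt, Perm.iterate_eq_pow, Perm.iterate_eq_pow,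
    h.commute.mul_pow, Perm.mul_apply, Perm.pow_apply_eq_self_of_apply_eq_self hx]

theorem minimalPeriod_mul_of_disjoint' {α : Type*} {σ τ : Perm α} (h : σ.Disjoint τ) {x : α}
    (hx : σ x = x) : minimalPeriod (σ * τ) x = minimalPeriod τ x := by
  rw [h.commute.eq]
  exact minimalPeriod_mul_of_disjoint h.symm hx

/-- The number of points in a union of blocks that lie in cycles of length `k`. -/
theorem card_minimalPeriod_blockElt (ε : ℕ → ℕ) {n a : ℕ} {L : List ℕ} (hL : ∀ m ∈ L, 0 < m)
    (h : a + L.sum ≤ n) (k : ℕ) :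
    (Finset.univ.filter fun x : Fin n => (a ≤ x ∧ x.1 < a + L.sum) ∧
      minimalPeriod (theta n (blockElt ε n a L)) x = k).card = k * L.count k := by
  classical
  induction L generalizing a with
  | nil =>
    rw [List.count_nil, Nat.mul_zero, Finset.card_eq_zero, Finset.filter_eq_empty_iff]
    rintro x - ⟨hx, -⟩
    rw [List.sum_nil] at hx
    omega
  | cons m L ih =>
    rw [List.sum_cons] at h ⊢
    have hm : 0 < m := hL m (by simp)
    have hL' : ∀ k ∈ L, 0 < k := fun k hk => hL k (by simp [hk])
    have hd := disjoint_cycleLift_blockElt ε (a := a) hm hL' (n := n) (by omega)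
    have hsplit : (Finset.univ.filter fun x : Fin n => (a ≤ x ∧ x.1 < a + (m + L.sum)) ∧
        minimalPeriod (theta n (blockElt ε n a (m :: L))) x = k) =
        (if m = k then (interval n m a (by omega)).toFinset else ∅) ∪
        (Finset.univ.filter fun x : Fin n => (a + m ≤ x ∧ x.1 < a + m + L.sum) ∧
          minimalPeriod (theta n (blockElt ε n (a + m) L)) x = k) := by
      ext x
      have hif : x ∈ (if m = k then (interval n m a (by omega)).toFinset else ∅) ↔
          (a ≤ x ∧ x.1 < a + m) ∧ m = k := by
        split_ifs with hk
        · simp [mem_interval, hk]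
        · simp [hk]
      simp only [Finset.mem_filter, Finset.mem_univ, true_and, Finset.mem_union, hif, blockElt,
        map_mul]
      rcases Nat.lt_or_ge x (a + m) with hx | hx
      · rw [minimalPeriod_mul_of_disjoint hd (theta_blockElt_apply ε hL' (by omega) (Or.inl hx)),
          theta_cycleLift ε hm (by omega)]
        by_cases hax : a ≤ x.1
        · rw [minimalPeriod_formPerm_interval _ ⟨hax, hx⟩]
          constructor
          · rintro ⟨h1, h2⟩; exact Or.inl ⟨⟨hax, hx⟩, h2⟩
          · rintro (⟨h1, h2⟩ | h1)
            · exact ⟨by omega, h2⟩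
            · omega
        · constructor
          · rintro ⟨h1, h2⟩; omega
          · rintro (⟨h1, h2⟩ | h1) <;> omega
      · rw [minimalPeriod_mul_of_disjoint' hd]
        · constructor
          · rintro ⟨h1, h2⟩; exact Or.inr ⟨by omega, h2⟩
          · rintro (⟨h1, h2⟩ | ⟨h1, h2⟩)
            · omega
            · exact ⟨by omega, h2⟩
        · rw [theta_cycleLift ε hm (by omega)]
          exact formPerm_interval_apply_of_notMem _ (Or.inr hx)
    rw [hsplit, Finset.card_union_of_disjoint, ih hL' (by omega), List.count_cons]
    · split_ifs with h1 h2 h2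
      · rw [List.card_toFinset, (nodup_interval _).dedup, length_interval]
        subst h1; ring
      · simp [h1] at h2
      · simp at h2; omega
      · simp
    · rw [Finset.disjoint_left]
      intro x hx hx'
      split_ifs at hx
      · rw [List.mem_toFinset, mem_interval] at hx
        simp only [Finset.mem_filter] at hx'
        omega
      · simp at hx

theorem odd_orderOf_theta_cycleLift (ε : ℕ → ℕ) {n a m : ℕ} (hm : Odd m) (h : a + m ≤ n) :
    Odd (orderOf (theta n (cycleLift ε n a m))) := by
  rw [theta_cycleLift ε hm.pos h, orderOf_formPerm_interval hm.pos h]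
  exact hm

theorem odd_orderOf_theta_blockElt (ε : ℕ → ℕ) {n a : ℕ} {L : List ℕ} (hL : ∀ m ∈ L, Odd m)
    (h : a + L.sum ≤ n) : Odd (orderOf (theta n (blockElt ε n a L))) := by
  induction L generalizing a with
  | nil => simp [blockElt]
  | cons m L ih =>
    rw [List.sum_cons] at h
    have hL' : ∀ k ∈ L, Odd k := fun k hk => hL k (by simp [hk])
    have hd := disjoint_cycleLift_blockElt ε (a := a) (hL m (by simp)).pos
      (fun k hk => (hL' k hk).pos) (n := n) (by omega)
    rw [blockElt, map_mul]
    exact ((odd_orderOf_theta_cycleLift ε (hL m (by simp)) (by omega)).mul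
      (ih hL' (by omega))).of_dvd_nat hd.commute.orderOf_mul_dvd_mul_orderOf

/-- The shift `S̃_m → S̃_n` carries lifted cycles to lifted cycles, `z` to `z`, and elements of odd
order to elements of odd order. So the position of the interval does not influence the sign. -/
theorem liftSign_cycleLift (ε : ℕ → ℕ) {n a m : ℕ} (hm : Odd m) (h : a + m ≤ n) :
    liftSign (cycleLift ε n a m) = liftSign (cycleLift ε m 0 m) := by
  obtain ⟨φ, hz, ht⟩ := exists_spinShift h
  have hφ : φ (cycleLift ε m 0 m) = cycleLift ε n a m := by
    rw [cycleLift, cycleLift, map_mul, map_pow, hz, map_list_prod, List.map_map]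
    congr 2
    refine List.map_congr_left fun k hk => ?_
    rw [List.mem_range] at hk
    rw [comp_apply, Nat.zero_add, ht k hk]
  have h0 := odd_orderOf_theta_cycleLift ε hm (by omega : 0 + m ≤ m)
  have h1 := odd_orderOf_theta_cycleLift ε hm h
  rw [← hφ] at h1 ⊢
  obtain ⟨s, hs, hs1, hs2⟩ := exists_odd_orderOf h0
  have hφs : Odd (orderOf (φ s)) := hs.of_dvd_nat (orderOf_map_dvd _ _)
  rcases hs2 with hs2 | hs2
  · rw [hs2, liftSign_of_odd hs, liftSign_of_odd hφs]
  · rw [← hs1] at h0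
    rw [hs2, map_mul, hz, liftSign_spinZ_mul (s := s) h0, liftSign_of_odd hs,
      liftSign_spinZ_mul (hφs.of_dvd_nat (orderOf_map_dvd _ _)), liftSign_of_odd hφs]

theorem sign_eq_one_of_odd {α : Type*} [Fintype α] [DecidableEq α] {σ : Perm α}
    (h : Odd (orderOf σ)) : Perm.sign σ = 1 := by
  have h2 : Perm.sign σ ^ orderOf σ = 1 := by rw [← map_pow, pow_orderOf_eq_one, map_one]
  rcases Int.units_eq_one_or (Perm.sign σ) with h3 | h3
  · exact h3
  · rw [h3, h.neg_one_pow] at h2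
    exact absurd h2 (by decide)

/-- Cycles of odd length are even permutations, so the lifts of disjoint blocks commute honestly and
their signs multiply. The resulting product does not see the order of the blocks, which is what
makes `t^ρ` and `t^ρ̄` comparable. -/
theorem liftSign_blockElt (ε : ℕ → ℕ) {n a : ℕ} {L : List ℕ} (hL : ∀ m ∈ L, Odd m)
    (h : a + L.sum ≤ n) :
    liftSign (blockElt ε n a L) = (L.map fun m => liftSign (cycleLift ε m 0 m)).prod := by
  induction L generalizing a with
  | nil => simp [blockElt, liftSign]
  | cons m L ih =>
    rw [List.sum_cons] at h
    have hL' : ∀ k ∈ L, Odd k := fun k hk => hL k (by simp [hk])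
    have hd := disjoint_cycleLift_blockElt ε (a := a) (hL m (by simp)).pos
      (fun k hk => (hL' k hk).pos) (n := n) (by omega)
    have h1 := odd_orderOf_theta_cycleLift ε (n := n) (hL m (by simp)) (by omega : a + m ≤ n)
    have hc : Commute (cycleLift ε n a m) (blockElt ε n (a + m) L) := by
      have := superCommute_of_disjoint hd
      rw [SuperCommute, sign_eq_one_of_odd h1, signZ, if_neg (by simp), one_mul] at this
      exact this
    rw [blockElt, liftSign_mul hc h1 (odd_orderOf_theta_blockElt ε hL' (by omega)),
      ih hL' (by omega), List.map_cons, List.prod_cons, liftSign_cycleLift ε (hL m (by simp))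
      (by omega)]

end Blocks

/-! ## Cycle data of the elements of a wreath product -/

section Wreath

open Function

variable {Γ : Type u} [Group Γ] {n : ℕ}

theorem perm_inv_apply_self {α : Type*} (σ : Perm α) (a : α) : σ⁻¹ (σ a) = a :=
  σ.symm_apply_apply a

theorem perm_apply_inv_self {α : Type*} (σ : Perm α) (a : α) : σ (σ⁻¹ a) = a :=
  σ.apply_symm_apply a

theorem perm_inv_apply_eq_iff {α : Type*} {σ : Perm α} {a b : α} : σ⁻¹ a = b ↔ a = σ b :=
  σ.symm_apply_eq

theorem wr_mul_left_apply (x y : Wr Γ n) (i : Fin n) :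
    (x * y).left i = x.left i * y.left (x.right⁻¹ i) := rfl

theorem wr_mul_left_apply' (x y : Wr Γ n) (i : Fin n) :
    (x * y).left (x.right i) = x.left (x.right i) * y.left i := by
  rw [wr_mul_left_apply, perm_inv_apply_self]

theorem wr_pow_right (x : Wr Γ n) (k : ℕ) : (x ^ k).right = x.right ^ k :=
  map_pow (SemidirectProduct.rightHom : Wr Γ n →* Perm (Fin n)) x k

/-- The product of the entries of `x` along the cycle through `i`, ending at `i`. -/
def cyc (x : Wr Γ n) (i : Fin n) : Γ := (x ^ minimalPeriod x.right i).left i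

theorem minimalPeriod_pos (σ : Perm (Fin n)) (i : Fin n) : 0 < minimalPeriod σ i :=
  minimalPeriod_pos_of_mem_periodicPts
    ⟨orderOf σ, orderOf_pos σ, by
      rw [IsPeriodicPt, IsFixedPt, Perm.iterate_eq_pow, pow_orderOf_eq_one, Perm.one_apply]⟩

theorem pow_minimalPeriod_apply (σ : Perm (Fin n)) (i : Fin n) :
    (σ ^ minimalPeriod σ i) i = i := by
  rw [← Perm.iterate_eq_pow]
  exact isPeriodicPt_minimalPeriod _ _

/-- The entry of `x^k` at `σ^k i` multiplies the entries at `σ i, …, σ^k i`. The cycle product that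
matches `cyc x i` therefore starts one step later, at `σ i`; its class is unaffected. -/
theorem cycleProd_eq_cyc (x : Wr Γ n) (i : Fin n) :
    cycleProd x (x.right i) = cyc x i := by
  have key : ∀ k : ℕ, (x ^ k).left ((x.right ^ k) i) =
      ((List.range k).reverse.map fun j => x.left ((x.right ^ j) (x.right i))).prod := by
    intro k
    induction k with
    | zero => simp
    | succ k ih =>
      rw [pow_succ', pow_succ', Perm.mul_apply, wr_mul_left_apply', ih, List.range_succ,
        List.reverse_append, List.reverse_singleton, List.singleton_append, List.map_cons,
        List.prod_cons, ← Perm.mul_apply _ x.right i, ← pow_succ, ← Perm.mul_apply, ← pow_succ']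
  have hk : minimalPeriod x.right (x.right i) = minimalPeriod x.right i :=
    minimalPeriod_apply (minimalPeriod_pos_iff_mem_periodicPts.1 (minimalPeriod_pos x.right i))
  rw [cycleProd, cyc, hk, ← key, pow_minimalPeriod_apply]

/-- The action of the wreath product on `Fin n × Γ` that commutes with right multiplication. -/
def wrAct (x : Wr Γ n) (p : Fin n × Γ) : Fin n × Γ := (x.right p.1, x.left (x.right p.1) * p.2)

theorem wrAct_mul (x y : Wr Γ n) (p : Fin n × Γ) : wrAct (x * y) p = wrAct x (wrAct y p) := by
  simp only [wrAct, wr_mul_left_apply, SemidirectProduct.mul_right, Perm.mul_apply,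
    perm_inv_apply_self, mul_assoc]

theorem wrAct_one (p : Fin n × Γ) : wrAct 1 p = p := by simp [wrAct]

/-- Right multiplication of the second component. -/
def rightMul (p : Fin n × Γ) (g : Γ) : Fin n × Γ := (p.1, p.2 * g)

theorem rightMul_rightMul (p : Fin n × Γ) (g h : Γ) :
    rightMul (rightMul p g) h = rightMul p (g * h) := by
  simp only [rightMul, mul_assoc]

theorem rightMul_one (p : Fin n × Γ) : rightMul p 1 = p := by simp [rightMul]

theorem wrAct_rightMul (x : Wr Γ n) (p : Fin n × Γ) (g : Γ) :
    wrAct x (rightMul p g) = rightMul (wrAct x p) g := by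
  simp only [wrAct, rightMul, mul_assoc]

theorem wr_ext_of_wrAct {x y : Wr Γ n} (h : ∀ i, wrAct x (i, 1) = wrAct y (i, 1)) : x = y := by
  have h1 : x.right = y.right := Equiv.ext fun i => congrArg Prod.fst (h i)
  refine SemidirectProduct.ext (funext fun i => ?_) h1
  have := congrArg Prod.snd (h (x.right⁻¹ i))
  simpa only [wrAct, mul_one, ← h1, perm_apply_inv_self] using this

/-- The length and the class of the cycle product of the cycle through `i`. -/
def ptData (x : Wr Γ n) (i : Fin n) : ℕ × ConjClasses Γ :=
  (minimalPeriod x.right i, ConjClasses.mk (cyc x i))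

/-- Intertwining elements preserve the data of points. -/
theorem conj_cyc {w x y : Wr Γ n} (h : w * x = y * w) (i : Fin n) :
    minimalPeriod y.right (w.right i) = minimalPeriod x.right i ∧
      w.left (w.right i) * cyc x i = cyc y (w.right i) * w.left (w.right i) := by
  have hp : ∀ k : ℕ, w * x ^ k = y ^ k * w := fun k => (SemiconjBy.pow_right h k)
  have hr : ∀ k : ℕ, w.right ((x.right ^ k) i) = (y.right ^ k) (w.right i) := by
    intro k
    have := congrArg (fun v : Wr Γ n => v.right i) (hp k)
    simpa [wr_pow_right] using this
  have hm : minimalPeriod y.right (w.right i) = minimalPeriod x.right i := by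
    rw [minimalPeriod_eq_minimalPeriod_iff]
    intro k
    rw [IsPeriodicPt, IsPeriodicPt, IsFixedPt, IsFixedPt, Perm.iterate_eq_pow,
      Perm.iterate_eq_pow, ← hr, EmbeddingLike.apply_eq_iff_eq]
  refine ⟨hm, ?_⟩
  rw [cyc, cyc, hm, ← wr_mul_left_apply', hp]
  rw [wr_mul_left_apply, wr_pow_right]
  congr 1
  refine congrArg w.left ?_
  rw [perm_inv_apply_eq_iff, ← hm, pow_minimalPeriod_apply]

theorem ptData_conj {w x y : Wr Γ n} (h : w * x = y * w) (i : Fin n) :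
    ptData y (w.right i) = ptData x i := by
  obtain ⟨h1, h2⟩ := conj_cyc h i
  refine Prod.ext h1 (ConjClasses.mk_eq_mk_iff_isConj.2 (isConj_iff.2
    ⟨(w.left (w.right i))⁻¹, ?_⟩))
  rw [inv_inv, mul_assoc, ← h2, inv_mul_cancel_left]

/-- Powers of `x` commute with `x`, so they are intertwiners that move a point along its cycle and
preserve its data. -/
theorem ptData_sameCycle (x : Wr Γ n) {i j : Fin n} (h : x.right.SameCycle i j) :
    ptData x i = ptData x j := by
  obtain ⟨k, rfl⟩ := h
  have hk : (x ^ k).right = x.right ^ k :=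
    map_zpow (SemidirectProduct.rightHom : Wr Γ n →* Perm (Fin n)) x k
  rw [← hk]
  exact (ptData_conj (Commute.zpow_self x k).eq i).symm

/-- The length and the class of the cycle product of a cycle. -/
def cycData (x : Wr Γ n) (q : Cycles x.right) : ℕ × ConjClasses Γ := ptData x q.out

theorem cycles_out_sameCycle {σ : Perm (Fin n)} (i : Fin n) :
    σ.SameCycle (Quotient.out (Quotient.mk (Perm.SameCycle.setoid σ) i)) i :=
  Quotient.mk_out (s := Perm.SameCycle.setoid σ) i

theorem cycData_mk (x : Wr Γ n) (i : Fin n) :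
    cycData x (Quotient.mk (Perm.SameCycle.setoid x.right) i) = ptData x i :=
  ptData_sameCycle x (cycles_out_sameCycle i)

theorem mk_cycleProd (x : Wr Γ n) (i : Fin n) :
    ConjClasses.mk (cycleProd x i) = (ptData x i).2 := by
  have h1 := cycleProd_eq_cyc x (x.right⁻¹ i)
  rw [perm_apply_inv_self] at h1
  rw [h1]
  exact congrArg Prod.snd (ptData_sameCycle x (i := x.right⁻¹ i) (j := i) ⟨1, by simp⟩)

open Classical in
theorem count_typeOf (x : Wr Γ n) (k : ℕ) (c : ConjClasses Γ) :
    (typeOf x c).count k = Nat.card {q : Cycles x.right // cycData x q = (k, c)} := by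
  rw [typeOf, Multiset.count_map, ← Finset.filter_val, Finset.filter_filter, Finset.card_val,
    Nat.card_eq_fintype_card, Fintype.card_subtype]
  congr 1
  ext q
  simp only [Finset.mem_filter, Finset.mem_univ, true_and, mk_cycleProd, cycData, Prod.ext_iff]
  exact ⟨fun h => ⟨h.2.symm, h.1⟩, fun h => ⟨h.2, h.1.symm⟩⟩

/-- Two functions on finite types with equinumerous fibers differ by a bijection. -/
theorem exists_equiv_of_card_fiber {A B K : Type*} [Finite A] [Finite B] {f : A → K} {g : B → K}
    (h : ∀ k, Nat.card {a // f a = k} = Nat.card {b // g b = k}) :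
    ∃ e : A ≃ B, ∀ a, g (e a) = f a := by
  have e : ∀ k, {a // f a = k} ≃ {b // g b = k} := fun k => (Finite.card_eq.1 (h k)).some
  refine ⟨(sigmaFiberEquiv f).symm.trans ((sigmaCongrRight e).trans (sigmaFiberEquiv g)), ?_⟩
  intro a
  exact (e (f a) ⟨a, rfl⟩).2

theorem typeOf_eq_iff {x y : Wr Γ n} : typeOf x = typeOf y ↔
    ∃ b : Cycles x.right ≃ Cycles y.right, ∀ q, cycData y (b q) = cycData x q := by
  classical
  constructor
  · intro h
    refine exists_equiv_of_card_fiber fun k => ?_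
    rw [← count_typeOf x k.1 k.2, ← count_typeOf y k.1 k.2, h]
  · rintro ⟨b, hb⟩
    funext c
    ext k
    rw [count_typeOf, count_typeOf]
    exact Nat.card_congr (b.subtypeEquiv fun q => by rw [hb])

/-- The bijection of cycles induced by an intertwining element. -/
def cyclesEquiv {w x y : Wr Γ n} (h : w * x = y * w) : Cycles x.right ≃ Cycles y.right :=
  Quotient.congr w.right (by
    intro i j
    have hr : y.right = w.right * x.right * w.right⁻¹ := by
      rw [eq_mul_inv_iff_mul_eq]
      exact (congrArg SemidirectProduct.right h).symm
    change x.right.SameCycle i j ↔ y.right.SameCycle (w.right i) (w.right j)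
    rw [hr, Perm.sameCycle_conj, perm_inv_apply_self, perm_inv_apply_self])

theorem cycData_cyclesEquiv {w x y : Wr Γ n} (h : w * x = y * w) (q : Cycles x.right) :
    cycData y (cyclesEquiv h q) = cycData x q := by
  induction q using Quotient.inductionOn with
  | h i => exact (cycData_mk y _).trans ((ptData_conj h i).trans (cycData_mk x i).symm)

theorem typeOf_eq_of_intertwine {w x y : Wr Γ n} (h : w * x = y * w) : typeOf x = typeOf y :=
  typeOf_eq_iff.2 ⟨_, cycData_cyclesEquiv h⟩

theorem typeOf_eq_of_isConj {x y : Wr Γ n} (h : IsConj x y) : typeOf x = typeOf y := by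
  obtain ⟨w, hw⟩ := isConj_iff.1 h
  exact typeOf_eq_of_intertwine (w := w) (by rw [← hw, inv_mul_cancel_right])

theorem ptData_inv (x : Wr Γ n) (i : Fin n) :
    ptData x⁻¹ i = ((ptData x i).1, invClass (ptData x i).2) := by
  have hm : minimalPeriod (x⁻¹).right i = minimalPeriod x.right i := by
    rw [minimalPeriod_eq_minimalPeriod_iff]
    intro k
    rw [IsPeriodicPt, IsPeriodicPt, IsFixedPt, IsFixedPt, Perm.iterate_eq_pow,
      Perm.iterate_eq_pow, SemidirectProduct.inv_right, inv_pow, perm_inv_apply_eq_iff, eq_comm]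
  refine Prod.ext hm ?_
  change ConjClasses.mk (cyc x⁻¹ i) = ConjClasses.mk (cyc x i)⁻¹
  congr 1
  rw [cyc, cyc, hm, inv_pow]
  have h1 := wr_mul_left_apply (x ^ minimalPeriod x.right i)⁻¹ (x ^ minimalPeriod x.right i) i
  rw [inv_mul_cancel, SemidirectProduct.inv_right, inv_inv, wr_pow_right,
    pow_minimalPeriod_apply] at h1
  exact eq_inv_of_mul_eq_one_left h1.symm

theorem invClass_invClass (c : ConjClasses Γ) : invClass (invClass c) = c := by
  induction c using Quotient.inductionOn with
  | h a => exact congrArg ConjClasses.mk (inv_inv a)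

theorem typeOf_inv (x : Wr Γ n) (c : ConjClasses Γ) : typeOf x⁻¹ c = typeOf x (invClass c) := by
  classical
  ext k
  rw [count_typeOf, count_typeOf]
  let b : Cycles (x⁻¹).right ≃ Cycles x.right := Quotient.congr (Equiv.refl _) (by
    intro i j
    change (x.right⁻¹).SameCycle i j ↔ x.right.SameCycle i j
    rw [Perm.sameCycle_inv])
  refine Nat.card_congr (b.subtypeEquiv fun q => ?_)
  induction q using Quotient.inductionOn with
  | h i =>
    have hb : b (Quotient.mk _ i) = Quotient.mk (Perm.SameCycle.setoid x.right) i := rfl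
    rw [hb, cycData_mk, cycData_mk, ptData_inv, Prod.ext_iff, Prod.ext_iff]
    dsimp only
    refine and_congr_right fun _ => ⟨?_, ?_⟩
    · rintro rfl; rw [invClass_invClass]
    · intro h; rw [h, invClass_invClass]

end Wreath

/-! ## Conjugacy and centralizers in wreath products -/

section Conjugacy

open Function

variable {Γ : Type u} [Group Γ] {n : ℕ}

theorem wrAct_pow_succ (x : Wr Γ n) (k : ℕ) (p : Fin n × Γ) :
    wrAct (x ^ (k + 1)) p = wrAct x (wrAct (x ^ k) p) := by rw [pow_succ', wrAct_mul]

theorem wrAct_pow_fst (x : Wr Γ n) (k : ℕ) (p : Fin n × Γ) :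
    (wrAct (x ^ k) p).1 = (x.right ^ k) p.1 := by rw [wrAct, wr_pow_right]

theorem wrAct_pow_minimalPeriod (x : Wr Γ n) (p : Fin n × Γ) :
    wrAct (x ^ minimalPeriod x.right p.1) p = (p.1, cyc x p.1 * p.2) := by
  rw [wrAct, wr_pow_right, pow_minimalPeriod_apply, cyc]

theorem rightMul_injective (g : Γ) : Injective fun p : Fin n × Γ => rightMul p g := by
  intro p q h
  have := congrArg (fun p => rightMul p g⁻¹) h
  simpa only [rightMul_rightMul, mul_inv_cancel, rightMul_one] using this

theorem exists_pow_out (σ : Perm (Fin n)) (i : Fin n) :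
    ∃ k : ℕ, (σ ^ k) (Quotient.mk (Perm.SameCycle.setoid σ) i).out = i :=
  (cycles_out_sameCycle i).exists_nat_pow_eq

theorem mk_pow_out {σ : Perm (Fin n)} (q : Cycles σ) (k : ℕ) :
    Quotient.mk (Perm.SameCycle.setoid σ) ((σ ^ k) q.out) = q := by
  conv_rhs => rw [← Quotient.out_eq q]
  exact Quotient.sound (s := Perm.SameCycle.setoid σ)
    (show σ.SameCycle _ _ from (Perm.sameCycle_pow_left).2 (Perm.SameCycle.refl _ _))

theorem mod_minimalPeriod_eq_iff {σ : Perm (Fin n)} {i : Fin n} {k l : ℕ} :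
    k % minimalPeriod σ i = l % minimalPeriod σ i ↔ (σ ^ k) i = (σ ^ l) i := by
  rw [← Perm.iterate_eq_pow, ← Perm.iterate_eq_pow, ← iterate_mod_minimalPeriod_eq (n := k),
    ← iterate_mod_minimalPeriod_eq (n := l)]
  refine ⟨fun h => by rw [h], fun h => ?_⟩
  exact iterate_injOn_Iio_minimalPeriod (Nat.mod_lt _ (minimalPeriod_pos σ i))
    (Nat.mod_lt _ (minimalPeriod_pos σ i)) h

/-- An intertwining element is determined by the images of one point of every cycle. -/
theorem intertwine_unique {w w' x y : Wr Γ n} (h : w * x = y * w) (h' : w' * x = y * w')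
    (hq : ∀ q : Cycles x.right, wrAct w (q.out, 1) = wrAct w' (q.out, 1)) : w = w' := by
  refine wr_ext_of_wrAct fun i => ?_
  obtain ⟨k, hk⟩ := exists_pow_out x.right i
  set q : Cycles x.right := Quotient.mk _ i
  have e : ∀ v : Wr Γ n, v * x = y * v →
      rightMul (wrAct v (i, 1)) (wrAct (x ^ k) (q.out, 1)).2 =
        wrAct (y ^ k) (wrAct v (q.out, 1)) := by
    intro v hv
    rw [← wrAct_mul, ← (SemiconjBy.pow_right hv k : v * x ^ k = y ^ k * v), wrAct_mul,
      ← wrAct_rightMul]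
    congr 1
    refine Prod.ext ?_ (one_mul _)
    rw [wrAct_pow_fst]
    exact hk.symm
  refine rightMul_injective _ ((e w h).trans ?_)
  rw [hq]
  exact (e w' h').symm

/-- Intertwining elements exist for all admissible images of the chosen points of the cycles. -/
theorem exists_intertwine {x y : Wr Γ n} (d : Cycles x.right → Fin n × Γ)
    (hm : ∀ q, minimalPeriod y.right (d q).1 = minimalPeriod x.right q.out)
    (hc : ∀ q, (d q).2 * cyc x q.out = cyc y (d q).1 * (d q).2)
    (hinj : Injective fun q => Quotient.mk (Perm.SameCycle.setoid y.right) (d q).1) :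
    ∃ w : Wr Γ n, w * x = y * w ∧ ∀ q : Cycles x.right, wrAct w (q.out, 1) = d q := by
  -- An intertwiner `w` with `w (q.out, 1) = d q` must send `x^k (q.out, 1)` to `y^k (d q)`. Right
  -- multiplication, which commutes with the actions, brings the second coordinate of the source
  -- back to `1`; `G q k` is the forced value at the `k`-th point of `q`.
  let G : Cycles x.right → ℕ → Fin n × Γ := fun q k =>
    rightMul (wrAct (y ^ k) (d q)) (wrAct (x ^ k) (q.out, 1)).2⁻¹
  -- Going once around the cycle multiplies both factors by the same cycle product, by `hm` and
  -- `hc`, so the forced values are consistent.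
  have hper : ∀ q, Periodic (G q) (minimalPeriod x.right q.out) := by
    intro q k
    have h1 := wrAct_pow_minimalPeriod x (q.out, 1)
    have h2 := wrAct_pow_minimalPeriod y (d q)
    rw [hm, ← hc] at h2
    have h1' : wrAct (x ^ minimalPeriod x.right q.out) (q.out, 1) =
        rightMul (q.out, 1) (cyc x q.out) := by
      rw [h1, rightMul, one_mul, mul_one]
    have h2' : wrAct (y ^ minimalPeriod x.right q.out) (d q) =
        rightMul (d q) (cyc x q.out) := h2
    simp only [G]
    rw [pow_add, pow_add, wrAct_mul, wrAct_mul, h1', h2', wrAct_rightMul, wrAct_rightMul,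
      rightMul_rightMul]
    congr 1
    rw [rightMul, mul_inv_rev, mul_inv_cancel_left]
  have hG : ∀ q k l, (x.right ^ k) q.out = (x.right ^ l) q.out → G q k = G q l := by
    intro q k l h
    rw [← (hper q).map_mod_nat k, ← (hper q).map_mod_nat l, mod_minimalPeriod_eq_iff.2 h]
  choose κ hκ using exists_pow_out x.right
  let F : Fin n → Fin n × Γ := fun i => G (Quotient.mk _ i) (κ i)
  have hF : ∀ q k, F ((x.right ^ k) q.out) = G q k := by
    intro q k
    have h1 := hκ ((x.right ^ k) q.out)
    simp only [F]
    rw [mk_pow_out] at h1 ⊢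
    exact hG _ _ _ h1
  have hrep : ∀ i, ∃ q k, (x.right ^ k) (Quotient.out (q : Cycles x.right)) = i :=
    fun i => ⟨_, κ i, hκ i⟩
  have hstep : ∀ i, rightMul (F (x.right i)) (x.left (x.right i)) = wrAct y (F i) := by
    intro i
    obtain ⟨q, k, rfl⟩ := hrep i
    rw [hF, ← Perm.mul_apply, ← pow_succ', hF]
    simp only [G]
    rw [wrAct_rightMul, ← wrAct_pow_succ, rightMul_rightMul]
    congr 1
    rw [wrAct_pow_succ, wrAct, wrAct_pow_fst, mul_inv_rev, pow_succ', Perm.mul_apply,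
      inv_mul_cancel_right]
  have hF1 : ∀ q k, (F ((x.right ^ k) q.out)).1 = (y.right ^ k) (d q).1 := by
    intro q k
    rw [hF]
    exact wrAct_pow_fst _ _ _
  -- Different cycles go to different cycles by `hinj`, and within a cycle the equality of periods
  -- `hm` prevents collisions.
  have hFinj : Injective fun i => (F i).1 := by
    intro i i' h
    obtain ⟨q, k, rfl⟩ := hrep i
    obtain ⟨q', k', rfl⟩ := hrep i'
    simp only [hF1] at h
    have hq : q = q' := by
      apply hinj
      refine Quotient.sound (s := Perm.SameCycle.setoid y.right) ?_
      change y.right.SameCycle _ _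
      rw [← Perm.sameCycle_pow_left (n := k), h, Perm.sameCycle_pow_left]
    subst hq
    rw [← mod_minimalPeriod_eq_iff, hm, mod_minimalPeriod_eq_iff] at h
    exact h
  let φ : Perm (Fin n) := Equiv.ofBijective _ (Finite.injective_iff_bijective.1 hFinj)
  let w : Wr Γ n := ⟨fun j => (F (φ.symm j)).2, φ⟩
  have hw : ∀ i, wrAct w (i, 1) = F i := by
    intro i
    refine Prod.ext rfl ?_
    change (F (φ.symm (φ i))).2 * 1 = _
    rw [mul_one, φ.symm_apply_apply]
  refine ⟨w, wr_ext_of_wrAct fun i => ?_, fun q => ?_⟩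
  · rw [wrAct_mul, wrAct_mul, hw, ← hstep, ← hw, ← wrAct_rightMul]
    congr 1
    simp [wrAct, rightMul]
  · rw [hw]
    have := hF q 0
    simp only [pow_zero, Perm.one_apply] at this
    rw [this]
    simp [G, wrAct_one, rightMul_one]

/-- Elements of the same type are conjugate. -/
theorem isConj_of_typeOf_eq {x y : Wr Γ n} (h : typeOf x = typeOf y) : IsConj x y := by
  obtain ⟨b, hb⟩ := typeOf_eq_iff.1 h
  have hu : ∀ q, ∃ u : Γ, u * cyc x q.out = cyc y (b q).out * u := by
    intro q
    have h1 := congrArg Prod.snd (hb q)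
    obtain ⟨u, hu⟩ := isConj_iff.1 (ConjClasses.mk_eq_mk_iff_isConj.1 h1.symm)
    exact ⟨u, by rw [← hu, inv_mul_cancel_right]⟩
  choose u hu using hu
  obtain ⟨w, hw, -⟩ := exists_intertwine (x := x) (y := y) (fun q => ((b q).out, u q))
    (fun q => congrArg Prod.fst (hb q)) hu (by
      intro q q' hqq
      simpa using hqq)
  exact isConj_iff.2 ⟨w, by rw [hw, mul_inv_cancel_right]⟩

theorem card_isConj_mul_card_centralizer {G : Type*} [Group G] [Finite G] (x : G) :
    Nat.card {y // IsConj x y} * Nat.card (Subgroup.centralizer {x}) = Nat.card G := by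
  rw [Subgroup.nat_card_centralizer_nat_card_stabilizer,
    Nat.card_congr (α := {y // IsConj x y}) (β := MulAction.orbit (ConjAct G) x)
      (Equiv.subtypeEquivRight fun y => by rw [ConjAct.mem_orbit_conjAct, isConj_comm]),
    ← Nat.card_prod, Nat.card_congr (MulAction.orbitProdStabilizerEquivGroup (ConjAct G) x)]
  exact Nat.card_congr ConjAct.ofConjAct.toEquiv

theorem card_conjugators {G : Type*} [Group G] {a b : G} (h : IsConj a b) :
    Nat.card {u : G // u * a = b * u} = Nat.card (Subgroup.centralizer {a}) := by
  obtain ⟨v, hv⟩ := isConj_iff.1 h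
  refine Nat.card_congr ((Equiv.mulLeft v⁻¹).subtypeEquiv fun u => ?_)
  rw [Subgroup.mem_centralizer_singleton_iff, ← hv]
  change _ ↔ v⁻¹ * u * a = a * (v⁻¹ * u)
  rw [← mul_right_inj v (b := v⁻¹ * u * a)]
  simp only [← mul_assoc, mul_inv_cancel, one_mul]

end Conjugacy

/-! ## The order of the centralizer of an element of given type -/

section Centralizer

open Function

variable {Γ : Type u} [Group Γ] {n : ℕ}

theorem card_centralizer_mk [Finite Γ] (a : Γ) :
    Nat.card (Subgroup.centralizer {a}) = zeta (ConjClasses.mk a) := by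
  have h : IsConj a (Quotient.out (ConjClasses.mk a)) :=
    ConjClasses.mk_eq_mk_iff_isConj.1 (Quotient.out_eq (ConjClasses.mk a)).symm
  have h1 := card_isConj_mul_card_centralizer a
  have h2 := card_isConj_mul_card_centralizer (Quotient.out (ConjClasses.mk a))
  have h3 : Nat.card {y // IsConj a y} =
      Nat.card {y // IsConj (Quotient.out (ConjClasses.mk a)) y} :=
    Nat.card_congr (Equiv.subtypeEquivRight fun y =>
      ⟨fun hy => h.symm.trans hy, fun hy => h.trans hy⟩)
  rw [← h2, ← h3] at h1
  have : Nonempty {y // IsConj a y} := ⟨⟨a, IsConj.refl a⟩⟩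
  exact Nat.eq_of_mul_eq_mul_left Nat.card_pos h1

theorem card_cycle {σ : Perm (Fin n)} (q : Cycles σ) :
    Nat.card {i // Quotient.mk (Perm.SameCycle.setoid σ) i = q} = minimalPeriod σ q.out := by
  rw [← Nat.card_fin (minimalPeriod σ q.out)]
  refine (Nat.card_eq_of_bijective (fun k : Fin (minimalPeriod σ q.out) =>
    (⟨(σ ^ k.1) q.out, mk_pow_out q k⟩ :
      {i // Quotient.mk (Perm.SameCycle.setoid σ) i = q})) ⟨?_, ?_⟩).symm
  · intro k l h
    have h1 := mod_minimalPeriod_eq_iff.2 (congrArg Subtype.val h)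
    rw [Nat.mod_eq_of_lt k.2, Nat.mod_eq_of_lt l.2] at h1
    exact Fin.ext h1
  · rintro ⟨i, rfl⟩
    obtain ⟨k, hk⟩ := exists_pow_out σ i
    refine ⟨⟨k % _, Nat.mod_lt _ (minimalPeriod_pos σ _)⟩, Subtype.ext ?_⟩
    exact (mod_minimalPeriod_eq_iff.1 (Nat.mod_mod _ _)).trans hk

/-- The base point may go to any of the `k` points of the target cycle. For each of them the
admissible second coordinates conjugate one cycle product into the other, and so form a coset of a
centralizer of order `ζ_c`. -/
theorem card_admissible [Finite Γ] (x : Wr Γ n) {q q' : Cycles x.right}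
    (h : cycData x q' = cycData x q) :
    Nat.card {p : Fin n × Γ // Quotient.mk (Perm.SameCycle.setoid x.right) p.1 = q' ∧
      p.2 * cyc x q.out = cyc x p.1 * p.2} = (cycData x q).1 * zeta (cycData x q).2 := by
  classical
  let e : {p : Fin n × Γ // Quotient.mk (Perm.SameCycle.setoid x.right) p.1 = q' ∧
      p.2 * cyc x q.out = cyc x p.1 * p.2} ≃
      Σ i : {i // Quotient.mk (Perm.SameCycle.setoid x.right) i = q'},
        {u // u * cyc x q.out = cyc x i.1 * u} :=
    { toFun := fun p => ⟨⟨p.1.1, p.2.1⟩, ⟨p.1.2, p.2.2⟩⟩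
      invFun := fun s => ⟨(s.1.1, s.2.1), ⟨s.1.2, s.2.2⟩⟩
      left_inv := fun _ => rfl
      right_inv := fun _ => rfl }
  rw [Nat.card_congr e, Nat.card_sigma]
  have h1 : ∀ i : {i // Quotient.mk (Perm.SameCycle.setoid x.right) i = q'},
      Nat.card {u // u * cyc x q.out = cyc x i.1 * u} = zeta (cycData x q).2 := by
    rintro ⟨i, rfl⟩
    rw [cycData_mk] at h
    rw [card_conjugators, card_centralizer_mk]
    · rfl
    · exact ConjClasses.mk_eq_mk_iff_isConj.1 (congrArg Prod.snd h).symm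
  rw [Finset.sum_congr rfl fun i _ => h1 i, Finset.sum_const, smul_eq_mul, Finset.card_univ,
    ← Nat.card_eq_fintype_card, card_cycle]
  congr 1
  exact congrArg Prod.fst h

open Classical in
-- A centralizing element is the same as a permutation `b` of the cycles that preserves length and
-- class, together with an admissible image in the cycle `b q` of the base point of each cycle `q`:
-- `intertwine_unique` gives injectivity and `exists_intertwine` realizes every choice. The
-- permutations contribute the factorials and the base points the factors `k ζ_c`.
theorem card_centralizer_cycData [Finite Γ] (x : Wr Γ n) :
    Nat.card (Subgroup.centralizer {x}) =
      (∏ p ∈ Finset.univ.image (cycData x),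
        (Nat.card {q : Cycles x.right // cycData x q = p}).factorial) *
      ∏ q : Cycles x.right, (cycData x q).1 * zeta (cycData x q).2 := by
  let T (b : {b : Perm (Cycles x.right) // cycData x ∘ b = cycData x}) (q : Cycles x.right) :=
    {p : Fin n × Γ // Quotient.mk (Perm.SameCycle.setoid x.right) p.1 = b.1 q ∧
      p.2 * cyc x q.out = cyc x p.1 * p.2}
  have hcomm : ∀ w : Subgroup.centralizer {x}, w.1 * x = x * w.1 := fun w =>
    Subgroup.mem_centralizer_singleton_iff.1 w.2
  let f : Subgroup.centralizer {x} → (Cycles x.right → Fin n × Γ) :=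
    fun w q => wrAct w.1 (q.out, 1)
  let g : (Σ b, ∀ q, T b q) → (Cycles x.right → Fin n × Γ) := fun s q => (s.2 q).1
  have hf : Injective f := fun w w' h =>
    Subtype.ext (intertwine_unique (hcomm w) (hcomm w') fun q => congrFun h q)
  have hg : Injective g := by
    rintro ⟨b, d⟩ ⟨b', d'⟩ h
    have hb : b = b' := Subtype.ext (Equiv.ext fun q => by
      rw [← (d q).2.1, ← (d' q).2.1]
      exact congrArg (fun p : Fin n × Γ => Quotient.mk (Perm.SameCycle.setoid x.right) p.1)
        (congrFun h q))
    subst hb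
    congr 1
    funext q
    exact Subtype.ext (congrFun h q)
  have hrange : Set.range f = Set.range g := by
    apply Set.eq_of_subset_of_subset
    · rintro _ ⟨w, rfl⟩
      refine ⟨⟨⟨cyclesEquiv (hcomm w), funext fun q => cycData_cyclesEquiv (hcomm w) q⟩,
        fun q => ⟨wrAct w.1 (q.out, 1), ?_, ?_⟩⟩, rfl⟩
      · conv_rhs => rw [← Quotient.out_eq q]
        rfl
      · have := (conj_cyc (hcomm w) q.out).2
        simpa only [wrAct, mul_one] using this
    · rintro _ ⟨⟨b, d⟩, rfl⟩
      have hpt : ∀ q, ptData x (d q).1.1 = ptData x q.out := by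
        intro q
        rw [← cycData_mk, (d q).2.1]
        exact congrFun b.2 q
      obtain ⟨w, hw, hw'⟩ := exists_intertwine (x := x) (y := x) (fun q => (d q).1)
        (fun q => congrArg Prod.fst (hpt q)) (fun q => (d q).2.2) (by
          intro q q' h
          simp only [(d _).2.1] at h
          exact b.1.injective h)
      exact ⟨⟨w, Subgroup.mem_centralizer_singleton_iff.2 hw⟩, funext hw'⟩
  rw [← Nat.card_range_of_injective hf, hrange, Nat.card_range_of_injective hg, Nat.card_sigma]
  have hT : ∀ b, Nat.card (∀ q, T b q) =
      ∏ q : Cycles x.right, (cycData x q).1 * zeta (cycData x q).2 := by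
    intro b
    rw [Nat.card_pi]
    exact Finset.prod_congr rfl fun q _ => card_admissible x (congrFun b.2 q)
  rw [Finset.sum_congr rfl fun b _ => hT b, Finset.sum_const, smul_eq_mul, Finset.card_univ,
    ← Nat.card_eq_fintype_card, Nat.card_eq_fintype_card, DomMulAct.stabilizer_card']
  simp only [Nat.card_eq_fintype_card]

open Classical in
theorem card_centralizer_typeOf [Finite Γ] (x : Wr Γ n) :
    Nat.card (Subgroup.centralizer {x}) = ∏ c, (∏ k ∈ (typeOf x c).toFinset,
      k ^ (typeOf x c).count k * ((typeOf x c).count k).factorial) *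
        zeta c ^ (typeOf x c).card := by
  have h1 : ∀ c, (∏ k ∈ (typeOf x c).toFinset,
      k ^ (typeOf x c).count k * ((typeOf x c).count k).factorial) *
        zeta c ^ (typeOf x c).card = ∏ k ∈ (typeOf x c).toFinset,
      (((typeOf x c).count k).factorial * (k * zeta c) ^ (typeOf x c).count k) := by
    intro c
    rw [← Multiset.toFinset_sum_count_eq, ← Finset.prod_pow_eq_pow_sum, ← Finset.prod_mul_distrib]
    refine Finset.prod_congr rfl fun k _ => ?_
    rw [mul_pow]
    ring
  rw [card_centralizer_cycData, Finset.prod_congr rfl fun c _ => h1 c,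
    Finset.prod_comp (fun p : ℕ × ConjClasses Γ => p.1 * zeta p.2) (cycData x),
    ← Finset.prod_mul_distrib]
  rw [← Finset.prod_finset_product_right (Finset.univ.image (cycData x)) Finset.univ
    (fun c => (typeOf x c).toFinset) (f := fun p : ℕ × ConjClasses Γ =>
      ((typeOf x p.2).count p.1).factorial * (p.1 * zeta p.2) ^ (typeOf x p.2).count p.1)]
  · refine Finset.prod_congr rfl fun p _ => ?_
    rw [count_typeOf, Nat.card_eq_fintype_card, Fintype.card_subtype]
  · rintro ⟨k, c⟩
    rw [Multiset.mem_toFinset, ← Multiset.count_pos, count_typeOf, Nat.card_eq_fintype_card,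
      Fintype.card_pos_iff]
    simp

/-- The order of the centralizer of an element of type `ρ` is `Z_ρ`. -/
theorem card_centralizer_of_typeOf [Finite Γ] {x : Wr Γ n} {ρ : OP Γ}
    (h : ∀ c, typeOf x c = (ρ c).map Subtype.val) :
    Nat.card (Subgroup.centralizer {x}) = ρ.Z := by
  classical
  rw [card_centralizer_typeOf, OP.Z]
  refine Finset.prod_congr rfl fun c _ => ?_
  rw [h c, Multiset.card_map, zPart, Multiset.toFinset_map,
    Finset.prod_image (Subtype.val_injective.injOn)]
  congr 1
  refine Finset.prod_congr ?_ fun k _ => ?_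
  · ext; simp
  · rw [Multiset.count_map_eq_count' _ _ Subtype.val_injective]

theorem OP_Z_ne_zero [Finite Γ] (ρ : OP Γ) : ρ.Z ≠ 0 := by
  classical
  refine Finset.prod_ne_zero_iff.2 fun c _ => mul_ne_zero ?_ (pow_ne_zero _ Nat.card_pos.ne')
  exact Finset.prod_ne_zero_iff.2 fun k _ =>
    mul_ne_zero (pow_ne_zero _ k.2.pos.ne') (Nat.factorial_ne_zero _)

/-- The number of the elements of the same type as a given one. -/
theorem card_typeOf_mul_Z [Finite Γ] {x : Wr Γ n} {ρ : OP Γ}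
    (h : ∀ c, typeOf x c = (ρ c).map Subtype.val) :
    Nat.card {y : Wr Γ n // ∀ c, typeOf y c = (ρ c).map Subtype.val} * ρ.Z =
      Nat.card (Wr Γ n) := by
  have : Finite (Wr Γ n) := Finite.of_equiv _ SemidirectProduct.equivProd.symm
  rw [← card_isConj_mul_card_centralizer x, card_centralizer_of_typeOf h]
  congr 1
  refine Nat.card_congr (Equiv.subtypeEquivRight fun y => ⟨fun hy => ?_, fun hy c => ?_⟩)
  · exact isConj_of_typeOf_eq (funext fun c => by rw [h, hy])
  · rw [← typeOf_eq_of_isConj hy, h]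

end Centralizer

/-! ## Existence of elements of given type -/

section Existence

open Function

variable {Γ : Type u} [Group Γ] {n : ℕ}

theorem minimalPeriod_out {σ : Perm (Fin n)} (i : Fin n) :
    minimalPeriod σ (Quotient.mk (Perm.SameCycle.setoid σ) i).out = minimalPeriod σ i :=
  -- A permutation is viewed as an element of the wreath product with the trivial group, where only
  -- the length of the cycle data carries information.
  congrArg Prod.fst (cycData_mk (⟨1, σ⟩ : Wr PUnit.{1} n) i)

theorem card_minimalPeriod_eq (σ : Perm (Fin n)) (k : ℕ) :
    Nat.card {i // minimalPeriod σ i = k} =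
      Nat.card {q : Cycles σ // minimalPeriod σ q.out = k} * k := by
  classical
  let e : {i // minimalPeriod σ i = k} ≃ Σ q : {q : Cycles σ // minimalPeriod σ q.out = k},
      {i // Quotient.mk (Perm.SameCycle.setoid σ) i = q.1} :=
    { toFun := fun i => ⟨⟨Quotient.mk _ i.1, by rw [minimalPeriod_out, i.2]⟩, ⟨i.1, rfl⟩⟩
      invFun := fun s => ⟨s.2.1, by rw [← minimalPeriod_out, s.2.2, s.1.2]⟩
      left_inv := fun _ => rfl
      right_inv := by
        rintro ⟨⟨q, h⟩, ⟨i, hi⟩⟩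
        obtain rfl : _ = q := hi
        rfl }
  rw [Nat.card_congr e, Nat.card_sigma, Finset.sum_congr rfl fun q _ => card_cycle q.1,
    Finset.sum_congr rfl fun q _ => q.2, Finset.sum_const, smul_eq_mul, Finset.card_univ,
    Nat.card_eq_fintype_card]

theorem count_map_toType {K L : Type*} [DecidableEq K] [DecidableEq L] (M : Multiset K)
    (f : K → L) (p : L) : Nat.card {a : M.ToType // f a.1 = p} = (M.map f).count p := by
  conv_rhs => rw [← M.map_univ_coe]
  rw [Multiset.map_map, Multiset.count_map, ← Finset.filter_val, Finset.card_val,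
    Nat.card_eq_fintype_card, Fintype.card_subtype]
  congr 1
  ext a
  simp [eq_comm]

theorem coe_partList [Finite Γ] {r : ℕ} (e : Fin r ≃ ConjClasses Γ) (ρ : OP Γ) :
    (partList e ρ : Multiset ℕ) = ∑ c, (ρ c).map Subtype.val := by
  rw [partList, ← Multiset.coe_bind, Multiset.bind, Multiset.join, Multiset.map_coe,
    Multiset.sum_coe, List.map_ofFn, List.sum_ofFn, ← Equiv.sum_comp e]
  simp

theorem odd_of_mem_partList [Finite Γ] {r : ℕ} {e : Fin r ≃ ConjClasses Γ} {ρ : OP Γ} {m : ℕ}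
    (h : m ∈ partList e ρ) : Odd m := by
  rw [partList, List.mem_flatMap] at h
  obtain ⟨c, -, h⟩ := h
  rw [Multiset.mem_sort, Multiset.mem_map] at h
  obtain ⟨k, -, rfl⟩ := h
  exact k.2

theorem sum_partList [Finite Γ] {r : ℕ} (e : Fin r ≃ ConjClasses Γ) (ρ : OP Γ) :
    (partList e ρ).sum = ρ.size := by
  rw [← Multiset.sum_coe, coe_partList, OP.size]
  exact map_sum (Multiset.sumAddMonoidHom : Multiset ℕ →+ ℕ) _ _

/-- The cycle lengths of the permutation below `t^ρ` are the parts of `ρ`. -/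
theorem card_cycles_specialElt [Finite Γ] (ε : ℕ → ℕ) {r : ℕ} (e : Fin r ≃ ConjClasses Γ)
    {ρ : OP Γ} (h : ρ.size = n) (k : ℕ) :
    Nat.card {q : Cycles (theta n (specialElt ε e n ρ)) //
      minimalPeriod (theta n (specialElt ε e n ρ)) q.out = k} = (partList e ρ).count k := by
  have hpos : ∀ m ∈ partList e ρ, 0 < m := fun m hm => (odd_of_mem_partList hm).pos
  rcases Nat.eq_zero_or_pos k with rfl | hk
  · rw [List.count_eq_zero_of_not_mem fun h0 => (hpos 0 h0).ne rfl, Nat.card_eq_zero]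
    exact Or.inl ⟨fun q => (minimalPeriod_pos _ _).ne' q.2⟩
  -- Cycles of length `k` are counted through their points: both counts of the points of period `k`
  -- carry a factor `k`, which is cancelled.
  · have h1 := card_minimalPeriod_eq (theta n (specialElt ε e n ρ)) k
    have h2 := card_minimalPeriod_blockElt ε (n := n) (a := 0) hpos
      (by rw [sum_partList, h, Nat.zero_add]) k
    have h3 : Nat.card {i // minimalPeriod (theta n (specialElt ε e n ρ)) i = k} =
        k * (partList e ρ).count k := by
      rw [← h2, Nat.card_eq_fintype_card, Fintype.card_subtype]
      congr 1
      ext x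
      rw [Finset.mem_filter, Finset.mem_filter, Nat.zero_add, sum_partList, h]
      exact ⟨fun hx => ⟨hx.1, ⟨Nat.zero_le _, x.2⟩, hx.2⟩, fun hx => ⟨hx.1, hx.2.2⟩⟩
    rw [h1, mul_comm] at h3
    exact Nat.eq_of_mul_eq_mul_left hk h3

open Classical in
/-- Every permutation and every colouring of its cycles by classes is realized by an element of
the wreath product. -/
theorem exists_cycData (σ : Perm (Fin n)) (col : Cycles σ → ConjClasses Γ) :
    ∃ g : Fin n → Γ, ∀ q : Cycles σ,
      cycData (⟨g, σ⟩ : Wr Γ n) q = (minimalPeriod σ q.out, col q) := by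
  -- A representative of the prescribed class sits at the base point of each cycle and `1`
  -- everywhere else, so the cycle product ending at the base point is that representative.
  let g : Fin n → Γ := fun i =>
    if i = (Quotient.mk (Perm.SameCycle.setoid σ) i).out then
      (col (Quotient.mk (Perm.SameCycle.setoid σ) i)).out else 1
  refine ⟨g, fun q => ?_⟩
  set x : Wr Γ n := ⟨g, σ⟩
  refine Prod.ext rfl ?_
  change ConjClasses.mk (cyc x q.out) = col q
  have hg : ∀ k, g ((σ ^ k) q.out) = if (σ ^ k) q.out = q.out then (col q).out else 1 := by
    intro k
    simp only [g]
    rw [mk_pow_out]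
  have h1 : ∀ k < minimalPeriod σ q.out, (x ^ k).left ((σ ^ k) q.out) = 1 := by
    intro k hk
    induction k with
    | zero => rfl
    | succ k ih =>
      rw [pow_succ', pow_succ' σ, Perm.mul_apply]
      refine (wr_mul_left_apply' x (x ^ k) _).trans ?_
      rw [ih (by omega), mul_one]
      change g (σ ((σ ^ k) q.out)) = 1
      rw [← Perm.mul_apply, ← pow_succ', hg, if_neg]
      intro h
      have := mod_minimalPeriod_eq_iff.2 (h.trans (by simp : q.out = (σ ^ 0) q.out))
      rw [Nat.mod_eq_of_lt hk, Nat.zero_mod] at this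
      omega
  have h2 : cyc x q.out = (col q).out := by
    obtain ⟨k, hk⟩ : ∃ k, minimalPeriod σ q.out = k + 1 :=
      ⟨minimalPeriod σ q.out - 1, by have := minimalPeriod_pos σ q.out; omega⟩
    have h3 : (σ ^ (k + 1)) q.out = q.out := by rw [← hk, pow_minimalPeriod_apply]
    change (x ^ minimalPeriod σ q.out).left q.out = _
    rw [hk]
    conv_lhs => rw [← h3]
    rw [pow_succ', pow_succ' σ, Perm.mul_apply]
    refine (wr_mul_left_apply' x (x ^ k) _).trans ?_
    rw [h1 k (by omega), mul_one]
    change g (σ ((σ ^ k) q.out)) = _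
    rw [← Perm.mul_apply, ← pow_succ', hg, if_pos h3]
  rw [h2]
  exact Quotient.out_eq _

/-- There is an element `(g, t^ρ)` of type `ρ`. -/
theorem exists_typeOf_specialElt [Finite Γ] (ε : ℕ → ℕ) {r : ℕ} (e : Fin r ≃ ConjClasses Γ)
    {ρ : OP Γ} (h : ρ.size = n) : ∃ g : Fin n → Γ, ∀ c,
      typeOf (⟨g, theta n (specialElt ε e n ρ)⟩ : Wr Γ n) c = (ρ c).map Subtype.val := by
  classical
  set σ := theta n (specialElt ε e n ρ) with hσ
  -- The parts of `ρ` labelled by their classes. The cycles of `t^ρ` have the same lengths, so a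
  -- length-preserving bijection with `M` colours the cycles, and `exists_cycData` realizes this
  -- colouring.
  let M : Multiset (ℕ × ConjClasses Γ) := ∑ c, (ρ c).map fun m => (m.1, c)
  have hM : M.map Prod.fst = (partList e ρ : Multiset ℕ) := by
    rw [coe_partList]
    refine (map_sum (Multiset.mapAddMonoidHom Prod.fst) _ _).trans ?_
    refine Finset.sum_congr rfl fun c _ => ?_
    simp [Multiset.map_map]
  have hMc : ∀ k c, M.count (k, c) = ((ρ c).map Subtype.val).count k := by
    intro k c
    simp only [M]
    rw [Multiset.count_sum', Finset.sum_eq_single c]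
    · have := Multiset.count_map_eq_count' (fun m : ℕ => (m, c)) ((ρ c).map Subtype.val)
        (fun a b hab => congrArg Prod.fst hab) k
      rw [Multiset.map_map] at this
      exact this
    · intro c' _ hc'
      refine Multiset.count_eq_zero_of_notMem fun hmem => ?_
      obtain ⟨m, -, hm⟩ := Multiset.mem_map.1 hmem
      exact hc' (congrArg Prod.snd hm)
    · simp
  obtain ⟨b, hb⟩ := exists_equiv_of_card_fiber (A := Cycles σ) (B := M.ToType)
    (f := fun q => minimalPeriod σ q.out) (g := fun a => a.1.1) (fun k => by
      rw [card_cycles_specialElt ε e h, count_map_toType M Prod.fst, hM, Multiset.coe_count])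
  obtain ⟨g, hg⟩ := exists_cycData (Γ := Γ) σ fun q => (b q).1.2
  refine ⟨g, fun c => ?_⟩
  ext k
  rw [count_typeOf, ← hMc]
  have := count_map_toType M id (k, c)
  rw [Multiset.map_id] at this
  rw [← this]
  refine Nat.card_congr (b.subtypeEquiv fun q => ?_)
  rw [hg, ← hb]
  rfl

end Existence

/-! ## The spin wreath product as a double cover -/

section DoubleCover

open Function

variable {Γ : Type u} [Group Γ] {n : ℕ}

theorem proj_mul (x y : SpinWr Γ n) : proj (x * y) = proj x * proj y :=
  SemidirectProduct.ext rfl (map_mul (theta n) _ _)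

theorem proj_one : proj (1 : SpinWr Γ n) = 1 := SemidirectProduct.ext rfl (map_one (theta n))

theorem proj_inv (x : SpinWr Γ n) : proj x⁻¹ = (proj x)⁻¹ := by
  rw [eq_inv_iff_mul_eq_one, ← proj_mul, inv_mul_cancel, proj_one]

theorem proj_surjective : Surjective (proj : SpinWr Γ n → Wr Γ n) := by
  rintro ⟨g, σ⟩
  obtain ⟨s, rfl⟩ := theta_surjective n σ
  exact ⟨⟨g, s⟩, rfl⟩

theorem wrZ_mul (x : SpinWr Γ n) : wrZ Γ n * x = ⟨x.left, spinZ n * x.right⟩ := by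
  refine SemidirectProduct.ext ?_ rfl
  change 1 * ((permAct Γ n) (theta n (spinZ n))) x.left = x.left
  rw [theta_spinZ, map_one, one_mul]
  rfl

theorem proj_wrZ_mul (x : SpinWr Γ n) : proj (wrZ Γ n * x) = proj x := by
  rw [wrZ_mul]
  refine SemidirectProduct.ext rfl ?_
  change theta n (spinZ n * x.right) = theta n x.right
  rw [map_mul, theta_spinZ, one_mul]

theorem wrZ_mul_ne (x : SpinWr Γ n) : wrZ Γ n * x ≠ x := by
  intro h
  rw [wrZ_mul] at h
  exact spinZ_mul_ne x.right (congrArg SemidirectProduct.right h)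

theorem proj_eq_iff {x y : SpinWr Γ n} : proj x = proj y ↔ x = y ∨ x = wrZ Γ n * y := by
  constructor
  · intro h
    have h1 : x.left = y.left := congrArg (fun p : Wr Γ n => p.left) h
    have h2 : theta n x.right = theta n y.right := congrArg (fun p : Wr Γ n => p.right) h
    rcases theta_eq_iff.1 h2 with h3 | h3
    · exact Or.inl (SemidirectProduct.ext h1 h3)
    · right
      rw [wrZ_mul]
      exact SemidirectProduct.ext h1 h3
  · rintro (rfl | rfl)
    · rfl
    · exact proj_wrZ_mul y

/-- The two lifts of every element of the wreath product. -/
def liftEquiv (Γ : Type u) [Group Γ] (n : ℕ) : Wr Γ n × Bool ≃ SpinWr Γ n :=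
  Equiv.ofBijective
    (fun p => if p.2 then wrZ Γ n * surjInv proj_surjective p.1 else surjInv proj_surjective p.1)
    (by
      have hs : ∀ y : Wr Γ n, proj (surjInv proj_surjective y) = y := surjInv_eq _
      constructor
      · rintro ⟨a, b⟩ ⟨a', b'⟩ h
        have h1 : ∀ (a : Wr Γ n) (b : Bool), proj (if b then wrZ Γ n *
            surjInv proj_surjective a else surjInv proj_surjective a) = a := by
          intro a b
          cases b
          · exact hs a
          · exact (proj_wrZ_mul _).trans (hs a)
        have ha : a = a' := by rw [← h1 a b, ← h1 a' b']; exact congrArg proj h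
        subst ha
        cases b <;> cases b'
        · rfl
        · exact absurd h.symm (wrZ_mul_ne _)
        · exact absurd h (wrZ_mul_ne _)
        · rfl
      · intro x
        rcases proj_eq_iff.1 (hs (proj x)).symm with h | h
        · exact ⟨(proj x, false), h.symm⟩
        · exact ⟨(proj x, true), h.symm⟩)

theorem proj_liftEquiv (p : Wr Γ n × Bool) : proj (liftEquiv Γ n p) = p.1 := by
  obtain ⟨y, b⟩ := p
  cases b
  · exact surjInv_eq proj_surjective y
  · exact (proj_wrZ_mul _).trans (surjInv_eq proj_surjective y)

instance wr_finite [Finite Γ] : Finite (Wr Γ n) :=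
  Finite.of_equiv _ SemidirectProduct.equivProd.symm

theorem card_spinWr : Nat.card (SpinWr Γ n) = Nat.card (Wr Γ n) * 2 := by
  rw [← Nat.card_congr (liftEquiv Γ n), Nat.card_prod, Nat.card_eq_fintype_card (α := Bool),
    Fintype.card_bool]

theorem finsum_comp_proj [Finite Γ] (G : Wr Γ n → ℂ) :
    ∑ᶠ x : SpinWr Γ n, G (proj x) = 2 * ∑ᶠ y, G y := by
  have := Fintype.ofFinite (Wr Γ n)
  rw [← finsum_comp_equiv (liftEquiv Γ n)]
  simp only [proj_liftEquiv]
  rw [finsum_eq_sum_of_fintype, finsum_eq_sum_of_fintype, Fintype.sum_prod_type, Finset.mul_sum]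
  refine Finset.sum_congr rfl fun y _ => ?_
  simp only [Finset.sum_const, Finset.card_univ, Fintype.card_bool, two_nsmul, two_mul]

end DoubleCover

/-! ## The split classes -/

section Split

open Function

variable {Γ : Type u} [Group Γ] {n : ℕ}

/-- The element `x` has type `ρ`. -/
def HasType (x : Wr Γ n) (ρ : OP Γ) : Prop := ∀ c, typeOf x c = (ρ c).map Subtype.val

theorem HasType.eq {x : Wr Γ n} {ρ ρ' : OP Γ} (h : HasType x ρ) (h' : HasType x ρ') : ρ = ρ' :=
  funext fun c => Multiset.map_injective Subtype.val_injective ((h c).symm.trans (h' c))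

theorem HasType.of_isConj {x y : Wr Γ n} {ρ : OP Γ} (h : HasType x ρ) (hxy : IsConj x y) :
    HasType y ρ := fun c => by rw [← typeOf_eq_of_isConj hxy, h]

theorem HasType.isConj {x y : Wr Γ n} {ρ : OP Γ} (h : HasType x ρ) (h' : HasType y ρ) :
    IsConj x y := isConj_of_typeOf_eq (funext fun c => by rw [h, h'])

theorem HasType.inv {x : Wr Γ n} {ρ : OP Γ} (h : HasType x ρ) : HasType x⁻¹ ρ.bar :=
  fun c => by rw [typeOf_inv, h]; rfl

theorem proj_isConj {x y : SpinWr Γ n} (h : IsConj x y) : IsConj (proj x) (proj y) := by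
  obtain ⟨w, rfl⟩ := isConj_iff.1 h
  exact isConj_iff.2 ⟨proj w, by rw [proj_mul, proj_mul, proj_inv]⟩

theorem mem_typeOf (x : Wr Γ n) (i : Fin n) :
    minimalPeriod x.right i ∈ typeOf x (ptData x i).2 := by
  classical
  rw [← Multiset.count_pos, count_typeOf, Nat.card_eq_fintype_card, Fintype.card_pos_iff]
  exact ⟨⟨Quotient.mk _ i, cycData_mk x i⟩⟩

theorem HasType.odd_minimalPeriod {x : Wr Γ n} {ρ : OP Γ} (h : HasType x ρ) (i : Fin n) :
    Odd (minimalPeriod x.right i) := by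
  have := mem_typeOf x i
  rw [h, Multiset.mem_map] at this
  obtain ⟨k, -, hk⟩ := this
  rw [← hk]
  exact k.2

theorem HasType.odd_orderOf {x : Wr Γ n} {ρ : OP Γ} (h : HasType x ρ) :
    Odd (orderOf x.right) := by
  refine odd_orderOf_iff.2 ⟨∏ i, minimalPeriod x.right i,
    Finset.prod_induction _ Odd (fun _ _ => Odd.mul) odd_one fun i _ => h.odd_minimalPeriod i, ?_⟩
  ext i
  rw [← Perm.iterate_eq_pow, Perm.one_apply]
  exact congrArg Fin.val ((isPeriodicPt_minimalPeriod x.right i).trans_dvd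
    (Finset.dvd_prod_of_mem _ (Finset.mem_univ i)))

theorem sum_sum_typeOf [Finite Γ] (x : Wr Γ n) : ∑ c, (typeOf x c).sum = n := by
  classical
  have h1 : ∀ c, (typeOf x c).sum =
      ∑ q : Cycles x.right, if (cycData x q).2 = c then minimalPeriod x.right q.out else 0 := by
    intro c
    rw [typeOf, ← Finset.sum_filter]
    simp only [mk_cycleProd]
    rfl
  rw [Finset.sum_congr rfl fun c _ => h1 c, Finset.sum_comm]
  simp only [Finset.sum_ite_eq, Finset.mem_univ, if_true]
  simp only [← card_cycle]
  rw [← Nat.card_sigma, Nat.card_congr (sigmaFiberEquiv _), Nat.card_fin]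

/-- An element whose cycles are all of odd length has a type in `OP_n`. -/
theorem exists_hasType [Finite Γ] {x : Wr Γ n} (h : ∀ i, Odd (minimalPeriod x.right i)) :
    ∃ ρ : OPn Γ n, HasType x ρ.1 := by
  classical
  have h1 : ∀ c, ∃ s : Multiset OddNat, s.map Subtype.val = typeOf x c := by
    intro c
    refine CanLift.prf (typeOf x c) fun k hk => ?_
    rw [← Multiset.count_pos, count_typeOf, Nat.card_eq_fintype_card, Fintype.card_pos_iff] at hk
    obtain ⟨q, hq⟩ := hk
    have : k = minimalPeriod x.right q.out := (congrArg Prod.fst hq).symm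
    rw [this]
    exact h _
  choose ρ hρ using h1
  refine ⟨⟨ρ, ?_⟩, fun c => (hρ c).symm⟩
  rw [OP.size, ← sum_sum_typeOf x]
  exact Finset.sum_congr rfl fun c _ => by rw [hρ]

theorem orderOf_cycleOf {σ : Perm (Fin n)} {i : Fin n} (hi : σ i ≠ i) :
    orderOf (σ.cycleOf i) = minimalPeriod σ i := by
  have hc := Perm.isCycle_cycleOf σ hi
  have hii : σ.cycleOf i i ≠ i := by rwa [Perm.cycleOf_apply_self]
  refine Nat.dvd_antisymm ?_ ?_
  · refine orderOf_dvd_of_pow_eq_one (hc.pow_eq_one_iff.2 ⟨i, hii, ?_⟩)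
    rw [Perm.cycleOf_pow_apply_self, pow_minimalPeriod_apply]
  · refine IsPeriodicPt.minimalPeriod_dvd ?_
    rw [IsPeriodicPt, IsFixedPt, Perm.iterate_eq_pow, ← Perm.cycleOf_pow_apply_self,
      pow_orderOf_eq_one, Perm.one_apply]

/-- An even element with a cycle of even length is conjugate to its product with `z`. -/
theorem isConj_wrZ_mul {x : SpinWr Γ n} (hx : spinParity n x.right = 1) {i : Fin n}
    (hi : Even (minimalPeriod (theta n x.right) i)) : IsConj x (wrZ Γ n * x) := by
  classical
  set σ := theta n x.right with hσ
  have hii : σ i ≠ i := by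
    intro h
    have h1 : minimalPeriod σ i = 1 := minimalPeriod_eq_one_iff_isFixedPt.2 h
    rw [h1] at hi
    exact absurd hi (by decide)
  have hc := Perm.isCycle_cycleOf σ hii
  have hsc : Perm.sign (σ.cycleOf i) = -1 := by
    rw [hc.sign, ← hc.orderOf, orderOf_cycleOf hii, hi.neg_one_pow]
  have hsσ : Perm.sign σ = 1 := by rw [hσ, sign_theta, hx, map_one]
  -- `t` lifts the cycle of even length, an odd permutation. As `σ` is even, the complementary
  -- factor `t⁻¹ x.right` is odd as well, so the two lifts commute up to exactly one `z`.
  obtain ⟨t, ht⟩ := theta_surjective n (σ.cycleOf i)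
  have hr : theta n (t⁻¹ * x.right) = (σ.cycleOf i)⁻¹ * σ := by rw [map_mul, map_inv, ht]
  have hdisj : (theta n t).Disjoint (theta n (t⁻¹ * x.right)) := by
    intro j
    rw [ht, hr]
    by_cases hj : σ.SameCycle i j
    · right
      rw [Perm.mul_apply, perm_inv_apply_eq_iff, Perm.cycleOf_apply, if_pos hj]
    · left
      rw [Perm.cycleOf_apply, if_neg hj]
  have hsuper := superCommute_of_disjoint hdisj
  rw [SuperCommute, hr, ht, map_mul, map_inv, hsc, hsσ, signZ, if_pos (by decide),
    mul_inv_cancel_left] at hsuper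
  -- `y` is the part of `x` supported on the chosen cycle. Its image in the wreath product commutes
  -- with that of `x`, and in the double cover the commutator is `z`.
  let y : SpinWr Γ n := ⟨fun j => if σ.SameCycle i j then x.left j else 1, t⟩
  have hyx : y * x = wrZ Γ n * (x * y) := by
    rw [wrZ_mul]
    refine SemidirectProduct.ext (funext fun j => ?_) ?_
    · change (if σ.SameCycle i j then x.left j else 1) * x.left ((theta n t)⁻¹ j) =
        x.left j * (if σ.SameCycle i (σ⁻¹ j) then x.left (σ⁻¹ j) else 1)
      have hj : σ.SameCycle i (σ⁻¹ j) ↔ σ.SameCycle i j := by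
        rw [← Perm.sameCycle_apply_right, perm_apply_inv_self]
      rw [ht, Perm.cycleOf_inv, Perm.cycleOf_apply]
      simp only [Perm.sameCycle_inv, hj]
      split_ifs with h
      · rfl
      · rw [one_mul, mul_one]
    · change t * x.right = spinZ n * (x.right * t)
      conv_lhs => rw [hsuper]
      rw [← mul_assoc, ← mul_assoc, spinZ_comm, mul_assoc (spinZ n), mul_inv_cancel_left, mul_assoc]
  exact isConj_iff.2 ⟨y, by rw [mul_inv_eq_iff_eq_mul, hyx, mul_assoc]⟩

end Split

/-! ## Spin super class functions -/

section SpinClassFunctions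

open Function

variable {Γ : Type u} [Group Γ] {n : ℕ}

/-- For even `x` the conjugacy of `x` and `zx` gives `f(x) = f(zx) = -f(x)`; on odd elements
vanishing is part of the definition of `Rminus`. -/
theorem Rminus.eq_zero (f : Rminus Γ n) {x : SpinWr Γ n} {i : Fin n}
    (hi : Even (minimalPeriod (theta n x.right) i)) : f.1 x = 0 := by
  obtain ⟨hconj, hz, hodd⟩ := f.2
  by_cases hx : spinParity n x.right = 1
  · have h1 := hconj _ _ (isConj_wrZ_mul hx hi)
    rw [hz] at h1
    exact self_eq_neg.1 h1
  · refine hodd x ?_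
    generalize spinParity n x.right = a at hx
    revert a
    decide

theorem Rminus.exists_hasType [Finite Γ] (f : Rminus Γ n) {x : SpinWr Γ n} (h : f.1 x ≠ 0) :
    ∃ ρ : OPn Γ n, HasType (proj x) ρ.1 :=
  SpinWreath.exists_hasType fun i => by
    rw [← Nat.not_even_iff_odd]
    exact fun hi => h (Rminus.eq_zero f hi)

theorem liftSign_of_isConj {x y : SpinWr Γ n} (h : IsConj x y) :
    liftSign x.right = liftSign y.right := by
  obtain ⟨w, rfl⟩ := isConj_iff.1 h
  exact (liftSign_conj _ _).symm

theorem isConj_or_of_proj {x y : SpinWr Γ n} (h : IsConj (proj x) (proj y)) :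
    IsConj x y ∨ IsConj x (wrZ Γ n * y) := by
  obtain ⟨v, hv⟩ := isConj_iff.1 h
  obtain ⟨w, rfl⟩ := proj_surjective v
  rw [← proj_inv, ← proj_mul, ← proj_mul] at hv
  rcases proj_eq_iff.1 hv with h | h
  · exact Or.inl (isConj_iff.2 ⟨w, h⟩)
  · exact Or.inr (isConj_iff.2 ⟨w, h⟩)

theorem liftSign_wrZ_mul {x : SpinWr Γ n} (h : Odd (orderOf (theta n x.right))) :
    liftSign (wrZ Γ n * x).right = -liftSign x.right := by
  rw [wrZ_mul]
  exact liftSign_spinZ_mul h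

/-- On the elements of a given type a spin class function is determined up to the sign of the
lift. -/
theorem Rminus.mul_liftSign (f : Rminus Γ n) {x y : SpinWr Γ n}
    (h : IsConj (proj x) (proj y)) (ho : Odd (orderOf (theta n y.right))) :
    f.1 x * liftSign x.right = f.1 y * liftSign y.right := by
  obtain ⟨hconj, hz, -⟩ := f.2
  rcases isConj_or_of_proj h with h1 | h1
  · rw [hconj _ _ h1, liftSign_of_isConj h1]
  · rw [hconj _ _ h1, liftSign_of_isConj h1, hz, liftSign_wrZ_mul ho, neg_mul_neg]

theorem invClass_involutive : Involutive (invClass : ConjClasses Γ → ConjClasses Γ) :=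
  invClass_invClass

theorem OP.bar_bar (ρ : OP Γ) : ρ.bar.bar = ρ :=
  funext fun c => congrArg ρ (invClass_invClass c)

variable [Finite Γ] (ε : ℕ → ℕ) {r : ℕ} (e : Fin r ≃ ConjClasses Γ)

theorem classRep_mem {ρ : OP Γ} (h : ρ.size = n) : classRep ε e n ρ ∈ Dplus ε e n ρ := by
  have hne : (Dplus ε e n ρ).Nonempty := by
    obtain ⟨g, hg⟩ := exists_typeOf_specialElt ε e h
    exact ⟨_, g, IsConj.refl _, hg⟩
  rw [classRep, dif_pos hne]
  exact hne.some_mem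

theorem hasType_classRep {ρ : OP Γ} (h : ρ.size = n) : HasType (proj (classRep ε e n ρ)) ρ := by
  obtain ⟨g, hg, ht⟩ := classRep_mem ε e h
  exact HasType.of_isConj ht (proj_isConj hg)

theorem liftSign_classRep {ρ : OP Γ} (h : ρ.size = n) :
    liftSign (classRep ε e n ρ).right =
      ((partList e ρ).map fun m => liftSign (cycleLift ε m 0 m)).prod := by
  obtain ⟨g, hg, -⟩ := classRep_mem ε e h
  rw [← liftSign_of_isConj hg]
  exact liftSign_blockElt ε (fun m hm => odd_of_mem_partList hm)
    (by rw [sum_partList, h, Nat.zero_add])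

theorem OP.size_bar (ρ : OP Γ) : ρ.bar.size = ρ.size :=
  Equiv.sum_comp (invClass_involutive.toPerm) fun c => ((ρ c).map Subtype.val).sum

theorem OP.len_bar (ρ : OP Γ) : ρ.bar.len = ρ.len :=
  Equiv.sum_comp (invClass_involutive.toPerm) fun c => (ρ c).card

theorem zeta_invClass (c : ConjClasses Γ) : zeta (invClass c) = zeta c := by
  induction c using Quotient.inductionOn with
  | h a =>
    change zeta (ConjClasses.mk a⁻¹) = zeta (ConjClasses.mk a)
    rw [← card_centralizer_mk, ← card_centralizer_mk]
    congr 2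
    ext b
    rw [Subgroup.mem_centralizer_singleton_iff, Subgroup.mem_centralizer_singleton_iff]
    exact Commute.inv_right_iff

theorem OP.Z_bar (ρ : OP Γ) : ρ.bar.Z = ρ.Z := by
  rw [OP.Z, OP.Z, ← Equiv.prod_comp (invClass_involutive.toPerm)]
  refine Finset.prod_congr rfl fun c _ => ?_
  change zPart (ρ.bar (invClass c)) * zeta (invClass c) ^ (ρ.bar (invClass c)).card = _
  rw [zeta_invClass, OP.bar, invClass_invClass]

/-- Passing from `ρ` to `ρ̄` only permutes the blocks, and the sign is a product over the multiset
of block lengths. With `liftSign_inv` this shows that inverses of elements of `D_ρ^+` lie in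
`D_ρ̄^+` and not in its `z`-translate. -/
theorem liftSign_classRep_bar {ρ : OP Γ} (h : ρ.size = n) :
    liftSign (classRep ε e n ρ.bar).right = liftSign (classRep ε e n ρ).right := by
  rw [liftSign_classRep ε e h, liftSign_classRep ε e (ρ.size_bar.trans h)]
  refine ((List.Perm.map _ ?_).prod_eq)
  rw [← Multiset.coe_eq_coe, coe_partList, coe_partList]
  exact Equiv.sum_comp (invClass_involutive.toPerm) fun c => (ρ c).map Subtype.val

/-- The product of `f` with `liftSign` is constant on all elements of a given type, both lifts
included, because conjugation and multiplication by `z` change the two factors in the same way. -/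
theorem Rminus.apply_eq (f : Rminus Γ n) {x : SpinWr Γ n} {ρ : OP Γ} (h : ρ.size = n)
    (hx : HasType (proj x) ρ) : f.1 x = f.1 (classRep ε e n ρ) *
      liftSign (classRep ε e n ρ).right * liftSign x.right := by
  have hr := hasType_classRep ε e h
  rw [← Rminus.mul_liftSign f (hx.isConj hr) hr.odd_orderOf, mul_assoc, liftSign_mul_self, mul_one]

/-- A spin super class function is determined by its values on the classes `D_ρ^+`. -/
theorem Rminus.ext_classRep {f g : Rminus Γ n}
    (h : ∀ ρ : OPn Γ n, f.1 (classRep ε e n ρ.1) = g.1 (classRep ε e n ρ.1)) : f = g := by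
  refine Subtype.ext (funext fun x => ?_)
  by_cases hx : ∃ ρ : OPn Γ n, HasType (proj x) ρ.1
  · obtain ⟨ρ, hρ⟩ := hx
    rw [Rminus.apply_eq ε e f ρ.2 hρ, Rminus.apply_eq ε e g ρ.2 hρ, h]
  · have h1 := fun f : Rminus Γ n => not_imp_comm.1 (Rminus.exists_hasType f) hx
    rw [h1, h1]

open Classical in
/-- The spin super class functions take arbitrary values on the classes `D_ρ^+`. -/
theorem Rminus.exists_classRep_eq (ρ : OPn Γ n) : ∃ f : Rminus Γ n, ∀ ρ' : OPn Γ n,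
    f.1 (classRep ε e n ρ'.1) = if ρ' = ρ then 1 else 0 := by
  refine ⟨⟨fun x => if HasType (proj x) ρ.1 then
      liftSign x.right * liftSign (classRep ε e n ρ.1).right else 0, ?_, ?_, ?_⟩, ?_⟩
  · intro x y hxy
    have h1 : HasType (proj x) ρ.1 ↔ HasType (proj y) ρ.1 :=
      ⟨fun h => h.of_isConj (proj_isConj hxy), fun h => h.of_isConj (proj_isConj hxy.symm)⟩
    simp only [h1, liftSign_of_isConj hxy]
  · intro x
    simp only [proj_wrZ_mul]
    split_ifs with h
    · rw [liftSign_wrZ_mul h.odd_orderOf, neg_mul]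
    · rw [neg_zero]
  · intro x hx
    dsimp only
    rw [if_neg]
    intro h
    have h1 := spinParity_of_odd (s := x.right) h.odd_orderOf
    rw [hx] at h1
    exact absurd h1 (by decide)
  · intro ρ'
    have h1 := hasType_classRep ε e ρ'.2
    by_cases h : ρ' = ρ
    · subst h
      rw [if_pos rfl]
      dsimp only
      rw [if_pos h1, liftSign_mul_self]
    · rw [if_neg h]
      dsimp only
      rw [if_neg fun h2 => h (Subtype.ext (h1.eq h2))]

theorem eta_eq (ξ : classFun Γ) {x : Wr Γ n} {ρ : OP Γ} (h : HasType x ρ) :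
    eta ξ x = ∏ c, atClass ξ c ^ (ρ c).card :=
  Finset.prod_congr rfl fun c _ => by rw [h, Multiset.card_map]

/-- The weighted form in terms of the values on the classes `D_ρ^+`. -/
theorem wFormN_eq (ξ : classFun Γ) (f g : Rminus Γ n) :
    wFormN ξ n f g = ∑ ρ : OPn Γ n, (ρ.1.Z : ℂ)⁻¹ * (∏ c, atClass ξ c ^ (ρ.1 c).card) *
      (f.1 (classRep ε e n ρ.1) * g.1 (classRep ε e n ρ.1.bar)) := by
  classical
  have := Fintype.ofFinite (Wr Γ n)
  let V : OPn Γ n → ℂ := fun ρ => (∏ c, atClass ξ c ^ (ρ.1 c).card) *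
    (f.1 (classRep ε e n ρ.1) * g.1 (classRep ε e n ρ.1.bar))
  -- The summand is invariant under `x ↦ zx`, so it descends to the wreath product and depends only
  -- on the type. The two lifts of each element cancel the factor 2 in the group order, and the
  -- class of type `ρ` has relative size `1/Z_ρ`.
  let G : Wr Γ n → ℂ := fun y => ∑ ρ : OPn Γ n, if HasType y ρ.1 then V ρ else 0
  have hG : ∀ x : SpinWr Γ n, eta ξ (proj x) * f.1 x * g.1 x⁻¹ = G (proj x) := by
    intro x
    by_cases hx : ∃ ρ : OPn Γ n, HasType (proj x) ρ.1
    · obtain ⟨ρ, hρ⟩ := hx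
      have hinv : HasType (proj x⁻¹) ρ.1.bar := by rw [proj_inv]; exact hρ.inv
      have h1 : G (proj x) = V ρ := by
        simp only [G]
        rw [Finset.sum_eq_single ρ, if_pos hρ]
        · intro ρ' _ hne
          rw [if_neg fun h => hne (Subtype.ext (h.eq hρ))]
        · simp
      have h2 : (x⁻¹).right = x.right⁻¹ := rfl
      rw [h1, Rminus.apply_eq ε e f ρ.2 hρ, Rminus.apply_eq ε e g (ρ.1.size_bar.trans ρ.2) hinv, eta_eq ξ hρ,
        liftSign_classRep_bar ε e ρ.2, h2, liftSign_inv]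
      have a1 := liftSign_mul_self x.right
      have a2 := liftSign_mul_self (classRep ε e n ρ.1).right
      simp only [V]
      linear_combination ((∏ c, atClass ξ c ^ (ρ.1 c).card) *
        (f.1 (classRep ε e n ρ.1) * g.1 (classRep ε e n ρ.1.bar))) *
        (a1 * (liftSign (classRep ε e n ρ.1).right * liftSign (classRep ε e n ρ.1).right) + a2)
    · have h1 : f.1 x = 0 := not_imp_comm.1 (Rminus.exists_hasType f) hx
      have h2 : G (proj x) = 0 :=
        Finset.sum_eq_zero fun ρ _ => if_neg fun h => hx ⟨ρ, h⟩
      rw [h1, h2, mul_zero, zero_mul]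
  rw [wFormN, finsum_congr hG, finsum_comp_proj, finsum_eq_sum_of_fintype, Finset.sum_comm,
    card_spinWr, Finset.mul_sum, Finset.mul_sum]
  refine Finset.sum_congr rfl fun ρ _ => ?_
  rw [← Finset.sum_filter, Finset.sum_const, nsmul_eq_mul]
  have hcard : Nat.card {y : Wr Γ n // HasType y ρ.1} * ρ.1.Z = Nat.card (Wr Γ n) :=
    card_typeOf_mul_Z (hasType_classRep ε e ρ.2)
  rw [Nat.card_eq_fintype_card, Fintype.card_subtype] at hcard
  have hZ : (ρ.1.Z : ℂ) ≠ 0 := by exact_mod_cast OP_Z_ne_zero ρ.1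
  have hW : (Nat.card (Wr Γ n) : ℂ) ≠ 0 := by exact_mod_cast Nat.card_pos.ne'
  have hcard' : ((Finset.univ.filter fun y : Wr Γ n => HasType y ρ.1).card : ℂ) * ρ.1.Z =
      Nat.card (Wr Γ n) := by
    exact_mod_cast hcard
  push_cast
  rw [← hcard'] at hW ⊢
  have hN := left_ne_zero_of_mul hW
  simp only [V]
  field_simp

end SpinClassFunctions

/-! ## Completeness of the irreducible characters -/

section Characters

variable {G : Type u} [Group G]

/-- A simple left ideal of the group algebra gives an irreducible representation on some `ℂ^m`. -/
theorem exists_irr_of_simple [Finite G] (S : Submodule (MonoidAlgebra ℂ G) (MonoidAlgebra ℂ G))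
    (hS : IsSimpleModule (MonoidAlgebra ℂ G) S) :
    ∃ (m : ℕ) (π : Representation ℂ G (Fin m → ℂ)) (e : S ≃ₗ[ℂ] (Fin m → ℂ)),
      π.IsIrreducible ∧ ∀ g s, e (MonoidAlgebra.single g (1 : ℂ) • s) = π g (e s) := by
  have hfin : Module.Finite ℂ (MonoidAlgebra ℂ G) := inferInstance
  have hfinS : Module.Finite ℂ S :=
    Module.Finite.of_injective (S.subtype.restrictScalars ℂ) S.injective_subtype
  let e : S ≃ₗ[ℂ] (Fin (Module.finrank ℂ S) → ℂ) := (Module.finBasis ℂ S).equivFun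
  let π : Representation ℂ G (Fin (Module.finrank ℂ S) → ℂ) :=
    { toFun := fun g => e.conj (Algebra.lsmul ℂ ℂ S (MonoidAlgebra.single g (1 : ℂ)))
      map_one' := by
        ext v
        simp [LinearEquiv.conj_apply, ← MonoidAlgebra.one_def]
      map_mul' := fun g h => by
        ext v
        simp [LinearEquiv.conj_apply, ← mul_smul, MonoidAlgebra.single_mul_single] }
  have hπ : ∀ g s, e (MonoidAlgebra.single g (1 : ℂ) • s) = π g (e s) := by
    intro g s
    simp [π, LinearEquiv.conj_apply]
  refine ⟨_, π, e, ?_, hπ⟩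
  have hnt : Nontrivial S := IsSimpleModule.nontrivial (MonoidAlgebra ℂ G) S
  have key : ∀ U : Subrepresentation π, U.toSubmodule = ⊥ ∨ U.toSubmodule = ⊤ := by
    intro U
    let N : Submodule (MonoidAlgebra ℂ G) S :=
      { carrier := {s | e s ∈ U.toSubmodule}
        add_mem' := fun {a b} ha hb => by
          simp only [Set.mem_ofPred_eq, map_add] at *
          exact add_mem ha hb
        zero_mem' := by simp
        smul_mem' := fun a s hs => by
          simp only [Set.mem_ofPred_eq] at *
          induction a using MonoidAlgebra.induction_on with
          | of g => rw [MonoidAlgebra.of_apply, hπ]; exact U.apply_mem_toSubmodule g hs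
          | add a b ha hb => rw [add_smul, map_add]; exact add_mem ha hb
          | smul c a ha => rw [smul_assoc, map_smul]; exact Submodule.smul_mem _ c ha }
    have hN : ∀ s, s ∈ N ↔ e s ∈ U.toSubmodule := fun s => Iff.rfl
    rcases eq_bot_or_eq_top N with h | h
    · left
      rw [Submodule.eq_bot_iff]
      intro v hv
      have h1 : e.symm v ∈ N := by rw [hN, e.apply_symm_apply]; exact hv
      rw [h, Submodule.mem_bot] at h1
      simpa using h1
    · right
      rw [Submodule.eq_top_iff']
      intro v
      have h1 : e.symm v ∈ N := by rw [h]; trivial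
      rwa [hN, e.apply_symm_apply] at h1
  have hbt : (⊥ : Subrepresentation π) ≠ ⊤ := by
    intro h
    have h1 : (⊥ : Submodule ℂ (Fin (Module.finrank ℂ S) → ℂ)) = ⊤ :=
      congrArg Subrepresentation.toSubmodule h
    have hnt' : Nontrivial (Fin (Module.finrank ℂ S) → ℂ) := e.symm.toEquiv.nontrivial
    exact bot_ne_top h1
  have : Nontrivial (Subrepresentation π) := ⟨⟨⊥, ⊤, hbt⟩⟩
  exact ⟨fun U => (key U).imp (fun h => Subrepresentation.toSubmodule_injective h)
    (fun h => Subrepresentation.toSubmodule_injective h)⟩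

/-- A class function that is orthogonal to all irreducible characters vanishes. -/
theorem classFun_eq_zero [Fintype G] (f : classFun G)
    (hf : ∀ χ : Irr G, ∑ x : G, f.1 x * χ.1.1 x⁻¹ = 0) : f = 0 := by
  classical
  -- `F` is central because `f` is a class function. By Schur's lemma it acts on a simple left ideal
  -- as a scalar, whose trace is the given vanishing sum, so the scalar is 0. By Maschke's theorem
  -- the simple left ideals span the group algebra, hence `F = F · 1 = 0`.
  let F : MonoidAlgebra ℂ G := ∑ x : G, MonoidAlgebra.single x⁻¹ (f.1 x)
  have hconj : ∀ g x : G, f.1 (g * x * g⁻¹) = f.1 x := fun g x =>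
    (f.2 _ _ (isConj_iff.2 ⟨g, rfl⟩)).symm
  have hcomm : ∀ b : MonoidAlgebra ℂ G, F * b = b * F := by
    intro b
    induction b using MonoidAlgebra.induction_on with
    | of g =>
      rw [MonoidAlgebra.of_apply, Finset.sum_mul, Finset.mul_sum,
        ← (MulAut.conj g⁻¹).toEquiv.sum_comp fun x => MonoidAlgebra.single g (1 : ℂ) *
          MonoidAlgebra.single x⁻¹ (f.1 x)]
      refine Finset.sum_congr rfl fun x _ => ?_
      rw [MonoidAlgebra.single_mul_single, MonoidAlgebra.single_mul_single, mul_one, one_mul]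
      change MonoidAlgebra.single (x⁻¹ * g) (f.1 x) =
        MonoidAlgebra.single (g * (g⁻¹ * x * g⁻¹⁻¹)⁻¹) (f.1 (g⁻¹ * x * g⁻¹⁻¹))
      rw [hconj]
      congr 1
      group
    | add a b ha hb => rw [mul_add, add_mul, ha, hb]
    | smul c a ha => rw [mul_smul_comm, smul_mul_assoc, ha]
  -- The annihilator of `F`; centrality of `F` is what makes it a left ideal.
  let N : Submodule (MonoidAlgebra ℂ G) (MonoidAlgebra ℂ G) :=
    { carrier := {a | F * a = 0}
      add_mem' := fun {a b} ha hb => by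
        simp only [Set.mem_ofPred_eq, mul_add] at *
        rw [ha, hb, add_zero]
      zero_mem' := mul_zero F
      smul_mem' := fun b a ha => by
        simp only [Set.mem_ofPred_eq, smul_eq_mul] at *
        rw [← mul_assoc, hcomm, mul_assoc, ha, mul_zero] }
  have hsimple : ∀ S : Submodule (MonoidAlgebra ℂ G) (MonoidAlgebra ℂ G),
      IsSimpleModule (MonoidAlgebra ℂ G) S → S ≤ N := by
    intro S hS
    obtain ⟨m, π, e, hπ, he⟩ := exists_irr_of_simple S hS
    let T : (Fin m → ℂ) →ₗ[ℂ] (Fin m → ℂ) := ∑ x : G, f.1 x • π x⁻¹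
    have hT : ∀ s : S, e (F • s) = T (e s) := by
      intro s
      simp only [F, T, Finset.sum_smul, map_sum, LinearMap.sum_apply, LinearMap.smul_apply]
      refine Finset.sum_congr rfl fun x _ => ?_
      rw [← he, ← map_smul, ← smul_assoc, MonoidAlgebra.smul_single, smul_eq_mul, mul_one]
    have hTg : ∀ g, T ∘ₗ π g = π g ∘ₗ T := by
      intro g
      refine LinearMap.ext fun v => ?_
      obtain ⟨s, rfl⟩ := e.surjective v
      rw [LinearMap.comp_apply, LinearMap.comp_apply, ← he, ← hT, ← hT, ← he, ← mul_smul,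
        ← mul_smul, hcomm]
    have hb : Function.Bijective (algebraMap ℂ (Representation.IntertwiningMap π π)) :=
      Representation.IsIrreducible.algebraMap_intertwiningMap_bijective_of_isAlgClosed
    obtain ⟨c, hc⟩ := hb.2 ⟨T, hTg⟩
    have hTc : T = c • LinearMap.id := by
      have := congrArg Representation.IntertwiningMap.toLinearMap hc
      exact this.symm
    have htr : LinearMap.trace ℂ (Fin m → ℂ) T = 0 := by
      let χ : Irr G := ⟨⟨π.character, fun x y hxy => by
        obtain ⟨g, rfl⟩ := isConj_iff.1 hxy
        exact (π.char_conj x g).symm⟩, m, π, hπ, fun _ => rfl⟩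
      rw [← hf χ, map_sum]
      refine Finset.sum_congr rfl fun x _ => ?_
      rw [map_smul, smul_eq_mul]
      rfl
    have hnt : Nontrivial S := IsSimpleModule.nontrivial (MonoidAlgebra ℂ G) S
    have hm : (m : ℂ) ≠ 0 := by
      rintro h
      have h0 : m = 0 := by exact_mod_cast h
      subst h0
      have := e.toEquiv.subsingleton
      exact not_subsingleton S this
    have hc0 : c = 0 := by
      rw [hTc, map_smul, LinearMap.trace_id, Module.finrank_fin_fun, smul_eq_mul] at htr
      exact (mul_eq_zero.1 htr).resolve_right hm
    intro s hs
    have h1 := hT ⟨s, hs⟩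
    rw [hTc, hc0, zero_smul, LinearMap.zero_apply, LinearEquiv.map_eq_zero_iff] at h1
    exact congrArg Subtype.val h1
  have hne : NeZero (Nat.card G : ℂ) := ⟨by exact_mod_cast Nat.card_pos.ne'⟩
  have htop : N = ⊤ := by
    rw [eq_top_iff, ← IsSemisimpleModule.sSup_simples_eq_top (MonoidAlgebra ℂ G)
      (MonoidAlgebra ℂ G)]
    exact sSup_le fun S hS => hsimple S hS
  have hF : F = 0 := by
    have h1 : (1 : MonoidAlgebra ℂ G) ∈ N := by rw [htop]; trivial
    have h2 : F * 1 = 0 := h1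
    rwa [mul_one] at h2
  refine Subtype.ext (funext fun y => ?_)
  have h3 := congrArg (fun a : MonoidAlgebra ℂ G => a.coeff y⁻¹) hF
  simpa [F, Finsupp.single_apply] using h3

open Classical in
theorem card_class_mul_zeta [Fintype G] (c : ConjClasses G) :
    (Finset.univ.filter fun x : G => ConjClasses.mk x = c).card * zeta c = Nat.card G := by
  induction c using Quotient.inductionOn with
  | h a =>
    change _ * zeta (ConjClasses.mk a) = _
    rw [← card_centralizer_mk, ← card_isConj_mul_card_centralizer a]
    congr 1
    rw [Nat.card_eq_fintype_card, Fintype.card_subtype]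
    congr 1
    ext x
    simp only [Finset.mem_filter, Finset.mem_univ, true_and]
    exact ConjClasses.mk_eq_mk_iff_isConj.trans isConj_comm

open Classical in
/-- The second orthogonality relation. -/
theorem sum_irr_mul [Fintype G] (c : ConjClasses G) (x : G) :
    ∑ γ : Irr G, atClass γ.1 (invClass c) * γ.1.1 x =
      if ConjClasses.mk x = c then (zeta c : ℂ) else 0 := by
  -- The difference of the character sum and `ζ_c` times the indicator of `c` is a class function
  -- orthogonal to every irreducible character, so completeness forces it to vanish.
  let δ : classFun G := ⟨fun x => if ConjClasses.mk x = c then (zeta c : ℂ) else 0,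
    fun x y h => by simp only [ConjClasses.mk_eq_mk_iff_isConj.2 h]⟩
  let h : classFun G := (∑ γ : Irr G, atClass γ.1 (invClass c) • γ.1) - δ
  have hval : ∀ x, h.1 x = (∑ γ : Irr G, atClass γ.1 (invClass c) * γ.1.1 x) - δ.1 x := by
    intro x
    simp [h]
  have hc : (Nat.card G : ℂ) ≠ 0 := by exact_mod_cast Nat.card_pos.ne'
  have h0 : h = 0 := by
    refine classFun_eq_zero h fun ψ => ?_
    simp only [hval, sub_mul, Finset.sum_sub_distrib, Finset.sum_mul]
    rw [sub_eq_zero, Finset.sum_comm]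
    have h1 : ∀ γ : Irr G, ∑ x : G, atClass γ.1 (invClass c) * γ.1.1 x * ψ.1.1 x⁻¹ =
        atClass γ.1 (invClass c) * (Nat.card G * if γ = ψ then 1 else 0) := by
      intro γ
      rw [← irr_orthonormal, mul_inv_cancel_left₀ hc, Finset.mul_sum]
      exact Finset.sum_congr rfl fun x _ => mul_assoc _ _ _
    rw [Finset.sum_congr rfl fun γ _ => h1 γ]
    simp only [mul_ite, mul_one, mul_zero, Finset.sum_ite_eq', Finset.mem_univ, if_true]
    have h2 : ∀ x : G, δ.1 x * ψ.1.1 x⁻¹ =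
        if ConjClasses.mk x = c then (zeta c : ℂ) * atClass ψ.1 (invClass c) else 0 := by
      intro x
      simp only [δ]
      split_ifs with hx
      · rw [← hx]; rfl
      · rw [zero_mul]
    rw [Finset.sum_congr rfl fun x _ => h2 x, ← Finset.sum_filter, Finset.sum_const,
      nsmul_eq_mul, ← card_class_mul_zeta c]
    push_cast
    ring
  have := hval x
  rw [h0] at this
  exact (sub_eq_zero.1 this.symm)

open Classical in
/-- The first orthogonality relation as a sum over classes. -/
theorem sum_class_mul [Fintype G] (χ ψ : Irr G) :
    ∑ c : ConjClasses G, (zeta c : ℂ)⁻¹ * atClass χ.1 c * atClass ψ.1 (invClass c) =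
      if χ = ψ then 1 else 0 := by
  have hc : (Nat.card G : ℂ) ≠ 0 := by exact_mod_cast Nat.card_pos.ne'
  rw [← irr_orthonormal, Finset.mul_sum]
  refine Eq.trans (Finset.sum_congr rfl fun c _ => ?_)
    (Finset.sum_fiberwise_of_maps_to (g := (ConjClasses.mk : G → ConjClasses G))
      (fun _ _ => Finset.mem_univ _) _)
  have h1 : ∀ x ∈ Finset.univ.filter fun x : G => ConjClasses.mk x = c,
      (Nat.card G : ℂ)⁻¹ * (χ.1.1 x * ψ.1.1 x⁻¹) =
        (Nat.card G : ℂ)⁻¹ * (atClass χ.1 c * atClass ψ.1 (invClass c)) := by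
    intro x hx
    rw [← (Finset.mem_filter.1 hx).2]
    rfl
  rw [Finset.sum_congr rfl h1, Finset.sum_const, nsmul_eq_mul]
  have h2 : ((Finset.univ.filter fun x : G => ConjClasses.mk x = c).card : ℂ) * zeta c =
      Nat.card G := by exact_mod_cast card_class_mul_zeta c
  rw [← h2] at hc ⊢
  have h3 := left_ne_zero_of_mul hc
  have h4 := right_ne_zero_of_mul hc
  field_simp

end Characters

/-! ## A bilinear form on polynomials -/

section PolyForm

variable {σ : Type u}

/-- The weight `∏_i s_i! w_i^{s_i}`. -/
def monoWeight (w : σ → ℂ) (s : σ →₀ ℕ) : ℂ :=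
  s.prod fun i k => (k.factorial : ℂ) * w i ^ k

/-- The bilinear form on polynomials that pairs the monomial of exponent `s` with that of exponent
`τ s` only, with the value `∏_i s_i! w_i^{s_i}`. -/
def polyForm (τ : σ ≃ σ) (w : σ → ℂ) : LinearMap.BilinForm ℂ (MvPolynomial σ ℂ) :=
  (MvPolynomial.basisMonomials σ ℂ).constr ℂ fun s =>
    monoWeight w s • MvPolynomial.lcoeff ℂ (s.equivMapDomain τ)

theorem polyForm_monomial_left (τ : σ ≃ σ) (w : σ → ℂ) (s : σ →₀ ℕ) (q : MvPolynomial σ ℂ) :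
    polyForm τ w (MvPolynomial.monomial s 1) q =
      monoWeight w s * q.coeff (s.equivMapDomain τ) := by
  have h := (MvPolynomial.basisMonomials σ ℂ).constr_basis ℂ (fun s =>
    monoWeight w s • MvPolynomial.lcoeff ℂ (s.equivMapDomain τ)) s
  rw [MvPolynomial.coe_basisMonomials] at h
  change polyForm τ w _ = _ at h
  rw [h]
  rfl

theorem polyForm_one_one (τ : σ ≃ σ) (w : σ → ℂ) : polyForm τ w 1 1 = 1 := by
  have h := polyForm_monomial_left τ w 0 1
  rw [show MvPolynomial.monomial (0 : σ →₀ ℕ) (1 : ℂ) = 1 from rfl] at h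
  rw [h]
  have h0 : (0 : σ →₀ ℕ).equivMapDomain τ = 0 := Finsupp.equivMapDomain_zero
  rw [h0, MvPolynomial.coeff_zero_one]
  simp [monoWeight]

theorem monoWeight_add_single (w : σ → ℂ) (s : σ →₀ ℕ) (i : σ) :
    monoWeight w (Finsupp.single i 1 + s) = (s i + 1) * w i * monoWeight w s := by
  classical
  have h : ∀ t : σ →₀ ℕ, t.support ⊆ insert i s.support →
      monoWeight w t = ((t i).factorial * w i ^ t i) *
        ∏ j ∈ s.support.erase i, (((t j).factorial : ℂ) * w j ^ t j) := by
    intro t ht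
    rw [monoWeight, Finsupp.prod_of_support_subset _ ht _ (by simp), ← Finset.insert_erase
      (Finset.mem_insert_self i s.support), Finset.prod_insert (Finset.notMem_erase i _)]
    congr 2
    ext j
    simp only [Finset.mem_erase, Finset.mem_insert]
    tauto
  rw [h s (Finset.subset_insert _ _), h (Finsupp.single i 1 + s)]
  · have h1 : ∀ j ∈ s.support.erase i, ((((Finsupp.single i 1 + s : σ →₀ ℕ) j).factorial : ℂ) *
        w j ^ (Finsupp.single i 1 + s : σ →₀ ℕ) j) = ((s j).factorial : ℂ) * w j ^ s j := by
      intro j hj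
      have hji : i ≠ j := (Finset.ne_of_mem_erase hj).symm
      simp [hji]
    rw [Finset.prod_congr rfl h1]
    simp only [Finsupp.add_apply, Finsupp.single_eq_same]
    rw [add_comm 1 (s i), Nat.factorial_succ, pow_succ]
    push_cast
    ring
  · refine Finsupp.support_add.trans (Finset.union_subset ?_ (Finset.subset_insert _ _))
    exact Finsupp.support_single_subset.trans (by simp)

/-- Raising the exponent at `i` by one multiplies the weight by `(s_i + 1) w_i`, and `s_i + 1` is
the factor that differentiation produces on the partner monomial. The bijection `τ` moves the
derivative to the variable `τ i`. -/
theorem polyForm_X_mul (τ : σ ≃ σ) (w : σ → ℂ) (i : σ) (p q : MvPolynomial σ ℂ) :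
    polyForm τ w (MvPolynomial.X i * p) q =
      polyForm τ w p (w i • MvPolynomial.pderiv (τ i) q) := by
  classical
  have key : ∀ s t : σ →₀ ℕ, polyForm τ w (MvPolynomial.X i * MvPolynomial.monomial s 1)
      (MvPolynomial.monomial t 1) =
      polyForm τ w (MvPolynomial.monomial s 1)
        (w i • MvPolynomial.pderiv (τ i) (MvPolynomial.monomial t 1)) := by
    intro s t
    have hX : MvPolynomial.X i * MvPolynomial.monomial s (1 : ℂ) =
        MvPolynomial.monomial (Finsupp.single i 1 + s) 1 := by
      rw [MvPolynomial.X, MvPolynomial.monomial_mul, one_mul]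
    rw [hX, polyForm_monomial_left, polyForm_monomial_left, monoWeight_add_single,
      MvPolynomial.pderiv_monomial, MvPolynomial.coeff_smul, MvPolynomial.coeff_monomial,
      MvPolynomial.coeff_monomial, one_mul, smul_eq_mul]
    have hτ : ∀ (a : σ →₀ ℕ) (j : σ), a.equivMapDomain τ (τ j) = a j := fun a j => by
      simp [Finsupp.equivMapDomain_apply]
    by_cases h : t = (Finsupp.single i 1 + s).equivMapDomain τ
    · have h1 : t (τ i) = s i + 1 := by
        rw [h, hτ]
        simp [add_comm]
      have h2 : t - Finsupp.single (τ i) 1 = s.equivMapDomain τ := by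
        ext j
        obtain ⟨j, rfl⟩ := τ.surjective j
        rw [h, Finsupp.tsub_apply, hτ, hτ, Finsupp.add_apply, Finsupp.single_apply,
          Finsupp.single_apply]
        simp only [τ.injective.eq_iff]
        omega
      rw [if_pos h, if_pos h2, h1]
      push_cast
      ring
    · rw [if_neg h, mul_zero]
      split_ifs with h2
      -- Subtraction of exponents is truncated, so the exponents can match although `t` has no
      -- factor at `τ i`; in that case the coefficient `t (τ i)` of the derivative is zero.
      · rcases Nat.eq_zero_or_pos (t (τ i)) with h0 | h0
        · rw [h0]; simp
        · exfalso
          apply h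
          ext j
          have h3 := DFunLike.congr_fun h2 j
          obtain ⟨j, rfl⟩ := τ.surjective j
          rw [Finsupp.tsub_apply, hτ, Finsupp.single_apply] at h3
          rw [hτ, Finsupp.add_apply, Finsupp.single_apply]
          simp only [τ.injective.eq_iff] at h3
          by_cases hij : i = j
          · subst hij
            simp only [if_true] at h3 ⊢
            omega
          · simp only [hij, if_false] at h3 ⊢
            omega
      · simp
  induction p using MvPolynomial.induction_on' with
  | add p p' hp hp' => simp only [mul_add, map_add, LinearMap.add_apply, hp, hp']
  | monomial s a =>
    have hs : MvPolynomial.monomial s a = a • MvPolynomial.monomial s (1 : ℂ) := by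
      rw [MvPolynomial.smul_monomial, smul_eq_mul, mul_one]
    rw [hs, mul_smul_comm, map_smul, LinearMap.smul_apply,
      LinearMap.map_smul (polyForm τ w), LinearMap.smul_apply]
    congr 1
    induction q using MvPolynomial.induction_on' with
    | add p p' hp hp' => simp only [map_add, smul_add, hp, hp']
    | monomial t b =>
      have ht : MvPolynomial.monomial t b = b • MvPolynomial.monomial t (1 : ℂ) := by
        rw [MvPolynomial.smul_monomial, smul_eq_mul, mul_one]
      rw [ht, map_smul, key s t]
      simp only [Derivation.map_smul, map_smul]
      rw [smul_comm]

/-- On monomials the relation of being `τ`-partners is symmetric because `τ` is an involution, and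
partners have equal weights. -/
theorem polyForm_symm (τ : σ ≃ σ) (w : σ → ℂ) (hτ : ∀ i, τ (τ i) = i) (hw : ∀ i, w (τ i) = w i)
    (p q : MvPolynomial σ ℂ) : polyForm τ w p q = polyForm τ w q p := by
  have hinv : ∀ s : σ →₀ ℕ, (s.equivMapDomain τ).equivMapDomain τ = s := fun s => by
    ext i
    have h : ∀ j, τ.symm j = τ j := fun j => by rw [Equiv.symm_apply_eq, hτ]
    simp only [Finsupp.equivMapDomain_apply, h, hτ]
  have hwt : ∀ s : σ →₀ ℕ, monoWeight w (s.equivMapDomain τ) = monoWeight w s := fun s => by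
    simp only [monoWeight, Finsupp.prod_equivMapDomain, hw]
  have hc : ∀ (r : MvPolynomial σ ℂ) (s : σ →₀ ℕ) (a : ℂ),
      polyForm τ w (MvPolynomial.monomial s a) r =
        a * (monoWeight w s * r.coeff (s.equivMapDomain τ)) := fun r s a => by
    rw [← polyForm_monomial_left, ← smul_eq_mul, ← LinearMap.smul_apply, ← map_smul,
      MvPolynomial.smul_monomial, smul_eq_mul, mul_one]
  induction p using MvPolynomial.induction_on' with
  | add p p' hp hp' => simp only [map_add, LinearMap.add_apply, hp, hp']
  | monomial s a =>
    induction q using MvPolynomial.induction_on' with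
    | add p p' hp hp' => simp only [map_add, LinearMap.add_apply, hp, hp']
    | monomial t b =>
      classical
      rw [hc, hc, MvPolynomial.coeff_monomial, MvPolynomial.coeff_monomial]
      by_cases h : t = s.equivMapDomain τ
      · rw [if_pos h, h, hinv, if_pos rfl, hwt]
        ring
      · rw [if_neg h, if_neg]
        · ring
        · rintro rfl
          exact h (hinv t).symm

end PolyForm

/-! ## The Fock space in class variables -/

section FockSpace

variable {Γ : Type u} [Group Γ]

/-- The polynomial algebra on the symbols `a_{-n}(c)`. -/
abbrev ClassPoly (Γ : Type u) [Group Γ] : Type u := MvPolynomial (OddNat × ConjClasses Γ) ℂ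

theorem zeta_ne_zero [Finite Γ] (c : ConjClasses Γ) : (zeta c : ℂ) ≠ 0 := by
  have h : zeta c ≠ 0 := Nat.card_pos.ne'
  exact_mod_cast h

open Classical in
theorem sum_irr_mul_atClass [Fintype Γ] (c d : ConjClasses Γ) :
    ∑ γ : Irr Γ, atClass γ.1 (invClass c) * atClass γ.1 d =
      if d = c then (zeta c : ℂ) else 0 := by
  induction d using Quotient.inductionOn with
  | h x => exact sum_irr_mul c x

/-- The generator `a_{-n}(γ)` as a combination of the `a_{-n}(c)`. -/
def irrPoly [Finite Γ] (n : OddNat) (γ : Irr Γ) : ClassPoly Γ :=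
  ∑ c : ConjClasses Γ, ((zeta c : ℂ)⁻¹ * atClass γ.1 c) • MvPolynomial.X (n, c)

/-- The symmetric algebra on the symbols `a_{-n}(c)` is the Fock space. -/
def fockEquiv (Γ : Type u) [Group Γ] [Fintype Γ] : ClassPoly Γ ≃ₐ[ℂ] Fock Γ :=
  -- The two linear substitutions of variables are mutually inverse: one composite is the first
  -- orthogonality relation, the other the second.
  AlgEquiv.ofAlgHom
    (MvPolynomial.aeval fun p => genClass p.1 p.2)
    (MvPolynomial.aeval fun p => irrPoly p.1 p.2)
    (by
      classical
      ext1 ⟨n, γ⟩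
      simp only [AlgHom.comp_apply, MvPolynomial.aeval_X, irrPoly, map_sum, map_smul, genClass,
        AlgHom.id_apply, Finset.smul_sum, smul_smul]
      rw [Finset.sum_comm]
      simp only [← Finset.sum_smul, sum_class_mul, ite_smul, one_smul, zero_smul,
        Finset.sum_ite_eq, Finset.mem_univ, if_true]
      rfl)
    (by
      classical
      ext1 ⟨n, c⟩
      simp only [AlgHom.comp_apply, MvPolynomial.aeval_X, irrPoly, map_sum, map_smul, genClass,
        gen, AlgHom.id_apply, Finset.smul_sum, smul_smul]
      rw [Finset.sum_comm]
      have h : ∀ d : ConjClasses Γ, ∑ γ : Irr Γ,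
          atClass γ.1 (invClass c) * ((zeta d : ℂ)⁻¹ * atClass γ.1 d) =
            if d = c then 1 else 0 := by
        intro d
        have h1 := sum_irr_mul_atClass c d
        simp only [mul_left_comm _ (zeta d : ℂ)⁻¹, ← Finset.mul_sum, h1]
        split_ifs with hd
        · rw [hd, inv_mul_cancel₀ (zeta_ne_zero c)]
        · rw [mul_zero]
      simp only [← Finset.sum_smul, h, ite_smul, one_smul, zero_smul, Finset.sum_ite_eq',
        Finset.mem_univ, if_true])

theorem fockEquiv_X [Fintype Γ] (n : OddNat) (c : ConjClasses Γ) :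
    fockEquiv Γ (MvPolynomial.X (n, c)) = genClass n c :=
  MvPolynomial.aeval_X _ _

theorem fockEquiv_symm_gen [Fintype Γ] (n : OddNat) (γ : Irr Γ) :
    (fockEquiv Γ).symm (gen n γ) = irrPoly n γ :=
  MvPolynomial.aeval_X _ _

/-- Inversion of classes. -/
def classInv (Γ : Type u) [Group Γ] : ConjClasses Γ ≃ ConjClasses Γ :=
  Function.Involutive.toPerm invClass invClass_involutive

/-- The involution `(n, c) ↦ (n, c⁻¹)` of the variables. -/
def varInv (Γ : Type u) [Group Γ] : OddNat × ConjClasses Γ ≃ OddNat × ConjClasses Γ :=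
  (Equiv.refl OddNat).prodCongr (classInv Γ)

theorem varInv_apply (n : OddNat) (c : ConjClasses Γ) : varInv Γ (n, c) = (n, invClass c) := rfl

/-- The weights `⟨a_{-n}(c), a_{-n}(c⁻¹)⟩' = (n/2) ζ_c ξ(c)`. -/
def varWeight (ξ : classFun Γ) (p : OddNat × ConjClasses Γ) : ℂ :=
  (p.1.1 : ℂ) / 2 * zeta p.2 * atClass ξ p.2

theorem atClass_invClass {ξ : classFun Γ} (hξ : ∀ x : Γ, ξ.1 x⁻¹ = ξ.1 x) (c : ConjClasses Γ) :
    atClass ξ (invClass c) = atClass ξ c := by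
  induction c using Quotient.inductionOn with
  | h x => exact hξ x

theorem varInv_varInv (p : OddNat × ConjClasses Γ) : varInv Γ (varInv Γ p) = p :=
  Prod.ext rfl (invClass_involutive p.2)

theorem varWeight_varInv [Finite Γ] {ξ : classFun Γ} (hξ : ∀ x : Γ, ξ.1 x⁻¹ = ξ.1 x)
    (p : OddNat × ConjClasses Γ) : varWeight ξ (varInv Γ p) = varWeight ξ p := by
  obtain ⟨n, c⟩ := p
  simp only [varInv_apply, varWeight, zeta_invClass, atClass_invClass hξ]

/-- The form `⟨,⟩'_ξ` on the Fock space. -/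
def fockForm [Fintype Γ] (ξ : classFun Γ) : LinearMap.BilinForm ℂ (Fock Γ) :=
  (polyForm (varInv Γ) (varWeight ξ)).compl₁₂ (fockEquiv Γ).symm.toLinearMap
    (fockEquiv Γ).symm.toLinearMap

theorem fockForm_apply [Fintype Γ] (ξ : classFun Γ) (u v : Fock Γ) :
    fockForm ξ u v =
      polyForm (varInv Γ) (varWeight ξ) ((fockEquiv Γ).symm u) ((fockEquiv Γ).symm v) := rfl

/-- The second orthogonality relation restricts the sum over the group to the inverses of the
elements of `c`; the factor `ζ_c` and the size of the class then cancel the order of the group. This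
evaluates `a_n(γ)` on `a_{-n}(c)`. -/
theorem wForm_irr_sum [Fintype Γ] (ξ : classFun Γ) (γ : Irr Γ) (c : ConjClasses Γ) :
    ∑ α : Irr Γ, atClass α.1 (invClass c) * wForm ξ γ.1 α.1 =
      atClass ξ (invClass c) * atClass γ.1 (invClass c) := by
  classical
  have h : ∀ x : Γ, ∑ α : Irr Γ, atClass α.1 (invClass c) * (ξ.1 x * γ.1.1 x * α.1.1 x⁻¹) =
      if ConjClasses.mk x⁻¹ = c then
        (zeta c : ℂ) * (atClass ξ (invClass c) * atClass γ.1 (invClass c)) else 0 := by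
    intro x
    simp only [mul_left_comm _ (ξ.1 x * γ.1.1 x), ← Finset.mul_sum, sum_irr_mul]
    split_ifs with hx
    · rw [← hx]
      change _ = _ * (ξ.1 x⁻¹⁻¹ * γ.1.1 x⁻¹⁻¹)
      rw [inv_inv]
      ring
    · rw [mul_zero]
  simp only [wForm, mul_left_comm _ (Nat.card Γ : ℂ)⁻¹, ← Finset.mul_sum]
  simp only [Finset.mul_sum]
  rw [Finset.sum_comm]
  simp only [← Finset.mul_sum, h]
  rw [← Equiv.sum_comp (Equiv.inv Γ)]
  simp only [Equiv.inv_apply, inv_inv]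
  rw [← Finset.sum_filter, Finset.sum_const, nsmul_eq_mul, ← card_class_mul_zeta c]
  have hc : (Nat.card Γ : ℂ) ≠ 0 := by exact_mod_cast Nat.card_pos.ne'
  rw [← card_class_mul_zeta c, Nat.cast_mul] at hc
  rw [Nat.cast_mul, ← mul_assoc _ (zeta c : ℂ), ← mul_assoc, inv_mul_cancel₀ hc, one_mul]

/-- The annihilation operators in the class variables. -/
def classAnnihilation [Fintype Γ] (ξ : classFun Γ) (n : OddNat) (γ : Irr Γ) :
    ClassPoly Γ →ₗ[ℂ] ClassPoly Γ :=
  ∑ c : ConjClasses Γ, ((n.1 : ℂ) / 2 * (atClass ξ c * atClass γ.1 c)) •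
    (MvPolynomial.pderiv (n, invClass c)).toLinearMap

theorem classAnnihilation_mul [Fintype Γ] (ξ : classFun Γ) (n : OddNat) (γ : Irr Γ)
    (p q : ClassPoly Γ) : classAnnihilation ξ n γ (p * q) =
      p * classAnnihilation ξ n γ q + q * classAnnihilation ξ n γ p := by
  simp only [classAnnihilation, LinearMap.sum_apply, LinearMap.smul_apply,
    Derivation.coeFn_coe, Derivation.leibniz, smul_eq_mul, smul_add, Finset.sum_add_distrib,
    Finset.mul_sum, mul_smul_comm]

theorem heis_neg [Fintype Γ] (ξ : classFun Γ) (n : OddNat) (h : Odd (-(n.1 : ℤ))) (γ : Irr Γ)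
    (u : Fock Γ) : heis ξ (-(n.1 : ℤ)) h γ u = gen n γ * u := by
  have h0 := n.2.pos
  rw [heis, if_pos (by omega)]
  have : (⟨(-(n.1 : ℤ)).natAbs, Int.natAbs_odd.2 h⟩ : OddNat) = n := Subtype.ext (by simp)
  rw [this]
  rfl

theorem heis_pos_mul [Fintype Γ] (ξ : classFun Γ) (n : OddNat) (h : Odd (n.1 : ℤ)) (γ : Irr Γ)
    (u v : Fock Γ) : heis ξ n.1 h γ (u * v) =
      u * heis ξ n.1 h γ v + v * heis ξ n.1 h γ u := by
  rw [heis, if_neg (by omega)]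
  simp only [Derivation.coeFn_coe, Derivation.leibniz, smul_eq_mul]

theorem heis_pos_C [Fintype Γ] (ξ : classFun Γ) (n : OddNat) (h : Odd (n.1 : ℤ)) (γ : Irr Γ)
    (a : ℂ) : heis ξ n.1 h γ (MvPolynomial.C a) = 0 := by
  rw [heis, if_neg (by omega), Derivation.coeFn_coe]
  exact Derivation.map_algebraMap _ a

theorem heis_pos_gen [Fintype Γ] (ξ : classFun Γ) (n : OddNat) (h : Odd (n.1 : ℤ)) (γ : Irr Γ)
    (m : OddNat) (α : Irr Γ) : heis ξ n.1 h γ (gen m α) =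
      if m = n then MvPolynomial.C ((n.1 : ℂ) / 2 * wForm ξ γ.1 α.1) else 0 := by
  rw [heis, if_neg (by omega), Derivation.coeFn_coe, gen, MvPolynomial.mkDerivation_X]
  simp only [Nat.cast_inj, Subtype.ext_iff, Int.cast_natCast]

theorem heis_pos_genClass [Fintype Γ] (ξ : classFun Γ) (n : OddNat) (h : Odd (n.1 : ℤ))
    (γ : Irr Γ) (m : OddNat) (c : ConjClasses Γ) : heis ξ n.1 h γ (genClass m c) =
      if m = n then MvPolynomial.C ((n.1 : ℂ) / 2 *
        (atClass ξ (invClass c) * atClass γ.1 (invClass c))) else 0 := by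
  simp only [genClass, map_sum, map_smul, heis_pos_gen]
  split_ifs with hm
  · rw [← wForm_irr_sum, Finset.mul_sum, map_sum]
    refine Finset.sum_congr rfl fun α _ => ?_
    rw [← MvPolynomial.C_mul', ← MvPolynomial.C_mul]
    congr 1
    ring
  · simp

/-- Both operators obey the Leibniz rule and kill constants, so it suffices that they agree on the
variables. -/
theorem heis_pos_fockEquiv [Fintype Γ] (ξ : classFun Γ) (n : OddNat) (h : Odd (n.1 : ℤ))
    (γ : Irr Γ) (p : ClassPoly Γ) : heis ξ n.1 h γ (fockEquiv Γ p) =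
      fockEquiv Γ (classAnnihilation ξ n γ p) := by
  classical
  induction p using MvPolynomial.induction_on with
  | C a =>
    have h1 : fockEquiv Γ (MvPolynomial.C a) = MvPolynomial.C a :=
      (fockEquiv Γ).commutes a
    rw [h1, heis_pos_C]
    simp [classAnnihilation]
  | add p q hp hq => simp only [map_add, hp, hq]
  | mul_X p i hp =>
    obtain ⟨m, c⟩ := i
    rw [map_mul, heis_pos_mul, hp, classAnnihilation_mul, map_add, map_mul, map_mul, fockEquiv_X,
      heis_pos_genClass]
    congr 2
    simp only [classAnnihilation, LinearMap.sum_apply, LinearMap.smul_apply,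
      Derivation.coeFn_coe, MvPolynomial.pderiv_X, Pi.single_apply, Prod.mk.injEq]
    split_ifs with hm
    · subst hm
      simp only [true_and]
      have h2 : ∀ d : ConjClasses Γ, (c = invClass d) = (d = invClass c) := fun d =>
        propext ⟨fun h => by rw [h, invClass_involutive], fun h => by rw [h, invClass_involutive]⟩
      simp only [h2, smul_ite, smul_zero, Finset.sum_ite_eq', Finset.mem_univ, if_true]
      rw [← MvPolynomial.C_mul', mul_one]
      exact ((fockEquiv Γ).commutes _).symm
    · simp [hm]

/-- The factor `ζ_c⁻¹` in `irrPoly` cancels the `ζ_c` in `varWeight`; what remains is the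
coefficient `(n/2) ξ(c) γ(c)` of the derivative in the variable of `c⁻¹`. -/
theorem polyForm_irrPoly_mul [Fintype Γ] (ξ : classFun Γ) (n : OddNat) (γ : Irr Γ)
    (p q : ClassPoly Γ) :
    polyForm (varInv Γ) (varWeight ξ) (irrPoly n γ * p) q =
      polyForm (varInv Γ) (varWeight ξ) p (classAnnihilation ξ n γ q) := by
  simp only [irrPoly, classAnnihilation, Finset.sum_mul, map_sum, LinearMap.sum_apply,
    smul_mul_assoc, map_smul, LinearMap.smul_apply, polyForm_X_mul, Derivation.coeFn_coe,
    varInv_apply, smul_eq_mul]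
  refine Finset.sum_congr rfl fun c _ => ?_
  have := zeta_ne_zero c
  simp only [varWeight]
  field_simp

theorem fockForm_gen_mul [Fintype Γ] (ξ : classFun Γ) (n : OddNat) (h : Odd (n.1 : ℤ))
    (γ : Irr Γ) (u v : Fock Γ) :
    fockForm ξ (gen n γ * u) v = fockForm ξ u (heis ξ n.1 h γ v) := by
  obtain ⟨q, rfl⟩ := (fockEquiv Γ).surjective v
  rw [heis_pos_fockEquiv, fockForm_apply, fockForm_apply, map_mul, fockEquiv_symm_gen,
    AlgEquiv.symm_apply_apply, AlgEquiv.symm_apply_apply, polyForm_irrPoly_mul]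

theorem fockForm_symm [Fintype Γ] {ξ : classFun Γ} (hξ : ∀ x : Γ, ξ.1 x⁻¹ = ξ.1 x)
    (u v : Fock Γ) : fockForm ξ u v = fockForm ξ v u :=
  polyForm_symm _ _ varInv_varInv (varWeight_varInv hξ) _ _

/-- Adjointness for a creation operator in the left argument is `fockForm_gen_mul`; for an
annihilation operator it follows by symmetry of the form. This is where self-duality of `ξ` enters.
-/
theorem isFockForm_fockForm [Fintype Γ] {ξ : classFun Γ} (hξ : ∀ x : Γ, ξ.1 x⁻¹ = ξ.1 x) :
    IsFockForm ξ (fockForm ξ) := by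
  refine ⟨?_, fun n hn γ u v => ?_⟩
  · rw [fockForm_apply, map_one, polyForm_one_one]
  · have key : ∀ (k : OddNat) (h : Odd (k.1 : ℤ)) (h' : Odd (-(k.1 : ℤ))) (a b : Fock Γ),
        fockForm ξ (heis ξ (-(k.1 : ℤ)) h' γ a) b = fockForm ξ a (heis ξ k.1 h γ b) := by
      intro k h h' a b
      rw [heis_neg, fockForm_gen_mul ξ k h]
    rcases le_or_gt 0 n with h0 | h0
    · lift n to ℕ using h0
      have hk : Odd n := by exact_mod_cast hn
      rw [fockForm_symm hξ, fockForm_symm hξ u, key ⟨n, hk⟩ hn hn.neg]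
    · obtain ⟨k, rfl⟩ : ∃ k : ℕ, n = -(k : ℤ) := ⟨n.natAbs, by omega⟩
      have hk' : Odd (k : ℤ) := by simpa using hn
      have hk : Odd k := by exact_mod_cast hk'
      rw [key ⟨k, hk⟩ hk' hn]
      congr 2
      simp only [neg_neg]

/-- Generators in the left argument move to the right as annihilation operators until the left
argument is a constant. A generator on the right then moves back as an annihilation operator that
kills `1`, so everything is determined by `⟨1, 1⟩' = 1`. -/
theorem IsFockForm.eq_fockForm [Fintype Γ] {ξ : classFun Γ} (hξ : ∀ x : Γ, ξ.1 x⁻¹ = ξ.1 x)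
    {B : LinearMap.BilinForm ℂ (Fock Γ)} (hB : IsFockForm ξ B) : B = fockForm ξ := by
  have main : ∀ B B' : LinearMap.BilinForm ℂ (Fock Γ), IsFockForm ξ B → IsFockForm ξ B' →
      ∀ u v, B u v = B' u v := by
    intro B B' hB hB' u
    have hodd : ∀ n : OddNat, Odd (n.1 : ℤ) := fun n => by exact_mod_cast n.2
    have hgen : ∀ B : LinearMap.BilinForm ℂ (Fock Γ), IsFockForm ξ B → ∀ (n : OddNat) (γ : Irr Γ)
        (u v : Fock Γ), B (u * gen n γ) v = B u (heis ξ n.1 (hodd n) γ v) := by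
      intro B hB n γ u v
      have := hB.2 (-(n.1 : ℤ)) (hodd n).neg γ u v
      rw [heis_neg] at this
      rw [mul_comm, this]
      congr 2
      simp only [neg_neg]
    have hone : ∀ B : LinearMap.BilinForm ℂ (Fock Γ), IsFockForm ξ B → ∀ (n : OddNat) (γ : Irr Γ)
        (v : Fock Γ), B 1 (v * gen n γ) = 0 := by
      intro B hB n γ v
      have := hB.2 n.1 (hodd n) γ 1 v
      rw [heis_neg, ← MvPolynomial.C_1, heis_pos_C, map_zero, LinearMap.zero_apply,
        MvPolynomial.C_1] at this
      rw [mul_comm, ← this]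
    induction u using MvPolynomial.induction_on with
    | C a =>
      intro v
      have ha : (MvPolynomial.C a : Fock Γ) = a • 1 := by
        rw [MvPolynomial.smul_eq_C_mul, mul_one]
      rw [ha, map_smul, map_smul, LinearMap.smul_apply, LinearMap.smul_apply]
      congr 1
      induction v using MvPolynomial.induction_on with
      | C b =>
        have hb : (MvPolynomial.C b : Fock Γ) = b • 1 := by
          rw [MvPolynomial.smul_eq_C_mul, mul_one]
        rw [hb, map_smul, map_smul, hB.1, hB'.1]
      | add p q hp hq => rw [map_add, map_add, hp, hq]
      | mul_X p i _ => exact (hone B hB i.1 i.2 p).trans (hone B' hB' i.1 i.2 p).symm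
    | add p q hp hq =>
      intro v
      rw [map_add, map_add, LinearMap.add_apply, LinearMap.add_apply, hp, hq]
    | mul_X p i hp =>
      intro v
      exact ((hgen B hB i.1 i.2 p v).trans (hp _)).trans (hgen B' hB' i.1 i.2 p v).symm
  exact LinearMap.ext fun u => LinearMap.ext fun v =>
    main B _ hB (isFockForm_fockForm hξ) u v

end FockSpace

/-! ## The characteristic map -/

section CharacteristicMap

variable {Γ : Type u} [Group Γ]

theorem monomial_toFinsupp {σ : Type u} {_ : DecidableEq σ} (M : Multiset σ) :
    MvPolynomial.monomial (Multiset.toFinsupp M) (1 : ℂ) = (M.map MvPolynomial.X).prod := by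
  induction M using Multiset.induction_on with
  | empty => simp
  | cons a M ih =>
    rw [Multiset.map_cons, Multiset.prod_cons, ← ih, ← Multiset.singleton_add, map_add,
      Multiset.toFinsupp_singleton, MvPolynomial.X, MvPolynomial.monomial_mul, one_mul]

open Classical in
/-- The exponent of the monomial `a'_{-ρ}` in the variables `a_{-n}(c)`. -/
def OP.exponent [Finite Γ] (ρ : OP Γ) : OddNat × ConjClasses Γ →₀ ℕ :=
  ∑ c, Multiset.toFinsupp ((ρ c).map fun n => (n, c))

open Classical in
theorem OP.exponent_apply [Finite Γ] (ρ : OP Γ) (n : OddNat) (c : ConjClasses Γ) :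
    ρ.exponent (n, c) = (ρ c).count n := by
  rw [OP.exponent, Finsupp.finsetSum_apply, Finset.sum_eq_single c]
  · rw [Multiset.toFinsupp_apply, Multiset.count_map_eq_count' _ _ (Prod.mk_left_injective c)]
  · intro d _ hd
    rw [Multiset.toFinsupp_apply, Multiset.count_eq_zero]
    intro h
    obtain ⟨m, _, hm⟩ := Multiset.mem_map.1 h
    exact hd (congrArg Prod.snd hm)
  · exact fun h => absurd (Finset.mem_univ c) h

theorem OP.exponent_injective [Finite Γ] : Function.Injective (OP.exponent (Γ := Γ)) := by
  classical
  intro ρ ρ' h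
  refine funext fun c => Multiset.ext.2 fun n => ?_
  have h1 := DFunLike.congr_fun h (n, c)
  rw [OP.exponent_apply, OP.exponent_apply] at h1
  convert h1

theorem OP.exponent_add [Finite Γ] (ρ ρ' : OP Γ) :
    OP.exponent (ρ + ρ') = ρ.exponent + ρ'.exponent := by
  classical
  ext ⟨n, c⟩
  rw [Finsupp.add_apply, OP.exponent_apply, OP.exponent_apply, OP.exponent_apply, Pi.add_apply,
    Multiset.count_add]

theorem OP.exponent_surjective [Finite Γ] : Function.Surjective (OP.exponent (Γ := Γ)) := by
  classical
  intro s
  induction s using Finsupp.induction_linear with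
  | zero =>
    refine ⟨0, ?_⟩
    ext ⟨n, c⟩
    rw [OP.exponent_apply]
    simp
  | add s t hs ht =>
    obtain ⟨ρ, rfl⟩ := hs
    obtain ⟨ρ', rfl⟩ := ht
    exact ⟨ρ + ρ', OP.exponent_add ρ ρ'⟩
  | single i k =>
    obtain ⟨m, d⟩ := i
    refine ⟨Pi.single d (Multiset.replicate k m), ?_⟩
    ext ⟨n, c⟩
    rw [OP.exponent_apply, Finsupp.single_apply]
    by_cases hc : d = c
    · subst hc
      rw [Pi.single_eq_same, Multiset.count_replicate]
      simp
    · rw [Pi.single_eq_of_ne (Ne.symm hc)]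
      simp [hc]

theorem OP.exponent_bar [Finite Γ] (ρ : OP Γ) :
    ρ.exponent.equivMapDomain (varInv Γ) = ρ.bar.exponent := by
  classical
  ext i
  obtain ⟨⟨n, c⟩, rfl⟩ := (varInv Γ).surjective i
  rw [Finsupp.equivMapDomain_apply, Equiv.symm_apply_apply, varInv_apply, OP.exponent_apply,
    OP.exponent_apply, OP.bar, invClass_involutive]

theorem fockEquiv_monomial [Fintype Γ] (ρ : OP Γ) :
    fockEquiv Γ (MvPolynomial.monomial ρ.exponent 1) = aPrime ρ := by
  classical
  rw [OP.exponent, MvPolynomial.monomial_sum_one, map_prod, aPrime]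
  refine Finset.prod_congr (by congr) fun c _ => ?_
  rw [monomial_toFinsupp, map_multiset_prod, Multiset.map_map, Multiset.map_map]
  congr 1
  exact Multiset.map_congr rfl fun n _ => fockEquiv_X n c

/-- A part `n` of multiplicity `m` at `c` contributes `m! ((n/2) ζ_c ξ(c))^m`: the factors `n^m m!`
and `ζ_c^m` build `Z_ρ`, and the halves give `2^{-l(ρ)}`. -/
theorem monoWeight_exponent [Fintype Γ] (ξ : classFun Γ) (ρ : OP Γ) :
    monoWeight (varWeight ξ) ρ.exponent =
      ρ.Z / 2 ^ ρ.len * ∏ c, atClass ξ c ^ (ρ c).card := by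
  classical
  let T : Finset OddNat := Finset.univ.biUnion fun c => (ρ c).toFinset
  have hsub : ρ.exponent.support ⊆ T ×ˢ Finset.univ := by
    rintro ⟨n, c⟩ h
    rw [Finsupp.mem_support_iff, OP.exponent_apply] at h
    simp only [Finset.mem_product, Finset.mem_univ, and_true, T, Finset.mem_biUnion, true_and,
      Multiset.mem_toFinset]
    exact ⟨c, by_contra fun hn => h (by convert Multiset.count_eq_zero_of_notMem hn)⟩
  have hclass : ∀ c : ConjClasses Γ, ∏ n ∈ T, ((((ρ c).count n).factorial : ℂ) *
      varWeight ξ (n, c) ^ (ρ c).count n) =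
        (zPart (ρ c) * zeta c ^ (ρ c).card : ℕ) / 2 ^ (ρ c).card * atClass ξ c ^ (ρ c).card := by
    intro c
    have hT : (ρ c).toFinset ⊆ T :=
      Finset.subset_biUnion_of_mem (fun c => (ρ c).toFinset) (Finset.mem_univ c)
    rw [← Finset.prod_subset hT]
    · have hpow : ∀ a : ℂ, a ^ (ρ c).card = ∏ n ∈ (ρ c).toFinset, a ^ (ρ c).count n := fun a => by
        rw [Finset.prod_pow_eq_pow_sum, Multiset.toFinset_sum_count_eq]
      rw [zPart]
      push_cast
      rw [hpow, hpow, hpow, ← Finset.prod_mul_distrib, ← Finset.prod_div_distrib,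
        ← Finset.prod_mul_distrib]
      refine Finset.prod_congr (by congr) fun n _ => ?_
      simp only [varWeight, mul_pow, div_pow]
      ring
    · intro n _ hn
      rw [Multiset.count_eq_zero_of_notMem (by simpa using hn)]
      simp
  rw [monoWeight, Finsupp.prod_of_support_subset _ hsub _ (by simp), Finset.prod_product_right]
  simp only [OP.exponent_apply, hclass]
  rw [Finset.prod_mul_distrib, Finset.prod_div_distrib, OP.Z, OP.len, Finset.prod_pow_eq_pow_sum]
  push_cast
  rfl

/-- The coefficient of an element of the Fock space at `a'_{-ρ}`. -/
def fockCoeff [Fintype Γ] (ρ : OP Γ) : Fock Γ →ₗ[ℂ] ℂ :=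
  MvPolynomial.lcoeff ℂ ρ.exponent ∘ₗ (fockEquiv Γ).symm.toLinearMap

open Classical in
theorem fockCoeff_aPrime [Fintype Γ] (ρ ρ' : OP Γ) :
    fockCoeff ρ (aPrime ρ') = if ρ' = ρ then 1 else 0 := by
  rw [← fockEquiv_monomial]
  change MvPolynomial.coeff ρ.exponent ((fockEquiv Γ).symm (fockEquiv Γ _)) = _
  rw [AlgEquiv.symm_apply_apply, MvPolynomial.coeff_monomial]
  simp only [OP.exponent_injective.eq_iff]

theorem fockForm_aPrime [Fintype Γ] (ξ : classFun Γ) (ρ : OP Γ) (v : Fock Γ) :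
    fockForm ξ (aPrime ρ) v =
      ρ.Z / 2 ^ ρ.len * (∏ c, atClass ξ c ^ (ρ c).card) * fockCoeff ρ.bar v := by
  rw [← fockEquiv_monomial, fockForm_apply, AlgEquiv.symm_apply_apply, polyForm_monomial_left,
    monoWeight_exponent, OP.exponent_bar]
  rfl

theorem mem_of_aPrime_mem [Fintype Γ] {S : Submodule ℂ (Fock Γ)} (h : ∀ ρ : OP Γ, aPrime ρ ∈ S)
    (u : Fock Γ) : u ∈ S := by
  obtain ⟨p, rfl⟩ := (fockEquiv Γ).surjective u
  induction p using MvPolynomial.induction_on' with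
  | add p q hp hq => rw [map_add]; exact add_mem hp hq
  | monomial s a =>
    obtain ⟨ρ, rfl⟩ := OP.exponent_surjective s
    rw [← mul_one a, ← smul_eq_mul, ← MvPolynomial.smul_monomial, map_smul, fockEquiv_monomial]
    exact S.smul_mem a (h ρ)

variable (ε : ℕ → ℕ) {r : ℕ} (e : Fin r ≃ ConjClasses Γ)

theorem chN_apply [Fintype Γ] (n : ℕ) (f : Rminus Γ n) :
    chN ε e n f = ∑ ρ : OPn Γ n, (((Real.sqrt 2 : ℝ) : ℂ) ^ ρ.1.len / (ρ.1.Z : ℂ) *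
      f.1 (classRep ε e n ρ.1)) • aPrime ρ.1.bar := rfl

theorem ch_of [Fintype Γ] (n : ℕ) (f : Rminus Γ n) :
    ch ε e (DirectSum.of (fun n => Rminus Γ n) n f) = chN ε e n f :=
  DirectSum.toModule_lof ℂ (φ := chN ε e) n f

theorem fockCoeff_chN [Fintype Γ] (n : ℕ) (f : Rminus Γ n) (ρ : OP Γ) :
    fockCoeff ρ.bar (chN ε e n f) = if ρ.size = n then
      ((Real.sqrt 2 : ℝ) : ℂ) ^ ρ.len / (ρ.Z : ℂ) * f.1 (classRep ε e n ρ) else 0 := by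
  classical
  have hbar : ∀ ρ' : OP Γ, ρ'.bar = ρ.bar ↔ ρ' = ρ := fun ρ' =>
    ⟨fun h => by rw [← OP.bar_bar ρ', h, OP.bar_bar], fun h => by rw [h]⟩
  simp only [chN_apply, map_sum, map_smul, fockCoeff_aPrime, hbar, smul_eq_mul, mul_ite, mul_one,
    mul_zero]
  split_ifs with h
  · rw [Finset.sum_eq_single ⟨ρ, h⟩]
    · rw [if_pos rfl]
    · exact fun ρ' _ hne => if_neg fun h' => hne (Subtype.ext h')
    · exact fun h' => absurd (Finset.mem_univ _) h'
  · refine Finset.sum_eq_zero fun ρ' _ => if_neg ?_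
    rintro rfl
    exact h ρ'.2

/-- Each `a'_{-ρ̄}` occurs in a single degree, that of the size of `ρ`, so its coefficient reads off
the value of one component on `D_ρ^+`. As the scalar is nonzero, this yields injectivity. -/
theorem fockCoeff_ch [Fintype Γ] (u : RminusSum Γ) {n : ℕ} {ρ : OP Γ} (hρ : ρ.size = n) :
    fockCoeff ρ.bar (ch ε e u) =
      ((Real.sqrt 2 : ℝ) : ℂ) ^ ρ.len / (ρ.Z : ℂ) * (u n).1 (classRep ε e n ρ) := by
  subst hρ
  induction u using DirectSum.induction_on with
  | zero => simp
  | add u v hu hv =>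
    rw [map_add, map_add, hu, hv, DirectSum.add_apply, Submodule.coe_add, Pi.add_apply, mul_add]
  | of n f =>
    rw [ch_of, fockCoeff_chN]
    split_ifs with h
    · subst h
      rw [DirectSum.of_eq_same]
    · rw [DirectSum.of_eq_of_ne _ _ _ h]
      simp

theorem sqrt_two_pow_ne_zero (k : ℕ) : ((Real.sqrt 2 : ℝ) : ℂ) ^ k ≠ 0 := by
  refine pow_ne_zero _ ?_
  have : Real.sqrt 2 ≠ 0 := by positivity
  exact_mod_cast this

theorem OP.Z_cast_ne_zero [Finite Γ] (ρ : OP Γ) : (ρ.Z : ℂ) ≠ 0 := by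
  exact_mod_cast OP_Z_ne_zero ρ

theorem ch_injective [Fintype Γ] : Function.Injective (ch (Γ := Γ) ε e) := by
  intro u v h
  refine DFinsupp.ext fun n => Rminus.ext_classRep ε e fun ρ => ?_
  have h1 := fockCoeff_ch ε e u ρ.2
  rw [h, fockCoeff_ch ε e v ρ.2] at h1
  exact (mul_left_cancel₀ (div_ne_zero (sqrt_two_pow_ne_zero _) (OP.Z_cast_ne_zero _)) h1).symm

/-- The function with value 1 on `D_ρ̄^+` and 0 on the other classes goes to a nonzero multiple of
`a'_{-ρ}`, and these products span the Fock space. -/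
theorem ch_surjective [Fintype Γ] : Function.Surjective (ch (Γ := Γ) ε e) := by
  classical
  rw [← LinearMap.range_eq_top, Submodule.eq_top_iff']
  refine mem_of_aPrime_mem fun ρ => ?_
  obtain ⟨f, hf⟩ := Rminus.exists_classRep_eq ε e (⟨ρ.bar, rfl⟩ : OPn Γ ρ.bar.size)
  have h1 : ch ε e (DirectSum.of (fun n => Rminus Γ n) _ f) =
      (((Real.sqrt 2 : ℝ) : ℂ) ^ ρ.bar.len / (ρ.bar.Z : ℂ)) • aPrime ρ := by
    rw [ch_of, chN_apply, Finset.sum_eq_single ⟨ρ.bar, rfl⟩]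
    · rw [hf, if_pos rfl, mul_one, OP.bar_bar]
    · intro ρ' _ hne
      rw [hf, if_neg hne, mul_zero, zero_smul]
    · exact fun h' => absurd (Finset.mem_univ _) h'
  have h2 := div_ne_zero (sqrt_two_pow_ne_zero ρ.bar.len) (OP.Z_cast_ne_zero ρ.bar)
  rw [← inv_smul_smul₀ h2 (aPrime ρ), ← h1]
  exact Submodule.smul_mem _ _ (LinearMap.mem_range_self _ _)

/-- The term of `f` at `ρ` contains `a'_{-ρ̄}`, which pairs only with `a'_{-ρ}`, whose coefficient
in `ch v` is governed by the value of `v` at `ρ̄`, as in `wFormN_eq`. The scalars combine to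
`(2^{l/2}/Z)² · Z/2^l = 1/Z`, since `Z` and `l` are unchanged under `ρ ↦ ρ̄`. -/
theorem fockForm_chN_ch [Fintype Γ] (ξ : classFun Γ) (hξ : ∀ x : Γ, ξ.1 x⁻¹ = ξ.1 x) (n : ℕ)
    (f : Rminus Γ n) (v : RminusSum Γ) :
    fockForm ξ (chN ε e n f) (ch ε e v) = wFormN ξ n f (v n) := by
  rw [wFormN_eq ε e, chN_apply, map_sum, LinearMap.sum_apply]
  refine Finset.sum_congr rfl fun ρ _ => ?_
  have hprod : ∏ c, atClass ξ c ^ (ρ.1.bar c).card = ∏ c, atClass ξ c ^ (ρ.1 c).card := by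
    rw [← Equiv.prod_comp (classInv Γ)]
    refine Finset.prod_congr rfl fun c _ => ?_
    change atClass ξ (invClass c) ^ (ρ.1.bar.bar c).card = _
    rw [atClass_invClass hξ, OP.bar_bar]
  have hsq : ((Real.sqrt 2 : ℝ) : ℂ) ^ ρ.1.len * ((Real.sqrt 2 : ℝ) : ℂ) ^ ρ.1.len =
      2 ^ ρ.1.len := by
    rw [← mul_pow, ← Complex.ofReal_mul, Real.mul_self_sqrt (by norm_num)]
    norm_num
  have hZ := OP.Z_cast_ne_zero ρ.1
  rw [map_smul, LinearMap.smul_apply, smul_eq_mul, fockForm_aPrime,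
    fockCoeff_ch ε e v (ρ.1.size_bar.trans ρ.2), hprod, OP.Z_bar,
    OP.len_bar, ← hsq]
  have h2 := sqrt_two_pow_ne_zero ρ.1.len
  field_simp

theorem fockForm_ch [Fintype Γ] (ξ : classFun Γ) (hξ : ∀ x : Γ, ξ.1 x⁻¹ = ξ.1 x)
    (u v : RminusSum Γ) : fockForm ξ (ch ε e u) (ch ε e v) = wFormSum ξ u v := by
  classical
  have hu : ch ε e u = ∑ n ∈ DFinsupp.support u, chN ε e n (u n) := by
    conv_lhs => rw [← DirectSum.sum_support_of u]
    rw [map_sum]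
    exact Finset.sum_congr rfl fun n _ => ch_of ε e n (u n)
  rw [wFormSum, finsum_eq_sum_of_support_subset (s := DFinsupp.support u), hu, map_sum,
    LinearMap.sum_apply]
  · exact Finset.sum_congr rfl fun n _ => fockForm_chN_ch ε e ξ hξ n (u n) v
  · intro n hn
    rw [Finset.mem_coe, DFinsupp.mem_support_iff]
    intro h0
    apply hn
    simp [h0, wFormN]

end CharacteristicMap

end SpinWreath

end

theorem mainTheorem5 {Γ : Type*} [Group Γ] [Fintype Γ]
    (e : Fin (Nat.card (ConjClasses Γ)) ≃ ConjClasses Γ) (ε : ℕ → ℕ)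
    (ξ : SpinWreath.classFun Γ) (hξ : ∀ x : Γ, ξ.1 x⁻¹ = ξ.1 x) :
    (∃! B : LinearMap.BilinForm ℂ (SpinWreath.Fock Γ), SpinWreath.IsFockForm ξ B) ∧
    Function.Bijective (SpinWreath.ch (Γ := Γ) ε e) ∧
    ∀ B : LinearMap.BilinForm ℂ (SpinWreath.Fock Γ), SpinWreath.IsFockForm ξ B →
      ∀ u v : SpinWreath.RminusSum Γ,
        B (SpinWreath.ch ε e u) (SpinWreath.ch ε e v) = SpinWreath.wFormSum ξ u v := by
  refine ⟨⟨SpinWreath.fockForm ξ, SpinWreath.isFockForm_fockForm hξ, fun B hB =>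
    hB.eq_fockForm hξ⟩, ⟨SpinWreath.ch_injective ε e, SpinWreath.ch_surjective ε e⟩, ?_⟩
  intro B hB u v
  rw [hB.eq_fockForm hξ, SpinWreath.fockForm_ch ε e ξ hξ]
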